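/- **Setting.** Let $C=(C_{i,j})_{1\le i,j\le n}$ be a symmetrizable generalized Cartan matrix: $C_{i,j}\in\mathbb{Z}$, $C_{i,i}=2$, $C_{i,j}\le 0$ for $i\ne j$, $C_{i,j}=0\Leftrightarrow C_{j,i}=0$, together with integers $r_i\ge 1$ such that $B=(B_{i,j})=(r_iC_{i,j})$ is symmetric; put $I=\{1,\dots,n\}$. Let $(\mathfrak h,\{\alpha_i\},\{\alpha_i^\vee\})$ be a realization of $C$ over $\mathbb{Q}$: $\mathfrak h$ is a $\mathbb{Q}$-vector space of dimension $2n-\operatorname{rank} C$, the $\alpha_i\in\mathfrak h^*$ and the $\alpha_i^\vee\in\mathfrak h$ are linearly independent, and $\alpha_j(\alpha_i^\vee)=C_{i,j}$. Let $q=e^t\in\mathbb{C}^*$ be not a root of unity; rational powers of $q$ are $q^s=e^{st}$. Put $q_i=q^{r_i}$, $[l]_z=\frac{z^l-z^{-l}}{z-z^{-1}}$, and let $\left[{s\atop k}\right]_z$ be the corresponding $z$-binomial coefficients. The quantum affinization $\mathcal U_q(\hat{\mathfrak g})$ is the $\mathbb{C}$-algebra with generators $x_{i,r}^\pm$ ($i\in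 I$, $r\in\mathbb{Z}$), $k_h$ ($h\in\mathfrak h$), $h_{i,m}$ ($i\in I$, $m\in\mathbb{Z}\setminus\{0\}$) and relations $$k_hk_{h'}=k_{h+h'},\quad k_0=1,\quad [k_h,h_{j,m}]=0,\quad [h_{i,m},h_{j,m'}]=0,$$ $$k_hx_{j,r}^\pm k_{-h}=q^{\pm\alpha_j(h)}x_{j,r}^\pm,\qquad [h_{i,m},x_{j,r}^\pm]=\pm\tfrac1m[mB_{i,j}]_q\,x_{j,m+r}^\pm,$$ $$[x_{i,r}^+,x_{j,r'}^-]=\delta_{i,j}\frac{\phi_{i,r+r'}^+-\phi_{i,r+r'}^-}{q_i-q_i^{-1}},$$ $$x_{i,r+1}^\pm x_{j,r'}^\pm-q^{\pm B_{i,j}}x_{j,r'}^\pm x_{i,r+1}^\pm=q^{\pm B_{i,j}}x_{i,r}^\pm x_{j,r'+1}^\pm-x_{j,r'+1}^\pm x_{i,r}^\pm,$$ $$\sum_{\pi\in\Sigma_s}\sum_{k=0}^s(-1)^k\left[{s\atop k}\right]_{q_i}x_{i,r_{\pi(1)}}^\pm\cdots x_{i,r_{\pi(k)}}^\pm x_{j,r'}^\pm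 x_{i,r_{\pi(k+1)}}^\pm\cdots x_{i,r_{\pi(s)}}^\pm=0\quad(i\ne j,\ s=1-C_{i,j}),$$ where $\sum_{m\ge0}\phi_{i,\pm m}^\pm z^{\pm m}=k_{\pm r_i\alpha_i^\vee}\exp\bigl(\pm(q-q^{-1})\sum_{m'\ge1}h_{i,\pm m'}z^{\pm m'}\bigr)$, and $\phi_{i,m}^+=0$ for $m<0$, $\phi_{i,m}^-=0$ for $m>0$. Let $\mathcal C=\mathbb{C}((u))$, $\mathcal U_q'(\hat{\mathfrak g})=\mathcal C\otimes_{\mathbb{C}}\mathcal U_q(\hat{\mathfrak g})$ and $\mathcal U_q^u(\hat{\mathfrak g})=\mathbb{C}[u^{\pm}]\otimes_{\mathbb{C}}\mathcal U_q(\hat{\mathfrak g})\subset\mathcal U_q'(\hat{\mathfrak g})$. An $l,u$-weight is a pair $(\lambda,\Psi(u))$ with $\lambda\in\mathfrak h^*$ and $\Psi(u)=(\Psi_{i,\pm m}^\pm(u))_{i\in I,m\ge0}$, $\Psi_{i,\pm m}^\pm(u)\in\mathbb{C}[u^{\pm}]$, $\Psi_{i,0}^\pm(u)=q_i^{\pm\lambda(\alpha_i^\vee)}$.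 A highest weight vector of $l,u$-weight $(\lambda,\Psi(u))$ in a module over $\mathcal U_q'(\hat{\mathfrak g})$ is a nonzero $v$ with $x_{i,r}^+v=0$, $k_hv=q^{\lambda(h)}v$, $\phi_{i,\pm m}^\pm v=\Psi_{i,\pm m}^\pm(u)v$ for all $i\in I$, $r\in\mathbb{Z}$, $h\in\mathfrak h$, $m\ge0$. The Verma module $M(\lambda,\Psi(u))$ (resp. $M^u(\lambda,\Psi(u))$) is the quotient of $\mathcal U_q'(\hat{\mathfrak g})$ (resp. $\mathcal U_q^u(\hat{\mathfrak g})$) by the left ideal generated by the $x_{i,r}^+$, $k_h-q^{\lambda(h)}$, $\phi_{i,\pm m}^\pm-\Psi_{i,\pm m}^\pm(u)$. Let $L(\lambda,\Psi(u))$ be the quotient of $M(\lambda,\Psi(u))$ by the sum of its proper submodules. Let $L^u(\lambda,\Psi(u))$, the "simple" $\mathcal U_q^u(\hat{\mathfrak g})$-module of $l,u$-highest weight $(\lambda,\Psi(u))$, be the quotient of $M^u(\lambda,\Psi(u))$ by the sum of all its submodules that contain no nonzero vector of weight $\lambda$ (i.e. no $y\neq 0$ with $k_hy=q^{\lambda(h)}y$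 for all $h\in\mathfrak h$). (Since $\mathbb{C}[u^\pm]$ is not a field, $L^u$ is simple only in this relative sense.) A $\mathbb{C}[u^{\pm}]$-form of a $\mathcal U_q'(\hat{\mathfrak g})$-module $V$ is a $\mathcal U_q^u(\hat{\mathfrak g})$-submodule $N\subset V$ such that the natural map $\mathcal C\otimes_{\mathbb{C}[u^{\pm}]}N\to V$ is an isomorphism. **Proposition.** Let $(\lambda,\Psi(u))$ be an $l,u$-weight. 1. The class of $1$ is a highest weight vector of $l,u$-weight $(\lambda,\Psi(u))$ in $M(\lambda,\Psi(u))$ (in particular it is nonzero). For every highest weight vector $v$ of $l,u$-weight $(\lambda,\Psi(u))$ in $M(\lambda,\Psi(u))$, the $\mathcal U_q^u(\hat{\mathfrak g})$-module $\mathcal U_q^u(\hat{\mathfrak g}).v$ is a $\mathbb{C}[u^{\pm}]$-form of $M(\lambda,\Psi(u))$ and is isomorphic to $M^u(\lambda,\Psi(u))$. 2. The $\mathcal U_q'(\hat{\mathfrak g})$-module $L(\lambda,\Psi(u))$ is simple, and the class of $1$ is a highest weight vector of $l,u$-weight $(\lambda,\Psi(u))$ in it. For every highest weight vector $v$ of $l,u$-weight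 $(\lambda,\Psi(u))$ in $L(\lambda,\Psi(u))$, the $\mathcal U_q^u(\hat{\mathfrak g})$-module $\mathcal U_q^u(\hat{\mathfrak g}).v$ is a $\mathbb{C}[u^{\pm}]$-form of $L(\lambda,\Psi(u))$ and is isomorphic to $L^u(\lambda,\Psi(u))$. -/

import Mathlib

open scoped TensorProduct LaurentPolynomial PowerSeries LaurentSeries

namespace QAff

/-! ### Cartan matrices and realizations -/

/-- A symmetrizable generalized Cartan matrix `C` of size `n`, with a chosen symmetrization
`D = diag(r₁, …, rₙ)`, `rᵢ ≥ 1`, such that `B = D C` is symmetric. -/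
structure SymmetrizableGCM (n : ℕ) where
  C : Matrix (Fin n) (Fin n) ℤ
  diag : ∀ i, C i i = 2
  offDiag : ∀ i j, i ≠ j → C i j ≤ 0
  zero_iff : ∀ i j, C i j = 0 ↔ C j i = 0
  r : Fin n → ℕ
  r_pos : ∀ i, 0 < r i
  symm : ∀ i j, (r i : ℤ) * C i j = r j * C j i

/-- The entries of the symmetric matrix `B = D C`. -/
def SymmetrizableGCM.B {n : ℕ} (X : SymmetrizableGCM n) (i j : Fin n) : ℤ := X.r i * X.C i j

/-- A realization `(𝔥, Π, Π^∨)` of `C` over `ℚ`: `dim 𝔥 = 2n - rank C`, the simple roots and the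
simple coroots are linearly independent families, and `α_j(α_i^∨) = C_{i,j}`. -/
structure Realization {n : ℕ} (X : SymmetrizableGCM n)
    (𝔥 : Type*) [AddCommGroup 𝔥] [Module ℚ 𝔥] where
  root : Fin n → Module.Dual ℚ 𝔥
  coroot : Fin n → 𝔥
  finite : Module.Finite ℚ 𝔥
  finrank_add_rank : Module.finrank ℚ 𝔥 + (X.C.map (Int.cast : ℤ → ℚ)).rank = 2 * n
  root_linearIndependent : LinearIndependent ℚ root
  coroot_linearIndependent : LinearIndependent ℚ coroot
  root_coroot : ∀ i j, root j (coroot i) = X.C i j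

/-! ### `q`-numbers

The parameter is `q = exp t`; the choice of the logarithm `t` fixes the rational powers of `q`. -/

/-- The rational power `q ^ s = exp (s t)` of `q = exp t`. -/
noncomputable def qpow (t : ℂ) (s : ℚ) : ℂ := Complex.exp (s * t)

/-- `[l]_z = (z^l - z^{-l}) / (z - z^{-1})`. -/
noncomputable def qInt (z : ℂ) (l : ℤ) : ℂ := (z ^ l - z ^ (-l)) / (z - z⁻¹)

/-- `[m]_z! = [1]_z ⋯ [m]_z`. -/
noncomputable def qFactorial (z : ℂ) (m : ℕ) : ℂ := ∏ a ∈ Finset.range m, qInt z (a + 1)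

/-- The `z`-binomial coefficient `[s]_z! / ([k]_z! [s-k]_z!)` (used for `k ≤ s`). -/
noncomputable def qBinom (z : ℂ) (s k : ℕ) : ℂ :=
  qFactorial z s / (qFactorial z k * qFactorial z (s - k))

section Algebra

variable {n : ℕ} {X : SymmetrizableGCM n} {𝔥 : Type*} [AddCommGroup 𝔥] [Module ℚ 𝔥]

/-! ### The quantum affinization -/

/-- The generators `x_{i,r}^ε` (`ε = ±1`), `k_h` and `h_{i,m}` (`m ≠ 0`). -/
inductive Gen (n : ℕ) (𝔥 : Type*) : Type _
  | x (ε : ℤˣ) (i : Fin n) (r : ℤ) : Gen n 𝔥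
  | k (h : 𝔥) : Gen n 𝔥
  | h (i : Fin n) (m : {m : ℤ // m ≠ 0}) : Gen n 𝔥

/-- The free algebra on the generators. -/
abbrev Free (n : ℕ) (𝔥 : Type*) : Type _ := FreeAlgebra ℂ (Gen n 𝔥)

/-- `x_{i,r}^ε` in the free algebra. -/
def fx (𝔥 : Type*) (ε : ℤˣ) (i : Fin n) (r : ℤ) : Free n 𝔥 := FreeAlgebra.ι ℂ (Gen.x ε i r)

/-- `k_h` in the free algebra. -/
def fk (n : ℕ) (h : 𝔥) : Free n 𝔥 := FreeAlgebra.ι ℂ (Gen.k h)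

/-- `h_{i,m}`, `m ≠ 0`, in the free algebra. -/
def fh (𝔥 : Type*) (i : Fin n) (m : {m : ℤ // m ≠ 0}) : Free n 𝔥 := FreeAlgebra.ι ℂ (Gen.h i m)

/-- The series `∑_{m ≥ 1} h_{i, ε m} Z^m`, where `Z = z^ε`. -/
def hSeries (𝔥 : Type*) (ε : ℤˣ) (i : Fin n) : PowerSeries (Free n 𝔥) :=
  PowerSeries.mk fun m =>
    if hm : m = 0 then 0
    else fh 𝔥 i ⟨(ε : ℤ) * m, mul_ne_zero (Units.ne_zero ε) (Int.natCast_ne_zero.mpr hm)⟩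

/-- The coefficient of `Z^m` in `exp f = ∑_p f^p / p!`, for a series `f` without constant term
(so that only the terms with `p ≤ m` contribute). -/
noncomputable def expCoeff {A : Type*} [Ring A] [Algebra ℂ A] (f : PowerSeries A) (m : ℕ) : A :=
  ∑ p ∈ Finset.range (m + 1), ((p.factorial : ℂ)⁻¹) • PowerSeries.coeff m (f ^ p)

/-- `φ_{i, ε m}^ε` for `m ≥ 0`, in the free algebra: the coefficient of `z^{ε m}` in
`k_{ε rᵢ αᵢ^∨} exp (ε (q - q⁻¹) ∑_{m' ≥ 1} h_{i, ε m'} z^{ε m'})`. -/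
noncomputable def fphiNat (R : Realization X 𝔥) (t : ℂ) (ε : ℤˣ) (i : Fin n) (m : ℕ) : Free n 𝔥 :=
  fk n (((ε : ℤ) * (X.r i : ℤ)) • R.coroot i) *
    expCoeff ((((ε : ℤ) : ℂ) * (qpow t 1 - qpow t (-1))) • hSeries 𝔥 ε i) m

/-- `φ_{i,m}^ε` for `m ∈ ℤ`, in the free algebra; it is `0` if `ε m < 0`. -/
noncomputable def fphi (R : Realization X 𝔥) (t : ℂ) (ε : ℤˣ) (i : Fin n) (m : ℤ) : Free n 𝔥 :=
  if 0 ≤ (ε : ℤ) * m then fphiNat R t ε i m.natAbs else 0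

/-- The defining relations of the quantum affinization. -/
inductive Rel (R : Realization X 𝔥) (t : ℂ) : Free n 𝔥 → Free n 𝔥 → Prop
  | k_add (h h' : 𝔥) : Rel R t (fk n h * fk n h') (fk n (h + h'))
  | k_zero : Rel R t (fk n 0) 1
  | k_h (h : 𝔥) (j : Fin n) (m : {m : ℤ // m ≠ 0}) :
      Rel R t (fk n h * fh 𝔥 j m) (fh 𝔥 j m * fk n h)
  | h_h (i j : Fin n) (m m' : {m : ℤ // m ≠ 0}) :
      Rel R t (fh 𝔥 i m * fh 𝔥 j m') (fh 𝔥 j m' * fh 𝔥 i m)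
  | k_x (ε : ℤˣ) (h : 𝔥) (j : Fin n) (r : ℤ) :
      Rel R t (fk n h * fx 𝔥 ε j r * fk n (-h))
        (qpow t (((ε : ℤ) : ℚ) * R.root j h) • fx 𝔥 ε j r)
  | h_x (ε : ℤˣ) (i j : Fin n) (m : {m : ℤ // m ≠ 0}) (r : ℤ) :
      Rel R t (fh 𝔥 i m * fx 𝔥 ε j r - fx 𝔥 ε j r * fh 𝔥 i m)
        ((((ε : ℤ) : ℂ) * (1 / ((m : ℤ) : ℂ)) * qInt (qpow t 1) ((m : ℤ) * X.B i j)) •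
          fx 𝔥 ε j ((m : ℤ) + r))
  | x_x (i j : Fin n) (r r' : ℤ) :
      Rel R t (fx 𝔥 1 i r * fx 𝔥 (-1) j r' - fx 𝔥 (-1) j r' * fx 𝔥 1 i r)
        (if i = j then
          (qpow t (X.r i) - qpow t (-(X.r i)))⁻¹ •
            (fphi R t 1 i (r + r') - fphi R t (-1) i (r + r'))
        else 0)
  | quad (ε : ℤˣ) (i j : Fin n) (r r' : ℤ) :
      Rel R t
        (fx 𝔥 ε i (r + 1) * fx 𝔥 ε j r' -
          qpow t (((ε : ℤ) : ℚ) * X.B i j) • (fx 𝔥 ε j r' * fx 𝔥 ε i (r + 1)))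
        (qpow t (((ε : ℤ) : ℚ) * X.B i j) • (fx 𝔥 ε i r * fx 𝔥 ε j (r' + 1)) -
          fx 𝔥 ε j (r' + 1) * fx 𝔥 ε i r)
  | serre (ε : ℤˣ) (i j : Fin n) (hij : i ≠ j) (s : ℕ) (hs : (s : ℤ) = 1 - X.C i j)
      (r : Fin s → ℤ) (r' : ℤ) :
      Rel R t
        (∑ π : Equiv.Perm (Fin s), ∑ k ∈ Finset.range (s + 1),
          ((-1 : ℂ) ^ k * qBinom (qpow t (X.r i)) s k) •
            (((List.ofFn fun a => fx 𝔥 ε i (r (π a))).take k).prod * fx 𝔥 ε j r' *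
              ((List.ofFn fun a => fx 𝔥 ε i (r (π a))).drop k).prod))
        0

/-- The quantum affinization `U_q(ĝ)`, a `ℂ`-algebra. -/
def Uq (R : Realization X 𝔥) (t : ℂ) : Type _ := RingQuot (Rel R t)

noncomputable instance (R : Realization X 𝔥) (t : ℂ) : Ring (Uq R t) :=
  inferInstanceAs (Ring (RingQuot (Rel R t)))

noncomputable instance (R : Realization X 𝔥) (t : ℂ) : Algebra ℂ (Uq R t) :=
  inferInstanceAs (Algebra ℂ (RingQuot (Rel R t)))

/-- The projection from the free algebra onto `U_q(ĝ)`. -/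
noncomputable def toUq (R : Realization X 𝔥) (t : ℂ) : Free n 𝔥 →ₐ[ℂ] Uq R t :=
  RingQuot.mkAlgHom ℂ (Rel R t)

end Algebra

/-! ### The rings `ℂ[u^±] ⊂ ℂ((u))` -/

/-- `ℂ((u))` as a `ℂ`-algebra with coefficientwise scalar multiplication (Mathlib has a second,
propositionally equal instance; this makes the choice unambiguous). -/
noncomputable instance instAlgebraLaurentSeries : Algebra ℂ ℂ⸨X⸩ := HahnSeries.instAlgebra

/-- The embedding `ℂ[u^±] → ℂ((u))`, `u ↦ u`. -/
noncomputable def laurentIncl : ℂ[T;T⁻¹] →ₐ[ℂ] ℂ⸨X⸩ :=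
  AddMonoidAlgebra.lift ℂ (ℂ⸨X⸩) ℤ
    { toFun := fun m => HahnSeries.single m.toAdd (1 : ℂ)
      map_one' := rfl
      map_mul' := fun a b => by simp [HahnSeries.single_mul_single] }

noncomputable instance : Algebra ℂ[T;T⁻¹] ℂ⸨X⸩ := laurentIncl.toRingHom.toAlgebra

instance : IsScalarTower ℂ ℂ[T;T⁻¹] ℂ⸨X⸩ :=
  IsScalarTower.of_algebraMap_eq fun c => (laurentIncl.commutes c).symm

section Modules

variable {n : ℕ} {X : SymmetrizableGCM n} {𝔥 : Type*} [AddCommGroup 𝔥] [Module ℚ 𝔥]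

/-! ### Scalar extensions of `U_q(ĝ)` -/

/-- `K ⊗_ℂ U_q(ĝ)`. For `K = ℂ((u))` this is `U_q'(ĝ)`; for `K = ℂ[u^±]` it is `U_q^u(ĝ)`. -/
abbrev UK (R : Realization X 𝔥) (t : ℂ) (K : Type*) [CommRing K] [Algebra ℂ K] : Type _ :=
  K ⊗[ℂ] Uq R t

/-- The inclusion `U_q^u(ĝ) ⊂ U_q'(ĝ)`. -/
noncomputable def inclU (R : Realization X 𝔥) (t : ℂ) :
    UK R t ℂ[T;T⁻¹] →ₐ[ℂ[T;T⁻¹]] UK R t ℂ⸨X⸩ :=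
  Algebra.TensorProduct.map (Algebra.ofId ℂ[T;T⁻¹] ℂ⸨X⸩) (AlgHom.id ℂ (Uq R t))

/-- `U_q'(ĝ)` is a left `U_q^u(ĝ)`-module through the inclusion. The quotients of `U_q'(ĝ)` below
thereby become `U_q^u(ĝ)`-modules by restriction. -/
noncomputable instance (R : Realization X 𝔥) (t : ℂ) :
    Module (UK R t ℂ[T;T⁻¹]) (UK R t ℂ⸨X⸩) :=
  Module.compHom _ (inclU R t).toRingHom

theorem inclU_smul_def (R : Realization X 𝔥) (t : ℂ) (a : UK R t ℂ[T;T⁻¹]) (b : UK R t ℂ⸨X⸩) :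
    a • b = inclU R t a * b := rfl

instance (R : Realization X 𝔥) (t : ℂ) :
    IsScalarTower (UK R t ℂ[T;T⁻¹]) (UK R t ℂ⸨X⸩) (UK R t ℂ⸨X⸩) :=
  ⟨fun a b c => by simp only [inclU_smul_def, smul_eq_mul, mul_assoc]⟩

instance (R : Realization X 𝔥) (t : ℂ) :
    IsScalarTower ℂ[T;T⁻¹] (UK R t ℂ[T;T⁻¹]) (UK R t ℂ⸨X⸩) :=
  ⟨fun a b c => by simp only [inclU_smul_def, map_smul, smul_mul_assoc]⟩

/-! ### `l,u`-weights, Verma modules and simple modules -/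

/-- An `l,u`-weight `(λ, Ψ(u))`; `psi ε i m` is `Ψ_{i, ε m}^ε(u) ∈ ℂ[u^±]` for `m ≥ 0`. -/
structure LUWeight (R : Realization X 𝔥) (t : ℂ) where
  wt : Module.Dual ℚ 𝔥
  psi : ℤˣ → Fin n → ℕ → ℂ[T;T⁻¹]
  psi_zero : ∀ ε i,
    psi ε i 0 = LaurentPolynomial.C (qpow t (((ε : ℤ) : ℚ) * X.r i * wt (R.coroot i)))

variable {R : Realization X 𝔥} {t : ℂ}

section General

variable (K : Type*) [CommRing K] [Algebra ℂ K]

variable (R t) in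
/-- The image of `x_{i,r}^+` in `K ⊗ U_q(ĝ)`. -/
noncomputable def xPlus (i : Fin n) (r : ℤ) : UK R t K := 1 ⊗ₜ toUq R t (fx 𝔥 1 i r)

variable (R t) in
/-- The image of `k_h` in `K ⊗ U_q(ĝ)`. -/
noncomputable def kEl (h : 𝔥) : UK R t K := 1 ⊗ₜ toUq R t (fk n h)

variable (R t) in
/-- The image of `φ_{i, ε m}^ε`, `m ≥ 0`, in `K ⊗ U_q(ĝ)`. -/
noncomputable def phiEl (ε : ℤˣ) (i : Fin n) (m : ℕ) : UK R t K :=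
  1 ⊗ₜ toUq R t (fphi R t ε i ((ε : ℤ) * m))

variable [Algebra ℂ[T;T⁻¹] K]

/-- The element `Ψ_{i, ε m}^ε(u)` of `K`, as a scalar in `K ⊗ U_q(ĝ)`. -/
noncomputable def psiEl (w : LUWeight R t) (ε : ℤˣ) (i : Fin n) (m : ℕ) : UK R t K :=
  algebraMap K (UK R t K) (algebraMap ℂ[T;T⁻¹] K (w.psi ε i m))

/-- The scalar `q^{λ(h)}` in `K ⊗ U_q(ĝ)`. -/
noncomputable def wtEl (w : LUWeight R t) (h : 𝔥) : UK R t K :=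
  algebraMap K (UK R t K) (algebraMap ℂ K (qpow t (w.wt h)))

/-- `v` is a highest weight vector of `l,u`-weight `(λ, Ψ(u))`: it is nonzero, `x_{i,r}^+ v = 0`,
`k_h v = q^{λ(h)} v` and `φ_{i, ±m}^± v = Ψ_{i, ±m}^±(u) v`. -/
def IsHighestWeightVector (w : LUWeight R t) {V : Type*} [AddCommGroup V] [Module (UK R t K) V]
    (v : V) : Prop :=
  v ≠ 0 ∧ (∀ i r, xPlus R t K i r • v = 0) ∧ (∀ h, kEl R t K h • v = wtEl K w h • v) ∧
    ∀ ε i m, phiEl R t K ε i m • v = psiEl K w ε i m • v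

/-- The left ideal of `K ⊗ U_q(ĝ)` generated by the `x_{i,r}^+`, `k_h - q^{λ(h)}` and
`φ_{i, ±m}^± - Ψ_{i, ±m}^±(u)`. -/
noncomputable def vermaIdeal (w : LUWeight R t) : Submodule (UK R t K) (UK R t K) :=
  Submodule.span (UK R t K)
    ({y | ∃ i r, y = xPlus R t K i r} ∪ {y | ∃ h, y = kEl R t K h - wtEl K w h} ∪
      {y | ∃ ε i m, y = phiEl R t K ε i m - psiEl K w ε i m})

/-- The Verma module over `K ⊗ U_q(ĝ)` of highest weight `(λ, Ψ(u))`. -/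
abbrev Verma (w : LUWeight R t) : Type _ := UK R t K ⧸ vermaIdeal K w

/-- The class of `1` in the Verma module. -/
noncomputable def vermaGen (w : LUWeight R t) : Verma K w := Submodule.Quotient.mk 1

end General

/-- The sum of all proper submodules of the Verma `U_q'(ĝ)`-module `M(λ, Ψ(u))`. -/
noncomputable def maxProper (w : LUWeight R t) :
    Submodule (UK R t ℂ⸨X⸩) (Verma ℂ⸨X⸩ w) :=
  sSup {N | N ≠ ⊤}

/-- The simple `U_q'(ĝ)`-module `L(λ, Ψ(u))`, the quotient of `M(λ, Ψ(u))` by its largest proper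
submodule. -/
abbrev SimpleL (w : LUWeight R t) : Type _ := Verma ℂ⸨X⸩ w ⧸ maxProper w

/-- The sum of all submodules of the Verma `U_q^u(ĝ)`-module `M^u(λ, Ψ(u))` that have no nonzero
vector of weight `λ`. -/
noncomputable def maxNoTop (w : LUWeight R t) :
    Submodule (UK R t ℂ[T;T⁻¹]) (Verma ℂ[T;T⁻¹] w) :=
  sSup {N | ∀ y ∈ N,
    (∀ h, kEl R t ℂ[T;T⁻¹] h • y = wtEl ℂ[T;T⁻¹] w h • y) → y = 0}

/-- The simple `U_q^u(ĝ)`-module `L^u(λ, Ψ(u))` of `l,u`-highest weight `(λ, Ψ(u))`.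
As `ℂ[u^±]` is not a field, `(u - a) M^u(λ, Ψ(u))` is a proper submodule for every `a ≠ 0`, and the
role of the largest proper submodule is played by the largest submodule that has no nonzero vector
of weight `λ`. -/
abbrev SimpleLu (w : LUWeight R t) : Type _ := Verma ℂ[T;T⁻¹] w ⧸ maxNoTop w

/-- A sub-`U_q^u(ĝ)`-module `N` of a `U_q'(ĝ)`-module `V` is a `ℂ[u^±]`-form of `V` if
`ℂ((u)) ⊗_{ℂ[u^±]} N → V`, `f ⊗ y ↦ f y`, is bijective (this map is always `U_q'(ĝ)`-linear). All
actions on `V` are the ones induced by that of `U_q'(ĝ)`; this is expressed by the towers. -/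
def IsForm {V : Type*} [AddCommGroup V]
    [Module (UK R t ℂ⸨X⸩) V] [Module (UK R t ℂ[T;T⁻¹]) V] [Module ℂ⸨X⸩ V] [Module ℂ[T;T⁻¹] V]
    [IsScalarTower (UK R t ℂ[T;T⁻¹]) (UK R t ℂ⸨X⸩) V]
    [IsScalarTower ℂ⸨X⸩ (UK R t ℂ⸨X⸩) V]
    [IsScalarTower ℂ[T;T⁻¹] (UK R t ℂ[T;T⁻¹]) V] [IsScalarTower ℂ[T;T⁻¹] ℂ⸨X⸩ V]
    (N : Submodule (UK R t ℂ[T;T⁻¹]) V) : Prop :=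
  IsBaseChange ℂ⸨X⸩ (N.restrictScalars ℂ[T;T⁻¹]).subtype

end Modules

end QAff

/-! Everything rests on a form of the triangular decomposition: the Verma module is `K ⊗ CurrAlg`,
where `CurrAlg` is generated by the currents x⁻_{j,r} subject only to their own quadratic and Serre
relations. Rather than ordering monomials, the proof builds an action of U_q on `K ⊗ CurrAlg`. The
x⁻ act by left multiplication, k_h through a rescaling of the generators, and h_{i,m} through a
shift derivation plus an eigenvalue read off from the logarithmic derivative of Ψ. The operator
x⁺_{i,r} kills 1 and has prescribed commutator δ_{ij} ξ_{i,r+s} with x⁻_{j,s}. By `exists_operator`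
it exists as soon as replacing x⁻_i by ξ_i, one factor at a time, annihilates the quadratic and
Serre relations.

That contraction statement, `isContraction_xiMode`, is the technical heart. The exchange relation
between φ(w) and x(z) turns it into two q-binomial identities in the quantum plane x'x = p²xx',
`qSum_eq_zero` and `sum_geom_eq_zero`. The same mechanism gives the relations among the x⁺: each
relator kills 1 and commutes with all x⁻, hence is zero. The model is universal
(`exists_intertwiner`), so it is the Verma module (`vermaEv_bijective`).

Let `coef` be the coefficient of the generator. As q is not a root of unity, a polynomial in one k_δ
with α_j(δ) = 1 for all j cuts a given vector down to its generator component (`exists_projector`).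
Hence every submodule contains coef(v) times the generator for each of its elements v, vectors of
weight λ are multiples of the generator, and both submodules divided out, over ℂ((u)) and over
ℂ[u^±], equal {v : coef(Uv) = 0}. This description is compatible with extension of scalars, which
yields the isomorphisms with M^u and L^u.

The form property follows from `isBaseChange_subtype`: it suffices that N spans and that some
functionals separate the points of V and take values in ℂ[u^±] on N. For M these are coordinates in
a ℂ-basis of `CurrAlg`; for L they are v ↦ coef(pv), p ∈ U_q. -/

namespace QAff

/-! ### The Euler operator on power series over a noncommutative ring -/

section Euler

variable {A : Type*} [Ring A]

/-- The Euler operator `ζ d/dζ` on power series. -/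
noncomputable def euler (f : PowerSeries A) : PowerSeries A :=
  PowerSeries.mk fun m => m • PowerSeries.coeff m f

@[simp] theorem coeff_euler (f : PowerSeries A) (m : ℕ) :
    PowerSeries.coeff m (euler f) = m • PowerSeries.coeff m f := by
  simp [euler]

theorem euler_mul (f g : PowerSeries A) : euler (f * g) = euler f * g + f * euler g := by
  ext m
  simp only [coeff_euler, map_add, PowerSeries.coeff_mul, Finset.smul_sum, ← Finset.sum_add_distrib]
  refine Finset.sum_congr rfl fun x hx => ?_
  rw [← Finset.HasAntidiagonal.mem_antidiagonal.mp hx, add_smul, smul_mul_assoc, mul_smul_comm]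

theorem commute_euler {f : PowerSeries A}
    (hf : ∀ a b, Commute (PowerSeries.coeff a f) (PowerSeries.coeff b f)) :
    Commute f (euler f) := by
  change f * euler f = euler f * f
  ext m
  rw [PowerSeries.coeff_mul, PowerSeries.coeff_mul, ← Finset.Nat.sum_antidiagonal_swap]
  refine Finset.sum_congr rfl fun x _ => ?_
  simp only [Prod.fst_swap, Prod.snd_swap, coeff_euler, smul_mul_assoc, mul_smul_comm]
  rw [(hf x.2 x.1).eq]

theorem euler_pow_succ {f : PowerSeries A} (hf : Commute f (euler f)) (p : ℕ) :
    euler (f ^ (p + 1)) = (p + 1) • (euler f * f ^ p) := by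
  induction p with
  | zero => simp
  | succ p ih =>
    rw [pow_succ, euler_mul, ih, succ_nsmul (euler f * f ^ (p + 1)), smul_mul_assoc, mul_assoc,
      ← pow_succ, (hf.pow_left (p + 1)).eq]

theorem coeff_pow_eq_zero {f : PowerSeries A} (hf : PowerSeries.coeff 0 f = 0) {m p : ℕ}
    (h : m < p) : PowerSeries.coeff m (f ^ p) = 0 := by
  induction p generalizing m with
  | zero => omega
  | succ p ih =>
    rw [pow_succ', PowerSeries.coeff_mul]
    refine Finset.sum_eq_zero fun x hx => ?_
    have hx' := Finset.HasAntidiagonal.mem_antidiagonal.mp hx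
    rcases Nat.eq_zero_or_pos x.1 with h0 | h0
    · rw [h0, hf, zero_mul]
    · rw [ih (by omega), mul_zero]

/-- A linear equation ζF' = DF with D(0) = 0 determines F from its constant term: the m-th
coefficient of DF involves only lower coefficients of F, and m is invertible in ℂ. Identities
between exponential series are checked this way instead of being expanded. -/
theorem eq_of_euler_eq [Algebra ℂ A] {D F G : PowerSeries A} (hD : PowerSeries.coeff 0 D = 0)
    (hF : euler F = D * F) (hG : euler G = D * G)
    (h0 : PowerSeries.coeff 0 F = PowerSeries.coeff 0 G) : F = G := by
  ext m
  induction m using Nat.strong_induction_on with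
  | _ m ih =>
    rcases Nat.eq_zero_or_pos m with rfl | hm
    · exact h0
    · have h1 : m • PowerSeries.coeff m F = m • PowerSeries.coeff m G := by
        rw [← coeff_euler, ← coeff_euler, hF, hG, PowerSeries.coeff_mul, PowerSeries.coeff_mul]
        refine Finset.sum_congr rfl fun x hx => ?_
        have hx' := Finset.HasAntidiagonal.mem_antidiagonal.mp hx
        rcases Nat.eq_zero_or_pos x.1 with h0 | h0
        · rw [h0, hD, zero_mul, zero_mul]
        · rw [ih _ (by omega)]
      rw [← Nat.cast_smul_eq_nsmul ℂ, ← Nat.cast_smul_eq_nsmul ℂ] at h1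
      have hm' : (m : ℂ) ≠ 0 := by exact_mod_cast hm.ne'
      have := congrArg (fun z => (m : ℂ)⁻¹ • z) h1
      simpa [smul_smul, inv_mul_cancel₀ hm'] using this

variable [Algebra ℂ A]

/-- The series `exp f`. -/
noncomputable def expSeries (f : PowerSeries A) : PowerSeries A := PowerSeries.mk (expCoeff f)

@[simp] theorem coeff_expSeries (f : PowerSeries A) (m : ℕ) :
    PowerSeries.coeff m (expSeries f) = expCoeff f m := by
  simp [expSeries]

theorem expCoeff_eq_sum {f : PowerSeries A} (hf : PowerSeries.coeff 0 f = 0) {m N : ℕ}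
    (h : m < N) : expCoeff f m =
      ∑ p ∈ Finset.range N, ((p.factorial : ℂ)⁻¹) • PowerSeries.coeff m (f ^ p) := by
  refine Finset.sum_subset (Finset.range_mono h) fun p _ hp => ?_
  rw [coeff_pow_eq_zero hf (by simpa using hp), smul_zero]

@[simp] theorem expCoeff_zero (f : PowerSeries A) : expCoeff f 0 = 1 := by
  simp [expCoeff]

theorem euler_expSeries {f : PowerSeries A} (hf : PowerSeries.coeff 0 f = 0)
    (hc : ∀ a b, Commute (PowerSeries.coeff a f) (PowerSeries.coeff b f)) :
    euler (expSeries f) = euler f * expSeries f := by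
  ext m
  -- Truncating at m + 2 leaves, once the term p = 0 is split off, the range m + 1 used on the other
  -- side.
  rw [coeff_euler, coeff_expSeries, expCoeff_eq_sum hf (N := m + 2) (by omega),
    Finset.sum_range_succ', smul_add, Finset.smul_sum, PowerSeries.coeff_mul]
  have h0 : m • ((((0 : ℕ).factorial : ℂ)⁻¹) • PowerSeries.coeff m (f ^ 0)) = 0 := by
    rcases Nat.eq_zero_or_pos m with rfl | hm
    · simp
    · simp [PowerSeries.coeff_one, hm.ne']
  rw [h0, add_zero]
  have h1 : ∀ x ∈ Finset.HasAntidiagonal.antidiagonal m,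
      PowerSeries.coeff x.1 (euler f) * PowerSeries.coeff x.2 (expSeries f) =
      ∑ p ∈ Finset.range (m + 1), ((p.factorial : ℂ)⁻¹) •
        (PowerSeries.coeff x.1 (euler f) * PowerSeries.coeff x.2 (f ^ p)) := by
    intro x hx
    have hx' := Finset.HasAntidiagonal.mem_antidiagonal.mp hx
    rw [coeff_expSeries, expCoeff_eq_sum hf (N := m + 1) (by omega), Finset.mul_sum]
    simp only [mul_smul_comm]
  rw [Finset.sum_congr rfl h1, Finset.sum_comm]
  refine Finset.sum_congr rfl fun p _ => ?_
  rw [← Finset.smul_sum, ← PowerSeries.coeff_mul, smul_comm, ← coeff_euler,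
    euler_pow_succ (commute_euler hc), map_nsmul, ← Nat.cast_smul_eq_nsmul ℂ, smul_smul,
    Nat.factorial_succ]
  congr 1
  have : ((p : ℂ) + 1) ≠ 0 := by exact_mod_cast Nat.succ_ne_zero p
  push_cast
  field_simp

end Euler

/-! ### Commutation of exponential series with currents -/

section Current

variable {E : Type*} [Ring E] [Algebra ℂ E]

/-- The coefficients of `(b - ζ) / (1 - b ζ)`. -/
noncomputable def gCoeff (b : ℂ) : ℕ → ℂ
  | 0 => b
  | a + 1 => b ^ (a + 2) - b ^ a

/-- The series `∑ g_a ζ^a y_{r+a}`, where `∑ g_a ζ^a = (b - ζ) / (1 - b ζ)`. -/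
noncomputable def gSeries (b : ℂ) (y : ℤ → E) (r : ℤ) : PowerSeries E :=
  PowerSeries.mk fun a => gCoeff b a • y (r + a)

/-- The relation `(1 - b ζ τ) Φ(ζ) y = (b - ζ τ) y Φ(ζ)` (`τ` the shift of the string `y`), in the
form solved for `Φ(ζ) y`. -/
def SeriesRel (b : ℂ) (Φ : PowerSeries E) (y : ℤ → E) : Prop :=
  ∀ r, Φ * PowerSeries.C (y r) = gSeries b y r * Φ

/-- This is the logarithmic derivative of g = (b - ζ)/(1 - bζ): ζg'/g = ∑ (b^m - b^{-m}) ζ^m,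
compared coefficientwise after multiplication by g. -/
theorem gCoeff_recurrence {b : ℂ} (hb : b ≠ 0) (n : ℕ) :
    ∑ x ∈ Finset.HasAntidiagonal.antidiagonal n, (b ^ x.1 - (b⁻¹) ^ x.1) * gCoeff b x.2 = n * gCoeff b n := by
  rw [Finset.Nat.sum_antidiagonal_eq_sum_range_succ_mk]
  rcases n with _ | n
  · simp
  · rw [Finset.sum_range_succ, Finset.sum_range_succ']
    -- Each product is a constant plus a difference of consecutive terms in k, so the sum
    -- telescopes.
    have h : ∀ k ∈ Finset.range n, (b ^ (k + 1) - b⁻¹ ^ (k + 1)) * gCoeff b (n + 1 - (k + 1)) =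
        (b ^ (n + 2) - b ^ n) + (b ^ n * (b⁻¹ ^ (k + 1)) ^ 2 - b ^ n * (b⁻¹ ^ k) ^ 2) := by
      intro k hk
      obtain ⟨d, rfl⟩ : ∃ d, n = k + 1 + d := ⟨n - (k + 1), by grind⟩
      rw [show k + 1 + d + 1 - (k + 1) = d + 1 by omega, gCoeff]
      simp only [inv_pow]
      field_simp
      ring
    rw [Finset.sum_congr rfl h, Finset.sum_add_distrib, Finset.sum_range_sub
      (fun k => b ^ n * (b⁻¹ ^ k) ^ 2)]
    simp only [Finset.sum_const, Finset.card_range, nsmul_eq_mul, pow_zero, sub_self, zero_mul,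
      add_zero, inv_pow, show n + 1 - (n + 1) = 0 by omega, gCoeff]
    push_cast
    field_simp
    ring

/-- Both sides of the exchange relation solve the same equation ζY' = (ζf')Y with the same constant
term. For the right-hand side this amounts to [ζf', g] = ζg'. -/
theorem seriesRel_expSeries {b : ℂ} (hb : b ≠ 0) {f : PowerSeries E} {k : E} {y : ℤ → E}
    (hf : PowerSeries.coeff 0 f = 0)
    (hc : ∀ a c, Commute (PowerSeries.coeff a f) (PowerSeries.coeff c f))
    (hfy : ∀ (a : ℕ) (r : ℤ), a ≠ 0 →
      PowerSeries.coeff a f * y r - y r * PowerSeries.coeff a f =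
        ((b ^ a - b⁻¹ ^ a) / a) • y (r + a))
    (hkf : ∀ a, Commute k (PowerSeries.coeff a f)) (hk : ∀ r, k * y r = b • (y r * k)) :
    SeriesRel b (PowerSeries.C k * expSeries f) y := by
  intro r
  -- Each commutator shifts the string by the degree of f, so the n-th coefficient is a multiple of
  -- y (r + n) alone; the scalar is given by `gCoeff_recurrence`.
  have hcomm : euler f * gSeries b y r - gSeries b y r * euler f = euler (gSeries b y r) := by
    ext n
    rw [map_sub, PowerSeries.coeff_mul, PowerSeries.coeff_mul,
      ← Finset.Nat.sum_antidiagonal_swap (f := fun x => PowerSeries.coeff x.1 (gSeries b y r) * _),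
      ← Finset.sum_sub_distrib, coeff_euler]
    have h : ∀ x ∈ Finset.HasAntidiagonal.antidiagonal n,
        PowerSeries.coeff x.1 (euler f) * PowerSeries.coeff x.2 (gSeries b y r) -
          PowerSeries.coeff x.swap.1 (gSeries b y r) * PowerSeries.coeff x.swap.2 (euler f) =
        ((b ^ x.1 - b⁻¹ ^ x.1) * gCoeff b x.2) • y (r + n) := by
      intro x hx
      have hx' := Finset.HasAntidiagonal.mem_antidiagonal.mp hx
      simp only [Prod.fst_swap, Prod.snd_swap, coeff_euler, gSeries, PowerSeries.coeff_mk]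
      rcases Nat.eq_zero_or_pos x.1 with h0 | h0
      · simp [h0]
      · rw [smul_mul_assoc, mul_smul_comm, mul_smul_comm, smul_mul_assoc,
          ← smul_sub, ← smul_sub, hfy _ _ h0.ne', ← Nat.cast_smul_eq_nsmul ℂ, smul_smul, smul_smul,
          add_assoc, ← Nat.cast_add, add_comm x.2, hx']
        congr 1
        have : (x.1 : ℂ) ≠ 0 := by exact_mod_cast h0.ne'
        field_simp
    rw [Finset.sum_congr rfl h, ← Finset.sum_smul, gCoeff_recurrence hb, gSeries,
      PowerSeries.coeff_mk, mul_smul, Nat.cast_smul_eq_nsmul]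
  have hC : ∀ z : E, euler (PowerSeries.C z) = 0 := by
    intro z
    ext m
    rcases Nat.eq_zero_or_pos m with rfl | hm
    · simp
    · simp [PowerSeries.coeff_C, hm.ne']
  have hkD : PowerSeries.C k * euler f = euler f * PowerSeries.C k := by
    ext m
    rw [PowerSeries.coeff_C_mul, PowerSeries.coeff_mul_C, coeff_euler, mul_smul_comm,
      smul_mul_assoc, (hkf m).eq]
  have h1 : euler (PowerSeries.C k * expSeries f) = euler f * (PowerSeries.C k * expSeries f) := by
    rw [euler_mul, hC, zero_mul, zero_add, euler_expSeries hf hc, ← mul_assoc, hkD, mul_assoc]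
  refine eq_of_euler_eq (D := euler f) (by simp) ?_ ?_ ?_
  · rw [euler_mul, h1, hC, mul_zero, add_zero, mul_assoc]
  · rw [euler_mul, h1, ← hcomm, sub_mul, mul_assoc, mul_assoc, sub_add_cancel]
  · simp [PowerSeries.coeff_mul, gSeries, gCoeff, hk]

/-- Clearing the denominator: applying 1 - bζτ to the expansion of (b - ζτ)/(1 - bζτ) leaves only
two terms. -/
theorem seriesRel_mode {b : ℂ} {Φ : PowerSeries E} {y : ℤ → E} (h : SeriesRel b Φ y) (r : ℤ) :
    Φ * PowerSeries.C (y r) - b • (PowerSeries.X * (Φ * PowerSeries.C (y (r + 1)))) =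
      b • (PowerSeries.C (y r) * Φ) - PowerSeries.X * (PowerSeries.C (y (r + 1)) * Φ) := by
  have h1 : gSeries b y r - b • (PowerSeries.X * gSeries b y (r + 1)) =
      b • PowerSeries.C (y r) - PowerSeries.X * PowerSeries.C (y (r + 1)) := by
    ext m
    rcases m with _ | _ | m
    · simp [gSeries, gCoeff]
    · simp [gSeries, gCoeff, PowerSeries.coeff_succ_X_mul, sub_smul, smul_smul, pow_two]
    · simp only [gSeries, gCoeff, map_sub, PowerSeries.coeff_mk, PowerSeries.coeff_smul,
        PowerSeries.coeff_succ_X_mul, PowerSeries.coeff_C]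
      simp only [smul_smul, Nat.cast_add, Nat.cast_one, Nat.add_eq_zero_iff, one_ne_zero,
        and_false, if_false, smul_zero, sub_zero]
      rw [show r + 1 + ((m : ℤ) + 1) = r + (m + 1 + 1) by ring, ← sub_smul]
      ring_nf
      simp
  rw [h r, h (r + 1), ← mul_assoc, ← smul_mul_assoc, ← sub_mul, h1, sub_mul, smul_mul_assoc,
    mul_assoc]

/-- The coefficients of `Φ`, extended by zero to negative indices. -/
noncomputable def zCoeff (Φ : PowerSeries E) (m : ℤ) : E :=
  if 0 ≤ m then PowerSeries.coeff m.toNat Φ else 0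

/-- The relation `(w - b z) Φ(w) y(z) = (b w - z) y(z) Φ(w)` in modes. -/
def ModeRel (b : ℂ) (u y : ℤ → E) : Prop :=
  ∀ m r, u (m + 1) * y r - b • (u m * y (r + 1)) = b • (y r * u (m + 1)) - y (r + 1) * u m

theorem SeriesRel.modeRel {b : ℂ} {Φ : PowerSeries E} {y : ℤ → E} (h : SeriesRel b Φ y) :
    ModeRel b (zCoeff Φ) y := by
  intro m r
  have h2 := seriesRel_mode h r
  rcases lt_trichotomy m (-1) with hm | rfl | hm
  · simp [zCoeff, show ¬ (0 ≤ m) by omega, show ¬ (0 ≤ m + 1) by omega]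
  -- For m = -1 the terms of index m vanish, and what remains is the constant coefficient.
  · have := congrArg (PowerSeries.coeff 0) h2
    simpa [zCoeff] using this
  · obtain ⟨d, rfl⟩ : ∃ d : ℕ, m = d := ⟨m.toNat, by omega⟩
    have := congrArg (PowerSeries.coeff (d + 1)) h2
    simp only [map_sub, PowerSeries.coeff_mul_C, PowerSeries.coeff_smul,
      PowerSeries.coeff_succ_X_mul, PowerSeries.coeff_C_mul] at this
    simpa [zCoeff, show (0 : ℤ) ≤ d + 1 by omega, show ((d : ℤ) + 1).toNat = d + 1 by omega]
      using this

end Current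

/-! ### `q`-binomial coefficients -/

section QBinom

/-- `z` is neither zero nor a root of unity. -/
def Generic (z : ℂ) : Prop := z ≠ 0 ∧ ∀ m : ℕ, 0 < m → z ^ m ≠ 1

variable {p : ℂ}

/-- `z^k - z^{-k}`. -/
noncomputable def kap (p : ℂ) (k : ℕ) : ℂ := p ^ k - (p ^ k)⁻¹

theorem kap_ne_zero (hp : Generic p) {k : ℕ} (hk : k ≠ 0) : kap p k ≠ 0 := by
  intro h
  have h0 : p ^ k ≠ 0 := pow_ne_zero _ hp.1
  apply hp.2 (k + k) (by omega)
  rw [kap, sub_eq_zero] at h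
  rw [pow_add]
  nth_rw 1 [h]
  exact inv_mul_cancel₀ h0

theorem qInt_natCast (p : ℂ) (k : ℕ) : qInt p k = kap p k / kap p 1 := by
  simp [qInt, kap]

theorem qFactorial_ne_zero (hp : Generic p) (m : ℕ) : qFactorial p m ≠ 0 := by
  refine Finset.prod_ne_zero_iff.mpr fun a _ => ?_
  have : qInt p ((a + 1 : ℕ) : ℤ) ≠ 0 := by
    rw [qInt_natCast]
    exact div_ne_zero (kap_ne_zero hp (by omega)) (kap_ne_zero hp one_ne_zero)
  simpa using this

theorem qFactorial_succ (p : ℂ) (m : ℕ) :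
    qFactorial p (m + 1) = qFactorial p m * (kap p (m + 1) / kap p 1) := by
  rw [qFactorial, Finset.prod_range_succ, ← qFactorial, ← qInt_natCast]
  simp

@[simp] theorem qFactorial_zero (p : ℂ) : qFactorial p 0 = 1 := by simp [qFactorial]

theorem qBinom_zero_right (hp : Generic p) (s : ℕ) : qBinom p s 0 = 1 := by
  simp [qBinom, qFactorial_ne_zero hp]

theorem qBinom_self (hp : Generic p) (s : ℕ) : qBinom p s s = 1 := by
  simp [qBinom, qFactorial_ne_zero hp]

/-- The absorption rule for q-binomials. With `kap_mul_qBinom_succ'` it is the source of all index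
shifts below. -/
theorem kap_mul_qBinom_succ (hp : Generic p) (k d : ℕ) :
    kap p (k + 1) * qBinom p (k + d + 1) (k + 1) = kap p (k + d + 1) * qBinom p (k + d) k := by
  have h1 := qFactorial_ne_zero hp k
  have h2 := qFactorial_ne_zero hp d
  have h3 := kap_ne_zero hp (k := k + 1) (by omega)
  have h4 := kap_ne_zero hp (k := 1) (by omega)
  rw [qBinom, qBinom, show k + d + 1 - (k + 1) = d by omega, show k + d - k = d by omega,
    qFactorial_succ, qFactorial_succ]
  field_simp

theorem kap_mul_qBinom_succ' (hp : Generic p) (k d : ℕ) :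
    kap p (d + 1) * qBinom p (k + d + 1) k = kap p (k + d + 1) * qBinom p (k + d) k := by
  have h1 := qFactorial_ne_zero hp k
  have h2 := qFactorial_ne_zero hp d
  have h3 := kap_ne_zero hp (k := d + 1) (by omega)
  have h4 := kap_ne_zero hp (k := 1) (by omega)
  rw [qBinom, qBinom, show k + d + 1 - k = d + 1 by omega, show k + d - k = d by omega,
    qFactorial_succ, qFactorial_succ]
  field_simp

/-- The `q`-Pascal rule. -/
theorem qBinom_pascal (hp : Generic p) (k d : ℕ) :
    qBinom p (k + 1 + d + 1) (k + 1) =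
      p ^ (k + 1) * qBinom p (k + 1 + d) (k + 1) + (p ^ (d + 1))⁻¹ * qBinom p (k + 1 + d) k := by
  have h0 := hp.1
  have h3 := kap_ne_zero hp (k := k + 1 + d + 1) (by omega)
  have e1 := kap_mul_qBinom_succ hp k (d + 1)
  have e2 := kap_mul_qBinom_succ' hp (k + 1) d
  rw [show k + (d + 1) + 1 = k + 1 + d + 1 by omega, show k + (d + 1) = k + 1 + d by omega] at e1
  -- After multiplication by this factor the absorption rules make all three binomials comparable,
  -- and only this splitting remains.
  have e3 : kap p (k + 1 + d + 1) =
      p ^ (k + 1) * kap p (d + 1) + (p ^ (d + 1))⁻¹ * kap p (k + 1) := by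
    simp only [kap, pow_add, pow_one]
    field_simp
    ring
  apply mul_left_cancel₀ h3
  rw [mul_add, mul_left_comm, ← e2, mul_left_comm _ (p ^ (d + 1))⁻¹, ← e1]
  nth_rw 1 [e3]
  ring

theorem generic_inv (hp : Generic p) : Generic p⁻¹ :=
  ⟨inv_ne_zero hp.1, fun m hm h => hp.2 m hm (by rwa [inv_pow, inv_eq_one] at h)⟩

theorem qBinom_inv (p : ℂ) (s k : ℕ) : qBinom p⁻¹ s k = qBinom p s k := by
  have h : ∀ l, qInt p⁻¹ l = qInt p l := by
    intro l
    simp only [qInt, inv_zpow', neg_neg, inv_inv]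
    rw [← neg_sub, ← neg_sub p, neg_div_neg_eq]
  simp [qBinom, qFactorial, h]

end QBinom

/-! ### Identities in the quantum plane -/

section QuantumPlane

variable {E : Type*} [Ring E]

/-- `∑_{a < k} A^a B^{k-1-a}`. -/
def geom (A B : E) (k : ℕ) : E := ∑ a ∈ Finset.range k, A ^ a * B ^ (k - 1 - a)

theorem geom_succ (A B : E) (k : ℕ) : geom A B (k + 1) = geom A B k * B + A ^ k := by
  rw [geom, Finset.sum_range_succ, geom, Finset.sum_mul]
  congr 1
  · refine Finset.sum_congr rfl fun a ha => ?_
    rw [mul_assoc, ← pow_succ]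
    congr 2
    grind
  · simp

variable [Algebra ℂ E] {p : ℂ}

/-- `∑ (-1)^k [s k] A^k X B^{s-k}`. -/
noncomputable def qSum (p : ℂ) (s : ℕ) (A X B : E) : E :=
  ∑ k ∈ Finset.range (s + 1), ((-1 : ℂ) ^ k * qBinom p s k) • (A ^ k * X * B ^ (s - k))

theorem qSum_zero (hp : Generic p) (A X B : E) : qSum p 0 A X B = X := by
  simp [qSum, qBinom_self hp]

/-- The q-Pascal rule splits off either a last factor B or a first factor A; what is left is in both
cases the shorter sum with A rescaled by p. -/
theorem qSum_succ (hp : Generic p) (s : ℕ) (A X B : E) :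
    qSum p (s + 1) A X B =
      qSum p s (p • A) X B * B - (p ^ s)⁻¹ • (A * qSum p s (p • A) X B) := by
  have h0 := hp.1
  unfold qSum
  rw [Finset.sum_range_succ, Finset.sum_range_succ', Finset.sum_mul, Finset.mul_sum,
    Finset.smul_sum, Finset.sum_range_succ' (fun k => _ * B), Finset.sum_range_succ (fun k => _ • (A * _))]
  have h : ∀ k ∈ Finset.range s,
      ((-1 : ℂ) ^ (k + 1) * qBinom p (s + 1) (k + 1)) • (A ^ (k + 1) * X * B ^ (s + 1 - (k + 1))) =
      ((-1 : ℂ) ^ (k + 1) * qBinom p s (k + 1)) • ((p • A) ^ (k + 1) * X * B ^ (s - (k + 1))) * B -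
      (p ^ s)⁻¹ • (A * ((-1 : ℂ) ^ k * qBinom p s k) • ((p • A) ^ k * X * B ^ (s - k))) := by
    intro k hk
    obtain ⟨d, rfl⟩ : ∃ d, s = k + 1 + d := ⟨s - (k + 1), by grind⟩
    rw [qBinom_pascal hp, show k + 1 + d + 1 - (k + 1) = d + 1 by omega,
      show k + 1 + d - (k + 1) = d by omega, show k + 1 + d - k = d + 1 by omega]
    simp only [smul_pow, smul_mul_assoc, mul_smul_comm, smul_smul, mul_assoc, ← pow_succ]
    rw [← mul_assoc A, ← pow_succ', ← sub_smul]
    congr 1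
    rw [pow_add p (k + 1) d, pow_add p d]
    field_simp
    ring
  rw [Finset.sum_congr rfl h, Finset.sum_sub_distrib]
  simp only [qBinom_zero_right hp, qBinom_self hp, smul_pow, smul_mul_assoc, mul_smul_comm,
    smul_smul, mul_assoc, ← pow_succ, pow_zero, one_mul, one_smul, Nat.sub_self, Nat.sub_zero,
    mul_one]
  rw [← mul_assoc A, ← pow_succ', show (p ^ s)⁻¹ * ((-1) ^ s * p ^ s) = (-1) ^ s by field_simp,
    pow_succ (-1 : ℂ), mul_neg_one, neg_smul]
  abel

theorem pow_mul_of_qcomm {x x' : E} (h : x' * x = p ^ 2 • (x * x')) (j : ℕ) :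
    x' * x ^ j = (p ^ (2 * j)) • (x ^ j * x') := by
  induction j with
  | zero => simp
  | succ j ih =>
    rw [pow_succ, ← mul_assoc, ih, smul_mul_assoc, mul_assoc, h, mul_smul_comm, smul_smul,
      mul_assoc]
    congr 1
    ring

/-- The `q`-binomial identity governing the Serre sum with the outer current contracted. -/
theorem qSum_eq_zero (hp : Generic p) {x x' : E} (h : x' * x = p ^ 2 • (x * x')) {c : ℂ} {s : ℕ}
    (hc : c * p ^ s = 1) : qSum p (s + 1) (x - c • x') 1 (c • x - x') = 0 := by
  have h0 := hp.1
  -- Moving x' to the right of x^j costs p^{2j}, and the condition on d is exactly the vanishing of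
  -- the coefficient of x^j x'.
  have step : ∀ (j : ℕ) (d : ℂ), d * c * p ^ j = 1 →
      x ^ j * (c • x - x') - (p ^ j)⁻¹ • ((d • (x - c • x')) * x ^ j) =
        (c - (p ^ j)⁻¹ * d) • x ^ (j + 1) := by
    intro j d hd
    have e : (p ^ j)⁻¹ * (d * c * p ^ (2 * j)) = 1 := by
      rw [two_mul, pow_add]
      field_simp
      linear_combination hd
    simp only [mul_sub, sub_mul, smul_mul_assoc, mul_smul_comm, ← pow_succ, ← pow_succ',
      pow_mul_of_qcomm h, smul_sub, smul_smul, sub_smul]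
    linear_combination (norm := module) e • (x ^ j * x')
  -- The recursion replaces (j + 1, d) by (j, pd), so d c p^j is invariant. Its value p makes `step`
  -- applicable at each stage, and every partial sum is a multiple of a power of x.
  have key : ∀ (j : ℕ) (d : ℂ), d * c * p ^ j = p →
      ∃ P : ℂ, qSum p j (d • (x - c • x')) 1 (c • x - x') = P • x ^ j := by
    intro j
    induction j with
    | zero => exact fun d _ => ⟨1, by simp [qSum_zero hp]⟩
    | succ j ih =>
      intro d hd
      have hd' : d * c * p ^ j = 1 := by
        rw [pow_succ] at hd
        apply mul_right_cancel₀ h0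
        linear_combination hd
      obtain ⟨P, hP⟩ := ih (p * d) (by linear_combination p * hd')
      refine ⟨P * (c - (p ^ j)⁻¹ * d), ?_⟩
      rw [qSum_succ hp, smul_smul, hP, mul_smul, ← step j d hd', smul_mul_assoc, mul_smul_comm,
        smul_comm _ P, ← smul_sub]
  obtain ⟨P, hP⟩ := key s p (by linear_combination p * hc)
  rw [qSum_succ hp, hP, smul_mul_assoc, mul_smul_comm, smul_comm _ P, ← smul_sub]
  -- The last stage has d = 1, where the remaining scalar c - p^{-s} is zero.
  have := step s 1 (by linear_combination hc)
  rw [one_smul] at this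
  rw [this, show c - (p ^ s)⁻¹ * 1 = 0 by field_simp; linear_combination hc, zero_smul, smul_zero]

/-- `(z^k - z^{-k}) C^{k-1}`, understood as `0` for `k = 0`. -/
noncomputable def kapPow (p : ℂ) (C : E) : ℕ → E
  | 0 => 0
  | k + 1 => kap p (k + 1) • C ^ k

@[simp] theorem kapPow_zero (p : ℂ) (C : E) : kapPow p C 0 = 0 := rfl

theorem kapPow_succ (p : ℂ) (C : E) (k : ℕ) : kapPow p C (k + 1) = kap p (k + 1) • C ^ k := rfl

theorem kapPow_mul (p : ℂ) (C : E) (k : ℕ) : kapPow p C k * C = kap p k • C ^ k := by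
  rcases k with _ | k
  · simp [kapPow, kap]
  · simp [kapPow, pow_succ]

theorem mul_kapPow (p : ℂ) (C : E) (k : ℕ) : C * kapPow p C k = kap p k • C ^ k := by
  rcases k with _ | k
  · simp [kapPow, kap]
  · simp [kapPow, pow_succ']

section

variable {x x' : E} (h : x' * x = p ^ 2 • (x * x'))

include h

/-- Since x'(x - p²x') = p²(x - x')x', a single x' can be carried to the far right. Together with
`pow_eq_right` this writes powers of A = x - p²x' and B = p²x - x' through powers of the one element
C = x - x'. -/
theorem pow_eq_left (hp0 : p ≠ 0) (k : ℕ) : (x - p ^ 2 • x') ^ k =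
    (x - x') ^ k - p ^ k • (kapPow p (x - x') k * x') := by
  have h1 : x' * (x - p ^ 2 • x') = p ^ 2 • ((x - x') * x') := by
    rw [mul_sub, h, mul_smul_comm, ← smul_sub, sub_mul]
  induction k with
  | zero => simp [kapPow]
  | succ k ih =>
    rw [pow_succ, ih, sub_mul, smul_mul_assoc, mul_assoc, h1, mul_smul_comm, ← mul_assoc,
      kapPow_mul, kapPow, pow_succ (x - x')]
    simp only [mul_sub, smul_mul_assoc, mul_smul_comm, smul_smul]
    have e : p ^ (k + 1) * kap p (k + 1) - (p ^ k * (p ^ 2 * kap p k)) - p ^ 2 + 1 = 0 := by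
      simp only [kap, pow_succ]
      field_simp
      ring
    linear_combination (norm := module) e • ((x - x') ^ k * x')

theorem pow_eq_right (hp0 : p ≠ 0) (k : ℕ) : (p ^ 2 • x - x') ^ k =
    p ^ (2 * k) • (x - x') ^ k + p ^ k • (x' * kapPow p (x - x') k) := by
  have h1 : (p ^ 2 • x - x') * x' = x' * (x - x') := by
    rw [mul_sub, h, sub_mul, smul_mul_assoc]
  induction k with
  | zero => simp [kapPow]
  | succ k ih =>
    rw [pow_succ', ih, mul_add, mul_smul_comm _ _ (x' * _), ← mul_assoc, h1, mul_assoc,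
      mul_kapPow, kapPow, pow_succ' (x - x')]
    simp only [sub_mul, smul_mul_assoc, mul_smul_comm, smul_smul]
    have e : p ^ (k + 1) * kap p (k + 1) - p ^ (2 * (k + 1)) + p ^ (2 * k) - p ^ k * kap p k = 0 := by
      simp only [kap, pow_succ, mul_add, two_mul, pow_add]
      field_simp
      ring
    linear_combination (norm := module) (-e) • (x' * (x - x') ^ k)

/-- In the inductive step the terms ending in x' coming from A^k and from B cancel, so the mixed sum
collapses to p^{k-1} [k]_p C^{k-1}. -/
theorem geom_eq (hp0 : p ≠ 0) (k : ℕ) :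
    (p * kap p 1) • geom (x - p ^ 2 • x') (p ^ 2 • x - x') k = p ^ k • kapPow p (x - x') k := by
  induction k with
  | zero => simp [kapPow, geom]
  | succ k ih =>
    have h1 : p ^ 2 • x - x' = p ^ 2 • (x - x') + (p ^ 2 - 1) • x' := by module
    rw [geom_succ, smul_add, ← smul_mul_assoc, ih, pow_eq_left h hp0, h1, mul_add, smul_mul_assoc,
      mul_smul_comm, kapPow_mul, kapPow]
    have e1 : p * kap p 1 = p ^ 2 - 1 := by
      simp only [kap]
      field_simp
    have e2 : p ^ (k + 1) * kap p (k + 1) - p ^ k * (p ^ 2 * kap p k) - p ^ 2 + 1 = 0 := by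
      simp only [kap, pow_succ]
      field_simp
      ring
    simp only [sub_mul, smul_mul_assoc, mul_smul_comm, smul_smul, e1]
    linear_combination (norm := module) (-e2) • (x - x') ^ k

/-- The `q`-binomial identity governing the Serre sum with an inner current contracted. -/
theorem sum_geom_eq_zero (hp : Generic p) {X X' : E} {c : ℂ} {N : ℕ} (hc : c * p ^ N = 1)
    (hX : x' * X - c • (X * x') = c • (x * X') - X' * x) :
    ∑ k ∈ Finset.range (N + 2), ((-1 : ℂ) ^ k * qBinom p (N + 1) k) •
      (geom (x - p ^ 2 • x') (p ^ 2 • x - x') k * (c • X - X') * (p ^ 2 • x - x') ^ (N + 1 - k) +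
        (x - p ^ 2 • x') ^ k * (X - c • X') *
          geom (x - p ^ 2 • x') (p ^ 2 • x - x') (N + 1 - k)) = 0 := by
  have h0 := hp.1
  set A := x - p ^ 2 • x' with hA
  set B := p ^ 2 • x - x' with hB
  set C := x - x' with hC
  set W := x' * X - c • (x * X') with hW
  -- W is the obstruction to exchanging (x, x') with (X, X'). By `hX` it has two forms, with x and
  -- x' on the left or on the right, and each side of C^k … C^M uses one of them.
  have hW' : c • (X * x') - X' * x = W := by
    rw [hW]
    linear_combination (norm := module) (-1 : ℂ) • hX
  -- Once A^k and B^M are expressed through C, the terms C^k X C^M and C^k X' C^M cancel because c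
  -- p^N = 1; only W survives.
  have term : ∀ k M, k + M = N → p ^ M • (A ^ k * (X - c • X') * C ^ M) -
      p ^ k • (C ^ k * (c • X - X') * B ^ M) =
      (-p ^ N) • (kapPow p C k * W * C ^ M + C ^ k * W * kapPow p C M) := by
    rintro k M rfl
    have e1 := kapPow_mul p C k
    have e2 := mul_kapPow p C M
    rw [hA, hB, pow_eq_left h h0, pow_eq_right h h0, ← hC]
    generalize kapPow p C k = Pk at *
    generalize kapPow p C M = PM at *
    have f1 : Pk * x * X' * C ^ M - Pk * x' * X' * C ^ M = kap p k • (C ^ k * X' * C ^ M) := by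
      rw [← sub_mul, ← sub_mul, ← mul_sub, ← hC, e1, smul_mul_assoc, smul_mul_assoc]
    have f2 : C ^ k * X' * x * PM - C ^ k * X' * x' * PM = kap p M • (C ^ k * X' * C ^ M) := by
      rw [← sub_mul, ← mul_sub, ← hC, mul_assoc _ C, e2, mul_smul_comm]
    have hc' : c = (p ^ (k + M))⁻¹ := eq_inv_of_mul_eq_one_left hc
    have hs : p ^ (k + M) * p ^ M - p ^ M * c - p ^ (k + M) * c * kap p k -
        p ^ (k + M) * kap p M = 0 := by
      rw [hc']
      simp only [kap, pow_add]
      field_simp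
      ring
    have hs2 : p ^ (k + M) * p ^ M * c = p ^ M := by linear_combination p ^ M * hc
    rw [smul_add, show C ^ k * W * PM = C ^ k * (c • (X * x') - X' * x) * PM by rw [hW'], hW]
    simp only [mul_sub, sub_mul, mul_add, smul_mul_assoc, mul_smul_comm, ← mul_assoc,
      smul_sub, smul_add, smul_smul]
    linear_combination (norm := module) (-hs2) • (C ^ k * X * C ^ M) + hs • (C ^ k * X' * C ^ M) -
      (p ^ (k + M) * c) • f1 - p ^ (k + M) • f2
  -- The left term at k + 1 cancels the right term at k, since the two absorption rules have the
  -- same right-hand side and the signs are opposite.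
  have cancel : ∑ k ∈ Finset.range (N + 1), ((-1 : ℂ) ^ k * qBinom p N k) •
      (kapPow p C k * W * C ^ (N - k) + C ^ k * W * kapPow p C (N - k)) = 0 := by
    simp only [smul_add, Finset.sum_add_distrib]
    rw [Finset.sum_range_succ', Finset.sum_range_succ (fun k => _ • (C ^ k * W * _)), Nat.sub_self]
    simp only [kapPow_zero, kapPow_succ, zero_mul, mul_zero, smul_zero, add_zero]
    rw [← Finset.sum_add_distrib]
    refine Finset.sum_eq_zero fun k hk => ?_
    obtain ⟨d, rfl⟩ : ∃ d, N = k + d + 1 := ⟨N - (k + 1), by grind⟩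
    rw [show k + d + 1 - (k + 1) = d by omega, show k + d + 1 - k = d + 1 by omega, kapPow_succ,
      smul_mul_assoc, smul_mul_assoc, mul_smul_comm, smul_smul, smul_smul, ← add_smul]
    have e := (kap_mul_qBinom_succ hp k d).trans (kap_mul_qBinom_succ' hp k d).symm
    rw [show (-1 : ℂ) ^ (k + 1) * qBinom p (k + d + 1) (k + 1) * kap p (k + 1) +
      (-1) ^ k * qBinom p (k + d + 1) k * kap p (d + 1) = 0 by
        linear_combination (-1 : ℂ) ^ (k + 1) * e, zero_smul]
  have hk1 : p * kap p 1 ≠ 0 := mul_ne_zero h0 (kap_ne_zero hp one_ne_zero)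
  -- Each geometric sum becomes a power of C. Shifting the index in the first half and absorbing the
  -- q-numbers merges both halves into one sum with binomials of order N.
  have main : (p * kap p 1) • ∑ k ∈ Finset.range (N + 2), ((-1 : ℂ) ^ k * qBinom p (N + 1) k) •
      (geom A B k * (c • X - X') * B ^ (N + 1 - k) + A ^ k * (X - c • X') * geom A B (N + 1 - k)) =
      (p * kap p (N + 1)) • ∑ k ∈ Finset.range (N + 1), ((-1 : ℂ) ^ k * qBinom p N k) •
        (p ^ (N - k) • (A ^ k * (X - c • X') * C ^ (N - k)) -
          p ^ k • (C ^ k * (c • X - X') * B ^ (N - k))) := by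
    have g := geom_eq h h0
    rw [← hA, ← hB, ← hC] at g
    rw [Finset.smul_sum, Finset.sum_congr (s₁ := Finset.range (N + 2)) rfl fun k _ => by
      rw [smul_comm, smul_add, ← smul_mul_assoc, ← smul_mul_assoc, g, ← mul_smul_comm, g]]
    simp only [smul_add, Finset.sum_add_distrib]
    rw [Finset.sum_range_succ', Finset.sum_range_succ (fun k => _ • (A ^ k * _ * _)), Nat.sub_self]
    simp only [kapPow_zero, kapPow_succ, zero_mul, mul_zero, smul_zero, add_zero]
    rw [← Finset.sum_add_distrib, Finset.smul_sum]
    refine Finset.sum_congr rfl fun k hk => ?_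
    obtain ⟨d, rfl⟩ : ∃ d, N = k + d := ⟨N - k, by grind⟩
    rw [show k + d + 1 - (k + 1) = d by omega, show k + d + 1 - k = d + 1 by omega,
      show k + d - k = d by omega, kapPow_succ]
    have e1 := kap_mul_qBinom_succ hp k d
    have e2 := kap_mul_qBinom_succ' hp k d
    simp only [smul_mul_assoc, mul_smul_comm]
    linear_combination (norm := module)
      ((-1 : ℂ) ^ (k + 1) * p ^ (k + 1) * e1) • (C ^ k * (c • X - X') * B ^ d) +
      ((-1 : ℂ) ^ k * p ^ (d + 1) * e2) • (A ^ k * (X - c • X') * C ^ d)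
  have h2 := main
  rw [Finset.sum_congr (s₁ := Finset.range (N + 1)) rfl fun k hk => by
    rw [term k (N - k) (by grind), smul_comm _ (-p ^ N)], ← Finset.smul_sum, cancel, smul_zero,
    smul_zero] at h2
  exact (smul_eq_zero_iff_right hk1).mp h2

end

end QuantumPlane

/-! ### Contraction of a current in the Serre sum: generating series -/

section Strings

variable {E : Type*} [Ring E] [Algebra ℂ E]

/-- The relation `(z - b w) y(z) y'(w) = (b z - w) y'(w) y(z)` in modes. -/
def QuadString (b : ℂ) (y y' : ℤ → E) : Prop :=
  ∀ r r', y (r + 1) * y' r' - b • (y' r' * y (r + 1)) = b • (y r * y' (r' + 1)) - y' (r' + 1) * y r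

/-- The series `∑ b^a ζ^a y_a`. -/
noncomputable def resolv (b : ℂ) (y : ℤ → E) : PowerSeries E := PowerSeries.mk fun a => b ^ a • y a

/-- The series `ζ ∑ b^a ζ^a y_{a+1}`. -/
noncomputable def resolv' (b : ℂ) (y : ℤ → E) : PowerSeries E :=
  PowerSeries.X * resolv b fun r => y (r + 1)

/-- Here `resolv` is x = (1 - bζτ)⁻¹ y and `resolv'` is x' = ζτ(1 - bζτ)⁻¹ y. With
`gSeries_eq_resolv`, moving Φ past y_0 replaces x - bx' by bx - x', the shape met in the
quantum-plane identities. -/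
theorem C_eq_resolv (b : ℂ) (y : ℤ → E) :
    PowerSeries.C (y 0) = resolv b y - b • resolv' b y := by
  ext m
  rcases m with _ | m
  · simp [resolv, resolv']
  · simp [resolv, resolv', PowerSeries.coeff_C, PowerSeries.coeff_succ_X_mul, smul_smul, pow_succ']

theorem gSeries_eq_resolv (b : ℂ) (y : ℤ → E) :
    gSeries b y 0 = b • resolv b y - resolv' b y := by
  ext m
  rcases m with _ | m
  · simp [resolv, resolv', gSeries, gCoeff]
  · simp only [gSeries, gCoeff, resolv, resolv', map_sub, PowerSeries.coeff_mk,
      PowerSeries.coeff_smul, PowerSeries.coeff_succ_X_mul, smul_smul, zero_add, sub_smul]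
    push_cast
    ring_nf

/-- The mode relations at (a, a'), weighted by b^a b'^{a'} and summed over a + a' = n; one variable
ζ serves both strings. -/
theorem resolv_quad {c : ℂ} {y y' : ℤ → E} (h : QuadString c y y') (b b' : ℂ) :
    resolv' b y * resolv b' y' - c • (resolv b' y' * resolv' b y) =
      c • (resolv b y * resolv' b' y') - resolv' b' y' * resolv b y := by
  have hX : ∀ f g : PowerSeries E, f * (PowerSeries.X * g) = PowerSeries.X * (f * g) := by
    intro f g
    rw [← mul_assoc, (PowerSeries.commute_X f).eq, mul_assoc]
  simp only [resolv', hX, mul_assoc, ← mul_smul_comm, ← mul_sub]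
  congr 1
  ext n
  simp only [map_sub, PowerSeries.coeff_smul, PowerSeries.coeff_mul]
  rw [← Finset.Nat.sum_antidiagonal_swap
      (f := fun x => PowerSeries.coeff x.1 (resolv b' y') * c • PowerSeries.coeff x.2 (resolv b _)),
    ← Finset.Nat.sum_antidiagonal_swap (f := fun x => PowerSeries.coeff x.1 (resolv b' _) *
      PowerSeries.coeff x.2 (resolv b y)), ← Finset.sum_sub_distrib, ← Finset.sum_sub_distrib]
  refine Finset.sum_congr rfl fun x _ => ?_
  simp only [resolv, PowerSeries.coeff_mk, Prod.fst_swap, Prod.snd_swap]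
  have := h x.1 x.2
  simp only [smul_mul_assoc, mul_smul_comm]
  linear_combination (norm := module) (b ^ x.1 * b' ^ x.2) • this

/-- For a string paired with itself, `resolv_quad` says that x'x - p²xx' equals its own negative. -/
theorem resolv_qcomm {p : ℂ} {y : ℤ → E} (h : QuadString (p ^ 2) y y) (b : ℂ) :
    resolv' b y * resolv b y = p ^ 2 • (resolv b y * resolv' b y) := by
  have := resolv_quad h b b
  linear_combination (norm := module) (1 / 2 : ℂ) • this

theorem semiconj_pow {Φ A B : E} (h : Φ * A = B * Φ) (k : ℕ) : Φ * A ^ k = B ^ k * Φ := by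
  have : SemiconjBy Φ A B := h
  exact this.pow_right k

/-- The derivative of `y ↦ y^k` in the direction `u`. -/
def dPow (y u : E) (k : ℕ) : E := ∑ a ∈ Finset.range k, y ^ a * u * y ^ (k - 1 - a)

theorem dPow_succ (y u : E) (k : ℕ) : dPow y u (k + 1) = dPow y u k * y + y ^ k * u := by
  rw [dPow, Finset.sum_range_succ, dPow, Finset.sum_mul]
  congr 1
  · refine Finset.sum_congr rfl fun a ha => ?_
    rw [mul_assoc _ _ y, ← pow_succ]
    congr 2
    grind
  · simp

/-- The derivative of `(y, X) ↦ ∑ (-1)^k [s k] y^k X y^{s-k}` in the direction `(u, v)`. -/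
noncomputable def dSerre (p : ℂ) (s : ℕ) (y X u v : E) : E :=
  ∑ k ∈ Finset.range (s + 1), ((-1 : ℂ) ^ k * qBinom p s k) •
    (dPow y u k * X * y ^ (s - k) + y ^ k * v * y ^ (s - k) + y ^ k * X * dPow y u (s - k))

theorem dPow_eq_geom {Φ A B : E} (h : Φ * A = B * Φ) (k : ℕ) : dPow A Φ k = geom A B k * Φ := by
  rw [dPow, geom, Finset.sum_mul]
  refine Finset.sum_congr rfl fun a _ => ?_
  rw [mul_assoc, semiconj_pow h, mul_assoc]

variable {p : ℂ} (hp : Generic p)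

include hp

/-- Pushing Φ to the far right turns every factor it crosses from x - cx' into cx - x'; the sum
becomes that of `qSum_eq_zero`, times Φ. -/
theorem dSerre_outer_series {c : ℂ} {s : ℕ} (hc : c * p ^ s = 1) {y : ℤ → E}
    (hy : QuadString (p ^ 2) y y) {Φ : PowerSeries E} (hΦ : SeriesRel c Φ y) (X : PowerSeries E) :
    dSerre p (s + 1) (PowerSeries.C (y 0)) X 0 Φ = 0 := by
  have h0 := hΦ 0
  rw [gSeries_eq_resolv] at h0
  have h1 := qSum_eq_zero hp (resolv_qcomm hy c) hc
  rw [← C_eq_resolv] at h1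
  have h2 : ∀ k, dPow (PowerSeries.C (y 0)) 0 k = 0 := by simp [dPow]
  have h3 := congrArg (· * Φ) h1
  simp only [zero_mul, qSum, Finset.sum_mul] at h3
  refine Eq.trans ?_ h3
  rw [dSerre]
  refine Finset.sum_congr rfl fun k _ => ?_
  simp only [h2, zero_mul, mul_zero, zero_add, add_zero, mul_one, smul_mul_assoc, mul_assoc,
    semiconj_pow h0]

/-- Pushing Φ to the far right turns the factors behind it into p²x - x', and X - cX' into cX - X'
when it crosses the outer current. The possible positions of Φ add up to the geometric sums of
`sum_geom_eq_zero`. -/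
theorem dSerre_inner_series {c : ℂ} {s : ℕ} (hc : c * p ^ s = 1) {y Y : ℤ → E}
    (hy : QuadString (p ^ 2) y y) (hyY : QuadString c y Y) {Φ : PowerSeries E}
    (hΦ : SeriesRel (p ^ 2) Φ y) (hΦ' : SeriesRel c Φ Y) :
    dSerre p (s + 1) (PowerSeries.C (y 0)) (PowerSeries.C (Y 0)) Φ 0 = 0 := by
  have h0 := hΦ 0
  have h0' := hΦ' 0
  rw [gSeries_eq_resolv] at h0 h0'
  have h1 := sum_geom_eq_zero (resolv_qcomm hy (p ^ 2)) hp hc (resolv_quad hyY (p ^ 2) c)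
  rw [← C_eq_resolv, ← C_eq_resolv] at h1
  have h3 := congrArg (· * Φ) h1
  simp only [zero_mul, Finset.sum_mul] at h3
  refine Eq.trans ?_ h3
  rw [dSerre]
  refine Finset.sum_congr rfl fun k _ => ?_
  rw [dPow_eq_geom h0, dPow_eq_geom h0, smul_mul_assoc, add_mul]
  simp only [mul_zero, zero_mul, add_zero, mul_assoc]
  rw [← mul_assoc Φ (PowerSeries.C (Y 0)), h0', mul_assoc, semiconj_pow h0]

end Strings

/-! ### Coefficients and linearity of the differentiated Serre sum. -/

section Modes

variable {E : Type*} [Ring E] [Algebra ℂ E]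

theorem coeff_dPow (y : E) (Φ : PowerSeries E) (n k : ℕ) :
    PowerSeries.coeff n (dPow (PowerSeries.C y) Φ k) = dPow y (PowerSeries.coeff n Φ) k := by
  simp only [dPow, map_sum, ← map_pow, PowerSeries.coeff_mul_C, PowerSeries.coeff_C_mul]

theorem coeff_dSerre (p : ℂ) (s : ℕ) (y X : E) (Φ Φ' : PowerSeries E) (n : ℕ) :
    PowerSeries.coeff n (dSerre p s (PowerSeries.C y) (PowerSeries.C X) Φ Φ') =
      dSerre p s y X (PowerSeries.coeff n Φ) (PowerSeries.coeff n Φ') := by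
  simp only [dSerre, map_sum, PowerSeries.coeff_smul, map_add, ← map_pow, mul_assoc]
  simp only [← mul_assoc, PowerSeries.coeff_mul_C, PowerSeries.coeff_C_mul, coeff_dPow]
  simp only [mul_assoc, PowerSeries.coeff_mul_C, PowerSeries.coeff_C_mul, coeff_dPow, ← map_mul]

theorem dPow_add (y u u' : E) (k : ℕ) : dPow y (u + u') k = dPow y u k + dPow y u' k := by
  simp only [dPow, mul_add, add_mul, Finset.sum_add_distrib]

theorem dPow_smul (y : E) (a : ℂ) (u : E) (k : ℕ) : dPow y (a • u) k = a • dPow y u k := by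
  simp only [dPow, mul_smul_comm, smul_mul_assoc, Finset.smul_sum]

/-- `dSerre p s y X` as a linear map of the direction. -/
noncomputable def dSerreLin (p : ℂ) (s : ℕ) (y X : E) : E × E →ₗ[ℂ] E where
  toFun w := dSerre p s y X w.1 w.2
  map_add' w w' := by
    simp only [dSerre, Prod.fst_add, Prod.snd_add, dPow_add, mul_add, add_mul, ← Finset.sum_add_distrib,
      ← smul_add]
    refine Finset.sum_congr rfl fun k _ => ?_
    congr 1
    abel
  map_smul' a w := by
    simp only [dSerre, Prod.smul_fst, Prod.smul_snd, dPow_smul, mul_smul_comm, smul_mul_assoc,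
      ← smul_add, RingHom.id_apply, Finset.smul_sum, smul_comm a]

theorem dSerreLin_apply (p : ℂ) (s : ℕ) (y X : E) (w : E × E) :
    dSerreLin p s y X w = dSerre p s y X w.1 w.2 := rfl

end Modes

/-! ### Serre sums: multilinearity and polarization -/

section Words

variable {E : Type*} [Ring E] [Algebra ℂ E]

/-- The Serre sum `∑_π ∑_k (-1)^k [s k] a_{π(1)} ⋯ a_{π(k)} X a_{π(k+1)} ⋯ a_{π(s)}`. -/
noncomputable def serreSum (p : ℂ) (s : ℕ) (a : Fin s → E) (X : E) : E :=
  ∑ π : Equiv.Perm (Fin s), ∑ k ∈ Finset.range (s + 1), ((-1 : ℂ) ^ k * qBinom p s k) •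
    (((List.ofFn fun b => a (π b)).take k).prod * X * ((List.ofFn fun b => a (π b)).drop k).prod)

theorem map_serreSum {F : Type*} [Ring F] [Algebra ℂ F] (f : E →ₐ[ℂ] F) (p : ℂ) (s : ℕ)
    (a : Fin s → E) (X : E) : f (serreSum p s a X) = serreSum p s (fun i => f (a i)) (f X) := by
  simp only [serreSum, map_sum, map_smul, map_mul, map_list_prod, List.map_take, List.map_drop,
    List.map_ofFn]
  rfl

omit [Algebra ℂ E] in
theorem insertNth_update' {s : ℕ} (k : Fin (s + 1)) (X : E) (a : Fin s → E) (i : Fin s) (z : E) :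
    k.insertNth (α := fun _ => E) X (Function.update a i z) =
      Function.update (k.insertNth (α := fun _ => E) X a) (k.succAbove i) z :=
  Fin.insertNth_update (α := fun _ => E) k X i z a

/-- The word `a_1 ⋯ a_k X a_{k+1} ⋯ a_s`, as a multilinear map of `a`. -/
noncomputable def word (s : ℕ) (k : Fin (s + 1)) (X : E) : MultilinearMap ℂ (fun _ : Fin s => E) E where
  toFun a := (List.ofFn (k.insertNth (α := fun _ => E) X a)).prod
  map_update_add' {inst} a i u v := by
    have : inst = instDecidableEqFin s := Subsingleton.elim _ _
    subst this
    simp only [← MultilinearMap.mkPiAlgebraFin_apply (R := ℂ), insertNth_update',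
      MultilinearMap.map_update_add]
  map_update_smul' {inst} a i c u := by
    have : inst = instDecidableEqFin s := Subsingleton.elim _ _
    subst this
    simp only [← MultilinearMap.mkPiAlgebraFin_apply (R := ℂ), insertNth_update',
      MultilinearMap.map_update_smul]

omit [Algebra ℂ E] in
theorem ofFn_insertNth_prod {s : ℕ} (k : Fin (s + 1)) (X : E) (a : Fin s → E) :
    (List.ofFn (k.insertNth (α := fun _ => E) X a)).prod =
      ((List.ofFn a).take k).prod * X * ((List.ofFn a).drop k).prod := by
  induction s with
  | zero =>
    obtain rfl : k = 0 := Fin.fin_one_eq_zero k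
    simp
  | succ s ih =>
    induction k using Fin.cases with
    | zero => simp [Fin.insertNth_zero', List.ofFn_cons]
    | succ k =>
      rw [← Fin.cons_self_tail a, Fin.insertNth_succ_cons, List.ofFn_cons, List.ofFn_cons,
        List.prod_cons, ih]
      simp [mul_assoc]

theorem serreSum_eq (p : ℂ) (s : ℕ) (a : Fin s → E) (X : E) : serreSum p s a X =
    ∑ k : Fin (s + 1), ((-1 : ℂ) ^ (k : ℕ) * qBinom p s k) •
      ∑ π : Equiv.Perm (Fin s), word s k X fun b => a (π b) := by
  rw [serreSum, Finset.sum_comm, Finset.sum_range]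
  refine Finset.sum_congr rfl fun k _ => ?_
  rw [Finset.smul_sum]
  refine Finset.sum_congr rfl fun π _ => ?_
  rw [← ofFn_insertNth_prod]
  rfl

theorem word_const {s : ℕ} (k : Fin (s + 1)) (X y : E) :
    word s k X (fun _ => y) = y ^ (k : ℕ) * X * y ^ (s - k) := by
  have : word s k X (fun _ => y) = _ := ofFn_insertNth_prod k X fun _ => y
  rw [this, List.ofFn_const, List.take_replicate, List.drop_replicate, List.prod_replicate,
    List.prod_replicate, min_eq_left (by omega)]

/-- Inclusion–exclusion over the set K of omitted values: for fixed g the signs run over all subsets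
of the complement of its image, so they cancel unless g is onto, hence a permutation. -/
theorem sum_perm_eq {s : ℕ} {M : Type*} [AddCommGroup M] (F : (Fin s → Fin s) → M) :
    ∑ π : Equiv.Perm (Fin s), F π =
      ∑ K : Finset (Fin s), (-1 : ℤ) ^ K.card • ∑ g ∈ Fintype.piFinset fun _ : Fin s => Kᶜ, F g := by
  have h1 : ∀ K : Finset (Fin s), (-1 : ℤ) ^ K.card • ∑ g ∈ Fintype.piFinset fun _ => Kᶜ, F g =
      ∑ g : Fin s → Fin s, if K ⊆ (Finset.univ.image g)ᶜ then (-1 : ℤ) ^ K.card • F g else 0 := by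
    intro K
    rw [Finset.smul_sum, ← Finset.sum_filter]
    refine Finset.sum_congr ?_ fun _ _ => rfl
    ext g
    simp only [Fintype.mem_piFinset, Finset.mem_compl, Finset.mem_filter, Finset.mem_univ, true_and,
      Finset.subset_iff, Finset.mem_image, not_exists]
    grind
  rw [Finset.sum_congr rfl fun K _ => h1 K, Finset.sum_comm]
  have h2 : ∀ g : Fin s → Fin s,
      (∑ K : Finset (Fin s), if K ⊆ (Finset.univ.image g)ᶜ then (-1 : ℤ) ^ K.card • F g else 0) =
        if Function.Bijective g then F g else 0 := by
    intro g
    rw [← Finset.sum_filter, ← Finset.sum_smul]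
    have : (Finset.univ.filter fun K : Finset (Fin s) => K ⊆ (Finset.univ.image g)ᶜ) =
        ((Finset.univ.image g)ᶜ).powerset := by
      ext K
      simp
    rw [this, Finset.sum_powerset_neg_one_pow_card]
    have : (Finset.univ.image g)ᶜ = ∅ ↔ Function.Bijective g := by
      rw [← Finite.surjective_iff_bijective, Finset.compl_eq_empty_iff, Finset.eq_univ_iff_forall]
      simp [Function.Surjective]
    simp only [this]
    split_ifs <;> simp
  rw [Finset.sum_congr rfl fun g _ => h2 g, ← Finset.sum_filter]
  refine (Finset.sum_bij (fun g h => Equiv.ofBijective g (Finset.mem_filter.mp h).2)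
    (by simp) (fun g h g' h' e => ?_) (fun π _ => ⟨π, Finset.mem_filter.mpr ⟨Finset.mem_univ _, π.bijective⟩, ?_⟩) (by simp)).symm
  · simpa using congrArg (fun e : Equiv.Perm (Fin s) => (e : Fin s → Fin s)) e
  · ext; simp

/-- Polarization of the Serre sum. -/
theorem serreSum_polarize (p : ℂ) (s : ℕ) (a : Fin s → E) (X : E) : serreSum p s a X =
    ∑ K : Finset (Fin s), (-1 : ℤ) ^ K.card •
      qSum p s (∑ b ∈ Kᶜ, a b) X (∑ b ∈ Kᶜ, a b) := by
  rw [serreSum_eq]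
  have h : ∀ (k : Fin (s + 1)) (K : Finset (Fin s)),
      ∑ g ∈ Fintype.piFinset fun _ : Fin s => Kᶜ, word s k X (fun b => a (g b)) =
        (∑ b ∈ Kᶜ, a b) ^ (k : ℕ) * X * (∑ b ∈ Kᶜ, a b) ^ (s - k) := by
    intro k K
    rw [← word_const, MultilinearMap.map_sum_finset]
  have h' : ∀ k : Fin (s + 1), ∑ π : Equiv.Perm (Fin s), word s k X (fun b => a (π b)) =
      ∑ K : Finset (Fin s), (-1 : ℤ) ^ K.card •
        ((∑ b ∈ Kᶜ, a b) ^ (k : ℕ) * X * (∑ b ∈ Kᶜ, a b) ^ (s - k)) := by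
    intro k
    rw [sum_perm_eq fun g => word s k X fun b => a (g b)]
    simp only [h]
  simp only [h', Finset.smul_sum, qSum]
  rw [Finset.sum_comm]
  refine Finset.sum_congr rfl fun K _ => ?_
  rw [Finset.sum_range]
  refine Finset.sum_congr rfl fun k _ => ?_
  rw [smul_comm]

end Words

/-! ### Dual numbers: polarization and Leibniz rule for Serre sums. -/

section Dual

variable {E : Type*} [Ring E] [Algebra ℂ E]

open TrivSqZeroExt

/-- The dual number `y + ε u`. -/
def dual (y u : E) : DualNumber E := inl y + inr u

omit [Algebra ℂ E] in
@[simp] theorem fst_dual (y u : E) : fst (dual y u) = y := by simp [dual]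

omit [Algebra ℂ E] in
@[simp] theorem snd_dual (y u : E) : snd (dual y u) = u := by simp [dual]

theorem snd_mul' (a b : DualNumber E) : snd (a * b) = fst a * snd b + snd a * fst b := by
  simp

theorem snd_dual_pow (y u : E) (k : ℕ) : snd (dual y u ^ k) = dPow y u k := by
  induction k with
  | zero => simp [dPow]
  | succ k ih => rw [pow_succ, snd_mul', ih, dPow_succ]; simp [add_comm]

theorem snd_sum {ι : Type*} (S : Finset ι) (f : ι → DualNumber E) :
    snd (∑ i ∈ S, f i) = ∑ i ∈ S, snd (f i) :=
  map_sum (sndHom E E) f S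

theorem snd_qSum (p : ℂ) (s : ℕ) (y X u v : E) :
    snd (qSum p s (dual y u) (dual X v) (dual y u)) = dSerre p s y X u v := by
  simp only [qSum, snd_sum, dSerre, snd_smul, snd_mul', fst_mul, fst_pow, fst_dual, snd_dual,
    snd_dual_pow, add_mul]
  refine Finset.sum_congr rfl fun k _ => ?_
  congr 1
  abel

theorem dual_sum {ι : Type*} (S : Finset ι) (y u : ι → E) :
    ∑ i ∈ S, dual (y i) (u i) = dual (∑ i ∈ S, y i) (∑ i ∈ S, u i) := by
  rw [dual, inl_sum, inr_sum, ← Finset.sum_add_distrib]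
  rfl

/-- Polarization holds over the dual numbers too, so the derivative of the symmetrized sum is
controlled by its derivatives on the diagonal, at the partial sums over subsets. -/
theorem snd_serreSum_eq_zero {p : ℂ} {s : ℕ} {y u : Fin s → E} {X v : E}
    (h : ∀ J : Finset (Fin s), dSerre p s (∑ b ∈ J, y b) X (∑ b ∈ J, u b) v = 0) :
    snd (serreSum p s (fun b => dual (y b) (u b)) (dual X v)) = 0 := by
  rw [serreSum_polarize, snd_sum]
  refine Finset.sum_eq_zero fun K _ => ?_
  rw [dual_sum, snd_smul, snd_qSum, h, smul_zero]

theorem snd_ofFn_prod {s : ℕ} (y u : Fin s → E) :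
    snd (List.ofFn fun b => dual (y b) (u b)).prod =
      ∑ i, (List.ofFn (Function.update y i (u i))).prod := by
  induction s with
  | zero => simp
  | succ s ih =>
    rw [List.ofFn_succ, List.prod_cons, snd_mul', ih, Fin.sum_univ_succ, add_comm]
    congr 1
    · rw [List.ofFn_succ, List.prod_cons, fst_list_prod, List.map_ofFn]
      simp [Function.comp_def]
    · rw [Finset.mul_sum]
      refine Finset.sum_congr rfl fun i _ => ?_
      rw [List.ofFn_succ, List.prod_cons, Function.update_of_ne (Fin.succ_ne_zero i).symm]
      have h : (fun b : Fin s => Function.update y i.succ (u i.succ) b.succ) =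
          Function.update (fun b => y b.succ) i (u i.succ) := by
        funext b
        simp [Function.update_apply]
      rw [h, fst_dual]

theorem snd_word {s : ℕ} (k : Fin (s + 1)) (y u : Fin s → E) (X v : E) :
    snd (word s k (dual X v) fun b => dual (y b) (u b)) =
      word s k v y + ∑ i, word s k X (Function.update y i (u i)) := by
  have h : (k.insertNth (α := fun _ => DualNumber E) (dual X v) fun b => dual (y b) (u b)) =
      fun b => dual (k.insertNth (α := fun _ => E) X y b) (k.insertNth (α := fun _ => E) v u b) := by
    ext1 b
    induction b using Fin.succAboveCases k <;> simp
  change snd (List.ofFn _).prod = _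
  rw [h, snd_ofFn_prod, Fin.sum_univ_succAbove _ k]
  congr 1
  · simp [Fin.update_insertNth, word]
  · refine Finset.sum_congr rfl fun i _ => ?_
    rw [Fin.insertNth_apply_succAbove, ← insertNth_update']
    rfl

/-- The Leibniz rule for Serre sums. -/
theorem snd_serreSum (p : ℂ) (s : ℕ) (y u : Fin s → E) (X v : E) :
    snd (serreSum p s (fun b => dual (y b) (u b)) (dual X v)) =
      serreSum p s y v + ∑ i, serreSum p s (Function.update y i (u i)) X := by
  simp only [serreSum_eq, snd_sum, snd_smul, snd_word]
  rw [Finset.sum_comm, ← Finset.sum_add_distrib]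
  refine Finset.sum_congr rfl fun k _ => ?_
  rw [← Finset.smul_sum, ← smul_add, Finset.sum_add_distrib]
  congr 2
  rw [Finset.sum_comm (s := (Finset.univ : Finset (Fin s)))]
  -- Position i of the permuted word carries the factor of index π i.
  refine Finset.sum_congr rfl fun π _ => Fintype.sum_equiv π _ _ fun i => ?_
  congr 1
  funext b
  simp [Function.update_apply]

theorem word_smul {s : ℕ} (k : Fin (s + 1)) (d : ℂ) (X : E) (y : Fin s → E) :
    word s k (d • X) y = d • word s k X y := by
  have h : ∀ Z : E, word s k Z y = _ := fun Z => ofFn_insertNth_prod k Z y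
  rw [h, h, mul_smul_comm, smul_mul_assoc]

theorem serreSum_update_smul (p : ℂ) (s : ℕ) (y : Fin s → E) (i : Fin s) (c : ℂ) (u X : E) :
    serreSum p s (Function.update y i (c • u)) X = c • serreSum p s (Function.update y i u) X := by
  simp only [serreSum_eq]
  rw [Finset.smul_sum]
  refine Finset.sum_congr rfl fun k _ => ?_
  rw [smul_comm c]
  congr 1
  rw [Finset.smul_sum]
  refine Finset.sum_congr rfl fun π _ => ?_
  have h : ∀ z : E, (fun b => Function.update y i z (π b)) =
      Function.update (fun b => y (π b)) (π.symm i) z := by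
    intro z
    funext b
    simp [Function.update_apply, Equiv.eq_symm_apply]
  rw [h, h, MultilinearMap.map_update_smul]

theorem serreSum_smul (p : ℂ) (s : ℕ) (y : Fin s → E) (c d : ℂ) (X : E) :
    serreSum p s (fun i => c • y i) (d • X) = (c ^ s * d) • serreSum p s y X := by
  simp only [serreSum_eq, word_smul]
  rw [Finset.smul_sum]
  refine Finset.sum_congr rfl fun k _ => ?_
  rw [smul_comm (c ^ s * d)]
  congr 1
  rw [Finset.smul_sum]
  refine Finset.sum_congr rfl fun π _ => ?_
  rw [MultilinearMap.map_smul_univ (word s k X) (fun _ => c)]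
  simp [smul_smul, mul_comm]

theorem serreSum_smul_right (p : ℂ) (s : ℕ) (y : Fin s → E) (d : ℂ) (X : E) :
    serreSum p s y (d • X) = d • serreSum p s y X := by
  simpa using serreSum_smul p s y 1 d X

end Dual

/-! ### Contraction of currents in the quadratic and Serre relations -/

section Contraction

variable {I : Type*} [DecidableEq I]

/-- The parameters of the quadratic and Serre relations between currents. -/
structure QData (I : Type*) where
  p : I → ℂ
  b : I → I → ℂ
  a : I → I → ℕ
  gen : ∀ i, Generic (p i)
  b_ne : ∀ i j, b i j ≠ 0
  b_self : ∀ i, b i i = p i ^ 2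
  b_symm : ∀ i j, b i j = b j i
  b_off : ∀ i j, i ≠ j → b i j * p i ^ a i j = 1

/-- The inverse parameters. -/
noncomputable def QData.inv (D : QData I) : QData I where
  p i := (D.p i)⁻¹
  b i j := (D.b i j)⁻¹
  a := D.a
  gen i := generic_inv (D.gen i)
  b_ne i j := inv_ne_zero (D.b_ne i j)
  b_self i := by rw [D.b_self, inv_pow]
  b_symm i j := by rw [D.b_symm]
  b_off i j h := by rw [inv_pow, ← mul_inv, D.b_off i j h, inv_one]

variable {E : Type*} [Ring E] [Algebra ℂ E]

/-- The quadratic relations. -/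
def QuadRel (D : QData I) (x : I → ℤ → E) : Prop := ∀ i j, QuadString (D.b i j) (x i) (x j)

/-- The Serre relations. -/
def SerreRel (D : QData I) (x : I → ℤ → E) : Prop :=
  ∀ i j, i ≠ j → ∀ (r : Fin (D.a i j + 1) → ℤ) (r' : ℤ),
    serreSum (D.p i) (D.a i j + 1) (fun c => x i (r c)) (x j r') = 0

/-- Replacing the current `x_{i₀}` by `Ξ`, one factor at a time, annihilates the quadratic and the
Serre relations. -/
def IsContraction (D : QData I) (x : I → ℤ → E) (i₀ : I) (Ξ : ℤ → E) : Prop :=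
  (∀ j, ModeRel (D.b i₀ j) Ξ (x j)) ∧
  ∀ i j, i ≠ j → ∀ (r : Fin (D.a i j + 1) → ℤ) (r' m : ℤ) (J : Finset (Fin (D.a i j + 1))),
    dSerreLin (D.p i) (D.a i j + 1) (∑ c ∈ J, x i (r c)) (x j r')
      (if i = i₀ then ∑ c ∈ J, Ξ (r c + m) else 0, if j = i₀ then Ξ (r' + m) else 0) = 0

theorem ModeRel.sub {b : ℂ} {Ξ Ξ' y : ℤ → E} (h : ModeRel b Ξ y) (h' : ModeRel b Ξ' y) :
    ModeRel b (fun m => Ξ m - Ξ' m) y := by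
  intro m r
  simp only [sub_mul, mul_sub]
  linear_combination (norm := module) (1 : ℂ) • h m r - (1 : ℂ) • h' m r

theorem ModeRel.smul {b : ℂ} {Ξ y : ℤ → E} (h : ModeRel b Ξ y) (z : ℂ) :
    ModeRel b (fun m => z • Ξ m) y := by
  intro m r
  simp only [smul_mul_assoc, mul_smul_comm]
  linear_combination (norm := module) z • h m r

/-- Negating the modes exchanges z with z⁻¹ and therefore b with b⁻¹. This transports results on
power series in z to φ⁻, a series in z⁻¹. -/
theorem ModeRel.reverse {b : ℂ} (hb : b ≠ 0) {Ξ y : ℤ → E}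
    (h : ModeRel b⁻¹ Ξ fun r => y (-r)) : ModeRel b (fun m => Ξ (-m)) y := by
  intro m r
  have h1 := h (-m - 1) (-r - 1)
  simp only [sub_add_cancel, neg_neg, neg_sub, sub_neg_eq_add] at h1
  rw [add_comm 1 r, show -m - 1 = -(m + 1) by ring] at h1
  have e : b * b⁻¹ = 1 := mul_inv_cancel₀ hb
  linear_combination (norm := module) (-b) • h1 - e • (Ξ (-(m + 1)) * y r) -
    e • (y (r + 1) * Ξ (-m))

theorem IsContraction.sub {D : QData I} {x : I → ℤ → E} {i₀ : I} {Ξ Ξ' : ℤ → E}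
    (h : IsContraction D x i₀ Ξ) (h' : IsContraction D x i₀ Ξ') :
    IsContraction D x i₀ fun m => Ξ m - Ξ' m := by
  refine ⟨fun j => (h.1 j).sub (h'.1 j), fun i j hij r r' m J => ?_⟩
  · have e := congrArg₂ (· - ·) (h.2 i j hij r r' m J) (h'.2 i j hij r r' m J)
    simp only [← map_sub, sub_zero] at e
    refine Eq.trans ?_ e
    congr 1
    ext <;> simp only [Prod.mk_sub_mk] <;> split_ifs <;> simp

theorem IsContraction.smul {D : QData I} {x : I → ℤ → E} {i₀ : I} {Ξ : ℤ → E}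
    (h : IsContraction D x i₀ Ξ) (z : ℂ) : IsContraction D x i₀ fun m => z • Ξ m := by
  refine ⟨fun j => (h.1 j).smul z, fun i j hij r r' m J => ?_⟩
  · have e := congrArg (z • ·) (h.2 i j hij r r' m J)
    simp only [← map_smul, smul_zero] at e
    refine Eq.trans ?_ e
    congr 1
    ext <;> simp only [Prod.smul_mk] <;> split_ifs <;> simp [Finset.smul_sum]

theorem IsContraction.reverse {D : QData I} {x : I → ℤ → E} {i₀ : I} {Ξ : ℤ → E}
    (h : IsContraction D.inv (fun j r => x j (-r)) i₀ fun r => Ξ (-r)) :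
    IsContraction D x i₀ Ξ := by
  refine ⟨fun j => ?_, fun i j hij r r' m J => ?_⟩
  · simpa using ModeRel.reverse (D.b_ne i₀ j) (h.1 j)
  · have h2 := h.2 i j hij (fun c => -r c) (-r') (-m) J
    simp only [QData.inv, neg_neg, neg_add_rev, add_comm m] at h2
    simpa only [dSerreLin_apply, dSerre, qBinom_inv] using h2

theorem QuadRel.reverse {D : QData I} {x : I → ℤ → E} (h : QuadRel D x) :
    QuadRel D.inv fun j r => x j (-r) := by
  intro i j r r'
  have h1 := h i j (-r - 1) (-r' - 1)
  simp only [QData.inv, sub_add_cancel, neg_add_rev] at h1 ⊢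
  rw [show -1 + -r = -r - 1 by ring, show -1 + -r' = -r' - 1 by ring]
  have hb := D.b_ne i j
  have e : (D.b i j)⁻¹ * D.b i j = 1 := inv_mul_cancel₀ hb
  linear_combination (norm := module) (-(D.b i j)⁻¹) • h1 - e • (x i (-r - 1) * x j (-r')) -
    e • (x j (-r' - 1) * x i (-r))

/-- The Serre condition concerns arbitrary modes, the series identities only mode 0 of a string.
Re-centred strings, and sums of them, again satisfy the quadratic and exchange relations, which
reconciles the two. -/
theorem isContraction_zCoeff {D : QData I} {x : I → ℤ → E} (hx : QuadRel D x) {i₀ : I}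
    {Φ : PowerSeries E} (hΦ : ∀ j, SeriesRel (D.b i₀ j) Φ (x j)) :
    IsContraction D x i₀ (zCoeff Φ) := by
  refine ⟨fun j => (hΦ j).modeRel, fun i j hij r r' m J => ?_⟩
  set y : ℤ → E := fun t => ∑ c ∈ J, x i (r c + t) with hy
  set Y : ℤ → E := fun t => x j (r' + t) with hY
  have hy0 : ∑ c ∈ J, x i (r c) = y 0 := by simp [hy]
  have hY0 : x j r' = Y 0 := by simp [hY]
  have hyy : QuadString (D.p i ^ 2) y y := by
    intro t t'
    simp only [hy, Finset.sum_mul_sum, Finset.smul_sum]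
    rw [Finset.sum_comm (f := fun c c' => D.p i ^ 2 • (x i (r c + t') * x i (r c' + (t + 1)))),
      Finset.sum_comm (f := fun c c' => x i (r c + (t' + 1)) * x i (r c' + t)),
      ← Finset.sum_sub_distrib, ← Finset.sum_sub_distrib]
    refine Finset.sum_congr rfl fun c _ => ?_
    rw [← Finset.sum_sub_distrib, ← Finset.sum_sub_distrib]
    refine Finset.sum_congr rfl fun c' _ => ?_
    simpa only [D.b_self, add_assoc] using hx i i (r c + t) (r c' + t')
  have hyY : QuadString (D.b i j) y Y := by
    intro t t'
    simp only [hy, hY, Finset.sum_mul, Finset.mul_sum, Finset.smul_sum]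
    rw [← Finset.sum_sub_distrib, ← Finset.sum_sub_distrib]
    refine Finset.sum_congr rfl fun c _ => ?_
    simpa only [add_assoc] using hx i j (r c + t) (r' + t')
  have hΦy : SeriesRel (D.b i₀ i) Φ y := by
    intro t
    simp only [hy, map_sum, Finset.mul_sum, hΦ i _]
    rw [← Finset.sum_mul]
    congr 1
    ext n
    simp [gSeries, Finset.smul_sum, add_assoc]
  have hΦY : SeriesRel (D.b i₀ j) Φ Y := by
    intro t
    simp only [hY, hΦ j _]
    congr 1
    ext n
    simp [gSeries, add_assoc]
  rw [hy0, hY0]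
  -- Any single coefficient Φ_n may be inserted; the required direction, a sum of coefficients of
  -- different index, then follows by linearity.
  have key1 : i = i₀ → ∀ n, dSerreLin (D.p i) (D.a i j + 1) (y 0) (Y 0) (zCoeff Φ n, 0) = 0 := by
    rintro rfl n
    rw [D.b_self] at hΦy
    have := dSerre_inner_series (D.gen i) (D.b_off i j hij) hyy hyY hΦy hΦY
    rw [zCoeff]
    split_ifs
    · have h2 := congrArg (PowerSeries.coeff n.toNat) this
      rw [← map_zero (PowerSeries.C (R := E)), coeff_dSerre] at h2
      simpa [dSerreLin_apply] using h2
    · exact map_zero _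
  have key2 : j = i₀ → ∀ n, dSerreLin (D.p i) (D.a i j + 1) (y 0) (Y 0) (0, zCoeff Φ n) = 0 := by
    rintro rfl n
    rw [D.b_symm] at hΦy
    have := dSerre_outer_series (D.gen i) (D.b_off i j hij) hyy hΦy (PowerSeries.C (Y 0))
    rw [zCoeff]
    split_ifs
    · have h2 := congrArg (PowerSeries.coeff n.toNat) this
      rw [coeff_dSerre] at h2
      simpa [dSerreLin_apply] using h2
    · exact map_zero _
  have e1 : dSerreLin (D.p i) (D.a i j + 1) (y 0) (Y 0)
      (if i = i₀ then ∑ c ∈ J, zCoeff Φ (r c + m) else 0, 0) = 0 := by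
    split_ifs with hi
    · have := map_sum ((dSerreLin (D.p i) (D.a i j + 1) (y 0) (Y 0)).comp (LinearMap.inl ℂ E E))
        (fun c => zCoeff Φ (r c + m)) J
      exact this.trans (Finset.sum_eq_zero fun c _ => key1 hi _)
    · exact map_zero _
  have e2 : dSerreLin (D.p i) (D.a i j + 1) (y 0) (Y 0)
      (0, if j = i₀ then zCoeff Φ (r' + m) else 0) = 0 := by
    split_ifs with hj
    · exact key2 hj _
    · exact map_zero _
  have := congrArg₂ (· + ·) e1 e2
  rw [← map_add] at this
  simpa using this

theorem isContraction_zCoeff_neg {D : QData I} {x : I → ℤ → E} (hx : QuadRel D x) {i₀ : I}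
    {Φ : PowerSeries E} (hΦ : ∀ j, SeriesRel (D.b i₀ j)⁻¹ Φ fun r => x j (-r)) :
    IsContraction D x i₀ fun m => zCoeff Φ (-m) := by
  apply IsContraction.reverse
  simpa using isContraction_zCoeff hx.reverse hΦ

/-- The family of currents `x_{j,r} + ε δ_{j,i₀} Ξ_{r+m}`. -/
noncomputable def dualFamily (x : I → ℤ → E) (i₀ : I) (Ξ : ℤ → E) (m : ℤ) (j : I) (r : ℤ) :
    DualNumber E :=
  dual (x j r) (if j = i₀ then Ξ (r + m) else 0)

theorem quadString_dual {b : ℂ} {y y' u u' : ℤ → E} (h : QuadString b y y')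
    (h' : ∀ r r', u (r + 1) * y' r' + y (r + 1) * u' r' -
      b • (u' r' * y (r + 1) + y' r' * u (r + 1)) =
      b • (u r * y' (r' + 1) + y r * u' (r' + 1)) - (u' (r' + 1) * y r + y' (r' + 1) * u r)) :
    QuadString b (fun r => dual (y r) (u r)) fun r => dual (y' r) (u' r) := by
  intro r r'
  ext
  · simpa using h r r'
  · simp only [TrivSqZeroExt.snd_sub, TrivSqZeroExt.snd_smul, snd_mul', fst_dual, snd_dual]
    linear_combination (norm := module) (1 : ℂ) • h' r r'

/-- The derivative splits according to which factor is contracted, and each half is an instance of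
the mode relation. The quadratic relations of x itself are not needed, so this can serve to prove
them for x⁺. -/
theorem quad_dualFamily {D : QData I} {x : I → ℤ → E} {i₀ : I}
    {Ξ : ℤ → E} (h : ∀ j, ModeRel (D.b i₀ j) Ξ (x j)) (m : ℤ) (i j : I) (r r' : ℤ) :
    (if i = i₀ then Ξ (r + 1 + m) else 0) * x j r' +
        x i (r + 1) * (if j = i₀ then Ξ (r' + m) else 0) -
      D.b i j • ((if j = i₀ then Ξ (r' + m) else 0) * x i (r + 1) +
        x j r' * (if i = i₀ then Ξ (r + 1 + m) else 0)) =
      D.b i j • ((if i = i₀ then Ξ (r + m) else 0) * x j (r' + 1) +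
        x i r * (if j = i₀ then Ξ (r' + 1 + m) else 0)) -
      ((if j = i₀ then Ξ (r' + 1 + m) else 0) * x i r +
        x j (r' + 1) * (if i = i₀ then Ξ (r + m) else 0)) := by
  have h1 : (if i = i₀ then Ξ (r + 1 + m) else 0) * x j r' -
      D.b i j • (x j r' * (if i = i₀ then Ξ (r + 1 + m) else 0)) =
      D.b i j • ((if i = i₀ then Ξ (r + m) else 0) * x j (r' + 1)) -
        x j (r' + 1) * (if i = i₀ then Ξ (r + m) else 0) := by
    split_ifs with hi
    · subst hi
      have := h j (r + m) r'
      rw [add_right_comm]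
      linear_combination (norm := module) (1 : ℂ) • this
    · simp
  have h2 : x i (r + 1) * (if j = i₀ then Ξ (r' + m) else 0) -
      D.b i j • ((if j = i₀ then Ξ (r' + m) else 0) * x i (r + 1)) =
      D.b i j • (x i r * (if j = i₀ then Ξ (r' + 1 + m) else 0)) -
        (if j = i₀ then Ξ (r' + 1 + m) else 0) * x i r := by
    split_ifs with hj
    · subst hj
      have := h i (r' + m) r
      rw [add_right_comm, D.b_symm i j]
      linear_combination (norm := module) (1 : ℂ) • this
    · simp
  linear_combination (norm := module) (1 : ℂ) • h1 + (1 : ℂ) • h2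

theorem quadRel_dualFamily {D : QData I} {x : I → ℤ → E} (hx : QuadRel D x) {i₀ : I}
    {Ξ : ℤ → E} (h : IsContraction D x i₀ Ξ) (m : ℤ) : QuadRel D (dualFamily x i₀ Ξ m) :=
  fun i j => quadString_dual (hx i j) fun r r' => quad_dualFamily h.1 m i j r r'

/-- Restricting to the ε-part avoids the Serre relations of x itself; this is what makes it usable
for deriving them for x⁺. -/
theorem snd_serreSum_dualFamily {D : QData I} {x : I → ℤ → E} {i₀ : I}
    {Ξ : ℤ → E} (h : IsContraction D x i₀ Ξ) (m : ℤ) {i j : I} (hij : i ≠ j)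
    (r : Fin (D.a i j + 1) → ℤ) (r' : ℤ) :
    TrivSqZeroExt.snd (serreSum (D.p i) (D.a i j + 1) (fun c => dualFamily x i₀ Ξ m i (r c))
      (dualFamily x i₀ Ξ m j r')) = 0 := by
  refine snd_serreSum_eq_zero fun J => ?_
  have := h.2 i j hij r r' m J
  rw [dSerreLin_apply] at this
  convert this using 2
  split_ifs <;> simp

end Contraction

/-! ### Inner derivations as homomorphisms to the dual numbers. -/

section DualHom

variable {E : Type*} [Ring E] [Algebra ℂ E]

/-- The homomorphism `e ↦ e + ε [e, z]`. -/
noncomputable def commHom (z : E) : E →ₐ[ℂ] DualNumber E where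
  toFun e := dual e (e * z - z * e)
  map_one' := by ext <;> simp
  map_mul' a b := by
    ext
    · simp
    · simp only [snd_mul', snd_dual, fst_dual]
      noncomm_ring
  map_zero' := by ext <;> simp
  map_add' a b := by
    ext
    · simp
    · simp only [TrivSqZeroExt.snd_add, snd_dual]
      noncomm_ring
  commutes' c := by
    ext
    · simp [TrivSqZeroExt.algebraMap_eq_inl']
    · simp [TrivSqZeroExt.algebraMap_eq_inl', Algebra.commutes]

theorem commHom_apply (z e : E) : commHom z e = dual e (e * z - z * e) := rfl

end DualHom

/-! ### The algebra generated by currents with quadratic and Serre relations -/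

section CurrAlg

variable {I : Type*} [DecidableEq I] {E F : Type*} [Ring E] [Algebra ℂ E] [Ring F] [Algebra ℂ F]

theorem QuadString.map {b : ℂ} {y y' : ℤ → E} (h : QuadString b y y') (f : E →ₐ[ℂ] F) :
    QuadString b (fun r => f (y r)) fun r => f (y' r) := by
  intro r r'
  simpa using congrArg f (h r r')

theorem QuadRel.map {D : QData I} {x : I → ℤ → E} (h : QuadRel D x) (f : E →ₐ[ℂ] F) :
    QuadRel D fun j r => f (x j r) := fun i j => (h i j).map f

theorem SerreRel.map {D : QData I} {x : I → ℤ → E} (h : SerreRel D x) (f : E →ₐ[ℂ] F) :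
    SerreRel D fun j r => f (x j r) := by
  intro i j hij r r'
  rw [← map_serreSum, h i j hij r r', map_zero]

theorem QuadRel.smul {D : QData I} {x : I → ℤ → E} (h : QuadRel D x) (c : I → ℂ) :
    QuadRel D fun j r => c j • x j r := by
  intro i j r r'
  simp only [smul_mul_assoc, mul_smul_comm]
  linear_combination (norm := module) (c i * c j) • h i j r r'

theorem SerreRel.smul {D : QData I} {x : I → ℤ → E} (h : SerreRel D x) (c : I → ℂ) :
    SerreRel D fun j r => c j • x j r := by
  intro i j hij r r'
  rw [serreSum_smul, h i j hij r r', smul_zero]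

/-- The dual family in the direction of a shift. -/
theorem QuadRel.shift {D : QData I} {x : I → ℤ → E} (h : QuadRel D x) (c : I → ℂ) (m : ℤ) :
    QuadRel D fun j r => dual (x j r) (c j • x j (r + m)) := by
  intro i j
  refine quadString_dual (h i j) fun r r' => ?_
  have h1 := h i j (r + m) r'
  have h2 := h i j r (r' + m)
  simp only [add_right_comm _ m 1] at h1 h2
  simp only [smul_mul_assoc, mul_smul_comm]
  linear_combination (norm := module) c i • h1 + c j • h2

/-- By the Leibniz rule the derivative of a Serre relation along a shift is a combination of Serre
relations with one mode shifted. -/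
theorem SerreRel.shift {D : QData I} {x : I → ℤ → E} (h : SerreRel D x) (c : I → ℂ) (m : ℤ) :
    SerreRel D fun j r => dual (x j r) (c j • x j (r + m)) := by
  intro i j hij r r'
  ext
  · change TrivSqZeroExt.fstHom ℂ E E _ = _
    rw [map_serreSum]
    simpa using h i j hij r r'
  · rw [snd_serreSum, serreSum_smul_right, h i j hij r (r' + m), smul_zero, zero_add]
    refine Finset.sum_eq_zero fun d _ => ?_
    rw [serreSum_update_smul]
    have : Function.update (fun b => x i (r b)) d (x i (r d + m)) =
        fun b => x i (Function.update r d (r d + m) b) := by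
      funext b
      by_cases hb : b = d
      · subst hb; simp
      · simp [hb]
    rw [this, h i j hij, smul_zero]

theorem serreRel_dualFamily {D : QData I} {x : I → ℤ → E} (hs : SerreRel D x) {i₀ : I}
    {Ξ : ℤ → E} (h : IsContraction D x i₀ Ξ) (m : ℤ) : SerreRel D (dualFamily x i₀ Ξ m) := by
  intro i j hij r r'
  ext
  · change TrivSqZeroExt.fstHom ℂ E E _ = _
    rw [map_serreSum]
    simpa [dualFamily] using hs i j hij r r'
  · exact snd_serreSum_dualFamily h m hij r r'

/-- The defining relations of `CurrAlg`. -/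
inductive CurrRel (D : QData I) : FreeAlgebra ℂ (I × ℤ) → FreeAlgebra ℂ (I × ℤ) → Prop
  | quad (i j : I) (r r' : ℤ) : CurrRel D
      (FreeAlgebra.ι ℂ (i, r + 1) * FreeAlgebra.ι ℂ (j, r') -
        D.b i j • (FreeAlgebra.ι ℂ (j, r') * FreeAlgebra.ι ℂ (i, r + 1)))
      (D.b i j • (FreeAlgebra.ι ℂ (i, r) * FreeAlgebra.ι ℂ (j, r' + 1)) -
        FreeAlgebra.ι ℂ (j, r' + 1) * FreeAlgebra.ι ℂ (i, r))
  | serre (i j : I) (hij : i ≠ j) (r : Fin (D.a i j + 1) → ℤ) (r' : ℤ) : CurrRel D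
      (serreSum (D.p i) (D.a i j + 1) (fun c => FreeAlgebra.ι ℂ (i, r c)) (FreeAlgebra.ι ℂ (j, r')))
      0

/-- The algebra generated by currents `x_{j,r}` subject to quadratic and Serre relations. -/
def CurrAlg (D : QData I) : Type _ := RingQuot (CurrRel D)

noncomputable instance (D : QData I) : Ring (CurrAlg D) :=
  inferInstanceAs (Ring (RingQuot (CurrRel D)))

noncomputable instance (D : QData I) : Algebra ℂ (CurrAlg D) :=
  inferInstanceAs (Algebra ℂ (RingQuot (CurrRel D)))

variable (D : QData I)

/-- The projection from the free algebra. -/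
noncomputable def toCurrAlg : FreeAlgebra ℂ (I × ℤ) →ₐ[ℂ] CurrAlg D :=
  RingQuot.mkAlgHom ℂ (CurrRel D)

/-- The generators of `CurrAlg`. -/
noncomputable def cx (j : I) (r : ℤ) : CurrAlg D := toCurrAlg D (FreeAlgebra.ι ℂ (j, r))

theorem toCurrAlg_rel {a b : FreeAlgebra ℂ (I × ℤ)} (h : CurrRel D a b) :
    toCurrAlg D a = toCurrAlg D b := RingQuot.mkAlgHom_rel ℂ h

theorem cx_quadRel : QuadRel D (cx D) := by
  intro i j r r'
  simpa [cx] using toCurrAlg_rel D (CurrRel.quad i j r r')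

theorem cx_serreRel : SerreRel D (cx D) := by
  intro i j hij r r'
  have := toCurrAlg_rel D (CurrRel.serre i j hij r r')
  rwa [map_serreSum, map_zero] at this

variable {D}

/-- The universal property of `CurrAlg`. -/
noncomputable def CurrAlg.lift {x : I → ℤ → E} (hq : QuadRel D x) (hs : SerreRel D x) :
    CurrAlg D →ₐ[ℂ] E :=
  RingQuot.liftAlgHom ℂ ⟨FreeAlgebra.lift ℂ fun z => x z.1 z.2, by
    intro a b h
    cases h with
    | quad i j r r' => simpa using hq i j r r'
    | serre i j hij r r' =>
      rw [map_serreSum, map_zero]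
      simpa using hs i j hij r r'⟩

@[simp] theorem CurrAlg.lift_cx {x : I → ℤ → E} (hq : QuadRel D x) (hs : SerreRel D x) (j : I)
    (r : ℤ) : CurrAlg.lift hq hs (cx D j r) = x j r := by
  change RingQuot.liftAlgHom ℂ _ (RingQuot.mkAlgHom ℂ _ _) = _
  rw [RingQuot.liftAlgHom_mkAlgHom_apply]
  simp

theorem CurrAlg.induction {P : CurrAlg D → Prop} (one : P 1) (add : ∀ a b, P a → P b → P (a + b))
    (smul : ∀ (c : ℂ) a, P a → P (c • a)) (mul : ∀ j r a, P a → P (cx D j r * a)) (a : CurrAlg D) :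
    P a := by
  have key : ∀ z : FreeAlgebra ℂ (I × ℤ), ∀ a, P a → P (toCurrAlg D z * a) := by
    intro z
    induction z using FreeAlgebra.induction with
    | grade0 c =>
      intro a ha
      rw [AlgHom.commutes, ← Algebra.smul_def]
      exact smul c a ha
    | grade1 z => exact fun a ha => mul z.1 z.2 a ha
    | mul x y hx hy =>
      intro a ha
      rw [map_mul, mul_assoc]
      exact hx _ (hy _ ha)
    | add x y hx hy =>
      intro a ha
      rw [map_add, add_mul]
      exact add _ _ (hx _ ha) (hy _ ha)
  obtain ⟨z, rfl⟩ : ∃ z, toCurrAlg D z = a := RingQuot.mkAlgHom_surjective ℂ (CurrRel D) a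
  simpa using key z 1 one

theorem CurrAlg.algHom_ext {f g : CurrAlg D →ₐ[ℂ] E} (h : ∀ j r, f (cx D j r) = g (cx D j r)) :
    f = g := by
  refine AlgHom.ext fun a => ?_
  induction a using CurrAlg.induction with
  | one => simp
  | add a b ha hb => simp [ha, hb]
  | smul c a ha => simp [ha]
  | mul j r a ha => simp [ha, h]

end CurrAlg

/-! ### Operators on the free module over the current algebra. -/

section Operators

variable {I : Type*} [DecidableEq I] (D : QData I) (K : Type*) [CommRing K] [Algebra ℂ K]

/-- The module underlying the Verma module. -/
abbrev FreeVerma : Type _ := K ⊗[ℂ] CurrAlg D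

/-- Left multiplication by elements of `CurrAlg`. -/
noncomputable def leftMul : CurrAlg D →ₐ[ℂ] Module.End K (FreeVerma D K) :=
  ((Algebra.lmul K (FreeVerma D K)).restrictScalars ℂ).comp Algebra.TensorProduct.includeRight

/-- Left multiplication by the generators of `CurrAlg`. -/
noncomputable def opX (j : I) (r : ℤ) : Module.End K (FreeVerma D K) := leftMul D K (cx D j r)

theorem leftMul_tmul (a : CurrAlg D) (z : K) (a' : CurrAlg D) :
    leftMul D K a (z ⊗ₜ a') = z ⊗ₜ (a * a') := by
  simp [leftMul]

theorem opX_quadRel : QuadRel D (opX D K) := (cx_quadRel D).map (leftMul D K)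

theorem opX_serreRel : SerreRel D (opX D K) := (cx_serreRel D).map (leftMul D K)

variable {D K}

theorem FreeVerma.induction {P : FreeVerma D K → Prop} (one : P 1)
    (add : ∀ a b, P a → P b → P (a + b)) (smul : ∀ (c : K) a, P a → P (c • a))
    (mul : ∀ j r a, P a → P (opX D K j r a)) (v : FreeVerma D K) : P v := by
  have key : ∀ a : CurrAlg D, P (1 ⊗ₜ a) := by
    intro a
    induction a using CurrAlg.induction with
    | one => exact one
    | add a b ha hb => rw [TensorProduct.tmul_add]; exact add _ _ ha hb
    | smul c a ha =>
      rw [← TensorProduct.smul_tmul, Algebra.smul_def, mul_one, ← mul_one (algebraMap ℂ K c),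
        ← smul_eq_mul, ← TensorProduct.smul_tmul']
      exact smul _ _ ha
    | mul j r a ha => simpa [opX, leftMul_tmul] using mul j r _ ha
  induction v using TensorProduct.induction_on with
  | zero => simpa using smul 0 _ one
  | tmul z a =>
    rw [← mul_one z, ← smul_eq_mul, ← TensorProduct.smul_tmul']
    exact smul _ _ (key a)
  | add a b ha hb => exact add _ _ ha hb

theorem FreeVerma.end_ext {f g : Module.End K (FreeVerma D K)} (one : f 1 = g 1)
    (mul : ∀ j r v, f v = g v → f (opX D K j r v) = g (opX D K j r v)) : f = g := by
  refine LinearMap.ext fun v => ?_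
  induction v using FreeVerma.induction with
  | one => exact one
  | add a b ha hb => rw [map_add, map_add, ha, hb]
  | smul c a ha => rw [map_smul, map_smul, ha]
  | mul j r a ha => exact mul j r a ha

/-- The vector 1 generates the module under the x⁻. This is how the relators among the x⁺ are shown
to vanish. -/
theorem FreeVerma.eq_zero_of_commute {f : Module.End K (FreeVerma D K)} (one : f 1 = 0)
    (mul : ∀ j r, f * opX D K j r = opX D K j r * f) : f = 0 := by
  refine FreeVerma.end_ext (by simpa using one) fun j r v hv => ?_
  have := LinearMap.congr_fun (mul j r) v
  simp only [Module.End.mul_apply] at this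
  rw [this, hv]
  simp

/-- Operators with prescribed commutators with the generators of `CurrAlg`. -/
theorem exists_operator (u : I → ℤ → Module.End K (FreeVerma D K)) (v₀ : FreeVerma D K)
    (hq : QuadRel D fun j r => dual (opX D K j r) (u j r))
    (hs : SerreRel D fun j r => dual (opX D K j r) (u j r)) :
    ∃ f : Module.End K (FreeVerma D K), f 1 = v₀ ∧
      ∀ j r, f * opX D K j r = opX D K j r * f + u j r := by
  -- ρ(a) = a + ε D(a), with D the derivation along left multiplication that sends x_{j,r} to
  -- u_{j,r}. The commutation rule then forces f(a·1) = D(a)1 + a v₀, which is taken as the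
  -- definition.
  set ρ := CurrAlg.lift hq hs with hρ
  have hfst : ∀ a, TrivSqZeroExt.fst (ρ a) = leftMul D K a := by
    have : (TrivSqZeroExt.fstHom ℂ _ _).comp ρ = leftMul D K :=
      CurrAlg.algHom_ext fun j r => by simp [hρ, opX]
    exact fun a => AlgHom.congr_fun this a
  let f₀ : CurrAlg D →ₗ[ℂ] FreeVerma D K :=
    { toFun := fun a => TrivSqZeroExt.snd (ρ a) 1 + leftMul D K a v₀
      map_add' := fun a b => by simp only [map_add, TrivSqZeroExt.snd_add, LinearMap.add_apply]; abel
      map_smul' := fun c a => by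
        simp only [map_smul, TrivSqZeroExt.snd_smul, LinearMap.smul_apply, smul_add,
          RingHom.id_apply] }
  refine ⟨f₀.liftBaseChange K, ?_, fun j r => ?_⟩
  · rw [Algebra.TensorProduct.one_def, LinearMap.liftBaseChange_tmul]
    simp [f₀]
  · refine LinearMap.ext fun v => ?_
    induction v using TensorProduct.induction_on with
    | zero => simp
    | add a b ha hb => rw [map_add, map_add, ha, hb]
    | tmul z a =>
      have h1 : leftMul D K a 1 = 1 ⊗ₜ a := by
        rw [Algebra.TensorProduct.one_def, leftMul_tmul, mul_one]
      have h2 : f₀ (cx D j r * a) = opX D K j r (f₀ a) + u j r (1 ⊗ₜ a) := by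
        simp only [f₀, LinearMap.coe_mk, AddHom.coe_mk, map_mul, snd_mul', hfst, map_add,
          LinearMap.add_apply, Module.End.mul_apply, h1]
        rw [hρ, CurrAlg.lift_cx, snd_dual, ← opX]
        abel
      rw [Module.End.mul_apply, opX, leftMul_tmul, LinearMap.liftBaseChange_tmul, h2, ← opX,
        LinearMap.add_apply, Module.End.mul_apply, LinearMap.liftBaseChange_tmul, smul_add,
        map_smul, ← map_smul (u j r), TensorProduct.smul_tmul', smul_eq_mul, mul_one]

/-- Operators that commute with the generators of `CurrAlg` up to scalars. -/
theorem exists_scaling (c : I → ℂ) (z : K) :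
    ∃ f : Module.End K (FreeVerma D K), f 1 = z • 1 ∧
      ∀ j r, f * opX D K j r = c j • (opX D K j r * f) := by
  let σ : CurrAlg D →ₐ[ℂ] CurrAlg D :=
    CurrAlg.lift ((cx_quadRel D).smul c) ((cx_serreRel D).smul c)
  refine ⟨z • σ.toLinearMap.baseChange K, ?_, fun j r => ?_⟩
  · rw [Algebra.TensorProduct.one_def]
    simp
  · refine LinearMap.ext fun v => ?_
    induction v using TensorProduct.induction_on with
    | zero => simp
    | add a b ha hb => rw [map_add, map_add, ha, hb]
    | tmul y a =>
      simp only [Module.End.mul_apply, opX, leftMul_tmul, LinearMap.smul_apply,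
        LinearMap.baseChange_tmul, AlgHom.toLinearMap_apply, map_mul, map_smul]
      rw [CurrAlg.lift_cx, smul_mul_assoc, TensorProduct.tmul_smul, smul_comm]

theorem quadRel_zero : QuadRel D fun (_ : I) (_ : ℤ) => (0 : ℂ) := by
  intro i j r r'
  simp

theorem serreRel_zero : SerreRel D fun (_ : I) (_ : ℤ) => (0 : ℂ) := by
  intro i j hij r r'
  simpa using serreSum_smul_right (D.p i) (D.a i j + 1) (fun _ => (0 : ℂ)) 0 0

variable (D K) in
/-- The augmentation, which kills the generators of `CurrAlg`. -/
noncomputable def augm : FreeVerma D K →ₗ[K] K :=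
  ((Algebra.linearMap ℂ K).comp
    (CurrAlg.lift (quadRel_zero (D := D)) serreRel_zero).toLinearMap).liftBaseChange K

@[simp] theorem augm_one : augm D K 1 = 1 := by
  rw [augm, Algebra.TensorProduct.one_def, LinearMap.liftBaseChange_tmul]
  simp

@[simp] theorem augm_opX (j : I) (r : ℤ) (v : FreeVerma D K) : augm D K (opX D K j r v) = 0 := by
  induction v using TensorProduct.induction_on with
  | zero => simp
  | add a b ha hb => rw [map_add, map_add, ha, hb, add_zero]
  | tmul y a =>
    rw [opX, leftMul_tmul, augm, LinearMap.liftBaseChange_tmul]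
    simp

theorem augm_map {K' : Type*} [CommRing K'] [Algebra ℂ K'] (f : K →ₐ[ℂ] K') (v : FreeVerma D K) :
    augm D K' (Algebra.TensorProduct.map f (AlgHom.id ℂ (CurrAlg D)) v) = f (augm D K v) := by
  induction v using TensorProduct.induction_on with
  | zero => simp
  | add a b ha hb => rw [map_add, map_add, ha, hb, map_add, map_add]
  | tmul y a =>
    rw [Algebra.TensorProduct.map_tmul, augm, augm, LinearMap.liftBaseChange_tmul,
      LinearMap.liftBaseChange_tmul]
    simp

end Operators

/-! ### The parameters attached to a Cartan matrix -/

section QPow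

variable {t : ℂ}

theorem qpow_add (t : ℂ) (a b : ℚ) : qpow t (a + b) = qpow t a * qpow t b := by
  simp only [qpow, Rat.cast_add, add_mul, Complex.exp_add]

@[simp] theorem qpow_zero (t : ℂ) : qpow t 0 = 1 := by simp [qpow]

theorem qpow_ne_zero (t : ℂ) (a : ℚ) : qpow t a ≠ 0 := Complex.exp_ne_zero _

theorem qpow_neg (t : ℂ) (a : ℚ) : qpow t (-a) = (qpow t a)⁻¹ := by
  simp [qpow, Complex.exp_neg]

theorem qpow_pow (t : ℂ) (a : ℚ) (k : ℕ) : qpow t a ^ k = qpow t (k * a) := by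
  simp only [qpow, ← Complex.exp_nat_mul]
  push_cast
  ring_nf

theorem qpow_zpow (t : ℂ) (a : ℚ) (k : ℤ) : qpow t a ^ k = qpow t (k * a) := by
  simp only [qpow, ← Complex.exp_int_mul]
  push_cast
  ring_nf

theorem generic_qpow (hq : ∀ m : ℕ, 0 < m → Complex.exp t ^ m ≠ 1) {k : ℕ} (hk : 0 < k)
    (ε : ℤˣ) : Generic (qpow t (((ε : ℤ) : ℚ) * k)) := by
  have h : Generic (qpow t k) := by
    refine ⟨qpow_ne_zero _ _, fun m hm h => hq (m * k) (Nat.mul_pos hm hk) ?_⟩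
    rw [qpow_pow] at h
    rw [← h, qpow, ← Complex.exp_nat_mul]
    push_cast
    rfl
  rcases Int.units_eq_one_or ε with rfl | rfl
  · simpa using h
  · simpa [qpow_neg] using generic_inv h

theorem qpow_one_sub_ne_zero (hq : ∀ m : ℕ, 0 < m → Complex.exp t ^ m ≠ 1) :
    qpow t 1 - qpow t (-1) ≠ 0 := by
  have := kap_ne_zero (generic_qpow hq one_pos 1) one_ne_zero
  simpa [kap, qpow_neg] using this

theorem sub_mul_qInt (hq : ∀ m : ℕ, 0 < m → Complex.exp t ^ m ≠ 1) (l : ℤ) :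
    (qpow t 1 - qpow t (-1)) * qInt (qpow t 1) l = qpow t l - qpow t (-l) := by
  have h := qpow_one_sub_ne_zero hq
  rw [qInt, qpow_zpow, qpow_zpow, ← qpow_neg]
  field_simp
  simp

end QPow

variable {n : ℕ} (X : SymmetrizableGCM n)

theorem SymmetrizableGCM.B_symm (i j : Fin n) : X.B i j = X.B j i := X.symm i j

/-- The parameters of the relations among the currents `x^ε`. -/
noncomputable def cartanData {t : ℂ} (hq : ∀ m : ℕ, 0 < m → Complex.exp t ^ m ≠ 1) (ε : ℤˣ) :
    QData (Fin n) where
  p i := qpow t (((ε : ℤ) : ℚ) * X.r i)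
  b i j := qpow t (((ε : ℤ) : ℚ) * X.B i j)
  a i j := (-X.C i j).toNat
  gen i := generic_qpow hq (X.r_pos i) ε
  b_ne i j := qpow_ne_zero _ _
  b_self i := by
    rw [qpow_pow, SymmetrizableGCM.B, X.diag]
    push_cast
    ring_nf
  b_symm i j := by rw [X.B_symm]
  b_off i j hij := by
    have h : (((-X.C i j).toNat : ℕ) : ℚ) = -X.C i j := by
      have := Int.toNat_of_nonneg (neg_nonneg.mpr (X.offDiag i j hij))
      exact_mod_cast congrArg (Int.cast : ℤ → ℚ) this
    rw [qpow_pow, ← qpow_add, SymmetrizableGCM.B, h]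
    push_cast
    ring_nf
    simp

/-! ### The series `φ` in an algebra with Cartan-type elements -/

section Phi

variable {X} {𝔥 : Type*} [AddCommGroup 𝔥] [Module ℚ 𝔥] (R : Realization X 𝔥) (t : ℂ)
variable {E : Type*} [Ring E] [Algebra ℂ E] (kf : 𝔥 → E) (hf : Fin n → {m : ℤ // m ≠ 0} → E)

/-- The series `∑ h_{i, ε m} Z^m`. -/
def hSer (ε : ℤˣ) (i : Fin n) : PowerSeries E :=
  PowerSeries.mk fun m =>
    if hm : m = 0 then 0
    else hf i ⟨(ε : ℤ) * m, mul_ne_zero (Units.ne_zero ε) (Int.natCast_ne_zero.mpr hm)⟩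

/-- The exponent of the series `φ`. -/
noncomputable def phiExp (ε : ℤˣ) (i : Fin n) : PowerSeries E :=
  (((ε : ℤ) : ℂ) * (qpow t 1 - qpow t (-1))) • hSer hf ε i

/-- The series `∑ φ_{i, ε m} Z^m`. -/
noncomputable def phiSer (ε : ℤˣ) (i : Fin n) : PowerSeries E :=
  PowerSeries.C (kf (((ε : ℤ) * (X.r i : ℤ)) • R.coroot i)) * expSeries (phiExp t hf ε i)

theorem coeff_phiExp {ε : ℤˣ} {i : Fin n} {a : ℕ} (ha : a ≠ 0) :
    PowerSeries.coeff a (phiExp t hf ε i) = (((ε : ℤ) : ℂ) * (qpow t 1 - qpow t (-1))) •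
      hf i ⟨(ε : ℤ) * a, mul_ne_zero (Units.ne_zero ε) (Int.natCast_ne_zero.mpr ha)⟩ := by
  simp [phiExp, hSer, ha]

@[simp] theorem coeff_zero_phiExp (ε : ℤˣ) (i : Fin n) :
    PowerSeries.coeff 0 (phiExp t hf ε i) = 0 := by
  simp [phiExp, hSer]

variable {kf hf}

theorem commute_phiExp (hh : ∀ i j m m', Commute (hf i m) (hf j m')) (ε ε' : ℤˣ) (i j : Fin n)
    (a b : ℕ) : Commute (PowerSeries.coeff a (phiExp t hf ε i))
      (PowerSeries.coeff b (phiExp t hf ε' j)) := by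
  rcases eq_or_ne a 0 with rfl | ha
  · simp
  rcases eq_or_ne b 0 with rfl | hb
  · simp
  rw [coeff_phiExp t hf ha, coeff_phiExp t hf hb]
  exact ((hh _ _ _ _).smul_left _).smul_right _

theorem commute_expCoeff {y : E} {f : PowerSeries E} (h : ∀ a, Commute y (PowerSeries.coeff a f))
    (m : ℕ) : Commute y (expCoeff f m) := by
  have hp : ∀ p a, Commute y (PowerSeries.coeff a (f ^ p)) := by
    intro p
    induction p with
    | zero =>
      intro a
      rw [pow_zero, PowerSeries.coeff_one]
      split_ifs
      · exact Commute.one_right y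
      · exact Commute.zero_right y
    | succ p ih =>
      intro a
      rw [pow_succ, PowerSeries.coeff_mul]
      exact Commute.sum_right _ _ _ fun x _ => (ih x.1).mul_right (h x.2)
  exact Commute.sum_right _ _ _ fun p _ => (hp p m).smul_right _

variable {t}

theorem commute_phiSer {y : E} (hk : ∀ h, Commute y (kf h)) (hh : ∀ i m, Commute y (hf i m))
    (ε : ℤˣ) (i : Fin n) (m : ℕ) : Commute y (PowerSeries.coeff m (phiSer R t kf hf ε i)) := by
  rw [phiSer, PowerSeries.coeff_C_mul, coeff_expSeries]
  refine (hk _).mul_right (commute_expCoeff (fun a => ?_) m)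
  rcases eq_or_ne a 0 with rfl | ha
  · simp
  · rw [coeff_phiExp t hf ha]
    exact (hh _ _).smul_right _

theorem commute_zCoeff {y : E} {Φ : PowerSeries E} (h : ∀ m, Commute y (PowerSeries.coeff m Φ))
    (m : ℤ) : Commute y (zCoeff Φ m) := by
  rw [zCoeff]
  split_ifs
  · exact h _
  · exact Commute.zero_right y

theorem map_expCoeff {F : Type*} [Ring F] [Algebra ℂ F] (φ : F →ₐ[ℂ] E) (f : PowerSeries F)
    (m : ℕ) : φ (expCoeff f m) = expCoeff (PowerSeries.map φ.toRingHom f) m := by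
  simp only [expCoeff, map_sum, map_smul, ← map_pow, PowerSeries.coeff_map]
  rfl

theorem map_fphi (φ : Free n 𝔥 →ₐ[ℂ] E) (hφk : ∀ h, φ (fk n h) = kf h)
    (hφh : ∀ i m, φ (fh 𝔥 i m) = hf i m) (ε : ℤˣ) (i : Fin n) (m : ℤ) :
    φ (fphi R t ε i m) = zCoeff (phiSer R t kf hf ε i) ((ε : ℤ) * m) := by
  have h1 : PowerSeries.map φ.toRingHom
      ((((ε : ℤ) : ℂ) * (qpow t 1 - qpow t (-1))) • hSeries 𝔥 ε i) = phiExp t hf ε i := by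
    ext a
    rw [PowerSeries.coeff_map, PowerSeries.coeff_smul]
    rcases eq_or_ne a 0 with rfl | ha
    · simp [hSeries]
    · rw [coeff_phiExp t hf ha]
      simp only [hSeries, PowerSeries.coeff_mk, dif_neg ha]
      exact (map_smul φ _ _).trans (by rw [hφh])
  rw [fphi, zCoeff]
  split_ifs with h
  · have h2 : m.natAbs = ((ε : ℤ) * m).toNat := by
      rcases Int.units_eq_one_or ε with rfl | rfl <;> simp at h ⊢ <;> omega
    rw [fphiNat, map_mul, map_expCoeff, h1, hφk, phiSer, PowerSeries.coeff_C_mul, coeff_expSeries,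
      h2]
  · exact map_zero φ

variable (hq : ∀ m : ℕ, 0 < m → Complex.exp t ^ m ≠ 1) (hh : ∀ i j m m', Commute (hf i m) (hf j m'))
  (hkh : ∀ h i m, Commute (kf h) (hf i m)) {η : ℤˣ} {x : Fin n → ℤ → E}
  (hkx : ∀ h j r, kf h * x j r = qpow t (((η : ℤ) : ℚ) * R.root j h) • (x j r * kf h))
  (hhx : ∀ i j m r, hf i m * x j r - x j r * hf i m =
    (((η : ℤ) : ℂ) * (1 / ((m : ℤ) : ℂ)) * qInt (qpow t 1) ((m : ℤ) * X.B i j)) • x j ((m : ℤ) + r))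

include hq hh hkh hkx hhx

/-- The case b = q^{εηB} of `seriesRel_expSeries`: multiplied by ε(q - q⁻¹), the structure constant
of h_{i,εa} on x^η_j is (b^a - b^{-a})/a. The string is read in the direction ε because φ^ε is a
series in z^ε. -/
theorem seriesRel_phiSer (ε : ℤˣ) (i j : Fin n) :
    SeriesRel (qpow t (((ε : ℤ) : ℚ) * (((η : ℤ) : ℚ) * X.B i j))) (phiSer R t kf hf ε i)
      fun r => x j ((ε : ℤ) * r) := by
  have hε : ((ε : ℤ) : ℚ) * ((ε : ℤ) : ℚ) = 1 := by exact_mod_cast Int.units_coe_mul_self ε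
  refine seriesRel_expSeries (qpow_ne_zero _ _) (coeff_zero_phiExp t hf ε i)
    (commute_phiExp t hh ε ε i i) (fun a r ha => ?_) (fun a => ?_) fun r => ?_
  · rw [coeff_phiExp t hf ha, smul_mul_assoc, mul_smul_comm, ← smul_sub, hhx, smul_smul]
    rw [show (ε : ℤ) * (r + a) = (ε : ℤ) * a + (ε : ℤ) * r by ring]
    congr 1
    have h1 := sub_mul_qInt hq ((ε : ℤ) * a * X.B i j)
    have ha' : (a : ℂ) ≠ 0 := by exact_mod_cast ha
    have hεc : ((ε : ℤ) : ℂ) ≠ 0 := by exact_mod_cast Units.ne_zero ε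
    rw [← qpow_neg, qpow_pow, qpow_pow]
    have h2 : qpow t (a * (((ε : ℤ) : ℚ) * (((η : ℤ) : ℚ) * X.B i j))) -
        qpow t (a * -(((ε : ℤ) : ℚ) * (((η : ℤ) : ℚ) * X.B i j))) =
        ((η : ℤ) : ℂ) * (qpow t ((((ε : ℤ) * a * X.B i j : ℤ)) : ℚ) -
          qpow t (-(((ε : ℤ) * a * X.B i j : ℤ) : ℚ))) := by
      rcases Int.units_eq_one_or η with rfl | rfl
      · push_cast
        ring_nf
      · push_cast
        ring_nf
    rw [h2, ← h1]
    push_cast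
    field_simp
  · rcases eq_or_ne a 0 with rfl | ha
    · simp
    · rw [coeff_phiExp t hf ha]
      exact (hkh _ _ _).smul_right _
  · rw [hkx]
    congr 2
    rw [map_zsmul, R.root_coroot, SymmetrizableGCM.B]
    push_cast
    rw [zsmul_eq_mul]
    push_cast
    ring

omit hq hh hkh hkx hhx in
variable (t kf hf) in
/-- The modes of the commutator of the currents `x^+_i` and `x^-_i`. -/
noncomputable def xiMode (i : Fin n) (r : ℤ) : E :=
  (qpow t (X.r i) - qpow t (-(X.r i)))⁻¹ •
    (zCoeff (phiSer R t kf hf 1 i) r - zCoeff (phiSer R t kf hf (-1) i) (-r))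

/-- Uses only the action of k and h on x, unlike `isContraction_xiMode`, which also needs the
quadratic relations. For x⁺ this one therefore comes first and yields those relations. -/
theorem modeRel_xiMode (i j : Fin n) :
    ModeRel ((cartanData X hq η).b i j) (xiMode R t kf hf i) (x j) := by
  refine ModeRel.smul (ModeRel.sub (SeriesRel.modeRel ?_)
    (ModeRel.reverse ((cartanData X hq η).b_ne i j) (SeriesRel.modeRel ?_))) _
  · simpa [cartanData] using seriesRel_phiSer R hq hh hkh hkx hhx 1 i j
  · simpa [cartanData, qpow_neg] using seriesRel_phiSer R hq hh hkh hkx hhx (-1) i j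

theorem isContraction_xiMode (hx : QuadRel (cartanData X hq η) x) (i : Fin n) :
    IsContraction (cartanData X hq η) x i (xiMode R t kf hf i) := by
  refine IsContraction.smul (IsContraction.sub (isContraction_zCoeff hx fun j => ?_)
    (isContraction_zCoeff_neg hx fun j => ?_)) _
  · simpa [cartanData] using seriesRel_phiSer R hq hh hkh hkx hhx 1 i j
  · simpa [cartanData, qpow_neg] using seriesRel_phiSer R hq hh hkh hkx hhx (-1) i j

end Phi

/-! ### The action of the quantum affinization on the algebra of negative currents -/

/-- The hypothesis on v says that the Euler derivative of f acts on v as the logarithmic derivative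
of P. Then exp(f)v and Pv obey the same recursion from the same start. -/
theorem expCoeff_apply {K V : Type*} [CommRing K] [Algebra ℂ K] [AddCommGroup V] [Module K V]
    [Module ℂ V] [IsScalarTower ℂ K V] [SMulCommClass K ℂ V]
    {f : PowerSeries (Module.End K V)} {P Δ : PowerSeries K} {v : V}
    (hf : PowerSeries.coeff 0 f = 0)
    (hc : ∀ a b, Commute (PowerSeries.coeff a f) (PowerSeries.coeff b f))
    (hP : euler P = Δ * P) (hP0 : PowerSeries.coeff 0 P = 1)
    (hv : ∀ a, a • PowerSeries.coeff a f v = PowerSeries.coeff a Δ • v) (m : ℕ) :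
    expCoeff f m v = PowerSeries.coeff m P • v := by
  induction m using Nat.strong_induction_on with
  | _ m ih =>
    rcases eq_or_ne m 0 with rfl | hm
    · simp [hP0]
    have h1 := congrArg (fun F : PowerSeries (Module.End K V) => PowerSeries.coeff m F v) (euler_expSeries hf hc)
    simp only [coeff_euler, PowerSeries.coeff_mul, coeff_expSeries, LinearMap.sum_apply,
      LinearMap.smul_apply, Module.End.mul_apply] at h1
    have h2 := congrArg (fun F : PowerSeries K => PowerSeries.coeff m F • v) hP
    simp only [coeff_euler, PowerSeries.coeff_mul, Finset.sum_smul] at h2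
    have h3 : m • expCoeff f m v = m • (PowerSeries.coeff m P • v) := by
      rw [h1, ← smul_assoc, h2]
      refine Finset.sum_congr rfl fun x hx => ?_
      rcases eq_or_ne x.1 0 with h0 | h0
      · have := hv 0
        simp only [zero_smul] at this
        rw [h0, zero_smul, mul_comm, mul_smul, ← this, smul_zero]
      · rw [ih x.2 (by have := Finset.HasAntidiagonal.mem_antidiagonal.mp hx; omega), map_smul,
          mul_comm, mul_smul, ← hv, smul_comm]
    have h4 := congrArg (fun z => (m : ℂ)⁻¹ • z) h3
    have hm' : (m : ℂ) ≠ 0 := by exact_mod_cast hm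
    simpa only [← Nat.cast_smul_eq_nsmul ℂ, smul_smul, inv_mul_cancel₀ hm', one_smul] using h4

theorem list_prod_apply_eq_zero {K V : Type*} [CommRing K] [AddCommGroup V] [Module K V] {v : V}
    (l : List (Module.End K V)) (hl : l ≠ []) (h : ∀ f ∈ l, f v = 0) : l.prod v = 0 := by
  induction l with
  | nil => exact absurd rfl hl
  | cons f l ih =>
    rw [List.prod_cons, Module.End.mul_apply]
    rcases eq_or_ne l [] with rfl | hl'
    · simpa using h f (by simp)
    · rw [ih hl' fun g hg => h g (List.mem_cons_of_mem _ hg), map_zero]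

/-- Every word contains X, hence is a nonempty product of operators killing v. -/
theorem serreSum_apply_eq_zero {K V : Type*} [CommRing K] [Algebra ℂ K] [AddCommGroup V]
    [Module K V] [Module ℂ V] [IsScalarTower ℂ K V] [SMulCommClass K ℂ V] {v : V} (p : ℂ) (s : ℕ)
    {a : Fin s → Module.End K V} {X : Module.End K V} (ha : ∀ c, a c v = 0) (hX : X v = 0) :
    serreSum p s a X v = 0 := by
  simp only [serreSum, LinearMap.sum_apply, LinearMap.smul_apply]
  refine Finset.sum_eq_zero fun π _ => Finset.sum_eq_zero fun k _ => ?_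
  set l := List.ofFn fun b => a (π b) with hl
  have hla : ∀ f ∈ l, f v = 0 := by
    intro f hf
    obtain ⟨b, rfl⟩ := (List.mem_ofFn' _ _).mp hf
    exact ha _
  have : (l.take k).prod * X * (l.drop k).prod = (l.take k ++ [X] ++ l.drop k).prod := by
    simp [mul_assoc]
  rw [this, list_prod_apply_eq_zero _ (by simp), smul_zero]
  intro f hf
  simp only [List.mem_append, List.mem_singleton] at hf
  rcases hf with (hf | rfl) | hf
  · exact hla f (List.mem_of_mem_take hf)
  · exact hX
  · exact hla f (List.mem_of_mem_drop hf)

section Action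

variable {n : ℕ} {X : SymmetrizableGCM n} {𝔥 : Type*} [AddCommGroup 𝔥] [Module ℚ 𝔥]
variable {R : Realization X 𝔥} {t : ℂ} (hq : ∀ m : ℕ, 0 < m → Complex.exp t ^ m ≠ 1)
  (w : LUWeight R t) (K : Type*) [CommRing K] [Algebra ℂ K] [Algebra ℂ[T;T⁻¹] K]
  [IsScalarTower ℂ ℂ[T;T⁻¹] K]

/-- The series `∑ Ψ_{i, ε m} Z^m`, divided by its constant term. -/
noncomputable def psiNorm (ε : ℤˣ) (i : Fin n) : PowerSeries K := PowerSeries.mk fun m =>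
  qpow t (-(((ε : ℤ) : ℚ) * X.r i * w.wt (R.coroot i))) • algebraMap ℂ[T;T⁻¹] K (w.psi ε i m)

theorem coeff_zero_psiNorm (ε : ℤˣ) (i : Fin n) : PowerSeries.coeff 0 (psiNorm w K ε i) = 1 := by
  have h : algebraMap ℂ[T;T⁻¹] K (LaurentPolynomial.C
      (qpow t (((ε : ℤ) : ℚ) * X.r i * w.wt (R.coroot i)))) =
      algebraMap ℂ K (qpow t (((ε : ℤ) : ℚ) * X.r i * w.wt (R.coroot i))) :=
    (IsScalarTower.algebraMap_apply ℂ ℂ[T;T⁻¹] K _).symm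
  rw [psiNorm, PowerSeries.coeff_mk, w.psi_zero, h, Algebra.smul_def, ← map_mul, ← qpow_add,
    neg_add_cancel, qpow_zero, map_one]

/-- The logarithmic derivative of `psiNorm`. -/
noncomputable def psiLog (ε : ℤˣ) (i : Fin n) : PowerSeries K :=
  euler (psiNorm w K ε i) * PowerSeries.invOfUnit (psiNorm w K ε i) 1

theorem euler_psiNorm (ε : ℤˣ) (i : Fin n) :
    euler (psiNorm w K ε i) = psiLog w K ε i * psiNorm w K ε i := by
  have h : psiNorm w K ε i * PowerSeries.invOfUnit (psiNorm w K ε i) 1 = 1 :=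
    PowerSeries.mul_invOfUnit _ _ (by simpa using coeff_zero_psiNorm w K ε i)
  rw [psiLog, mul_assoc, mul_comm (PowerSeries.invOfUnit _ _), h, mul_one]

theorem coeff_zero_psiLog (ε : ℤˣ) (i : Fin n) : PowerSeries.coeff 0 (psiLog w K ε i) = 0 := by
  simp [psiLog, PowerSeries.coeff_mul]

/-- The eigenvalue of `h_{i,m}` on the highest weight vector. -/
noncomputable def hEigen (i : Fin n) (m : {m : ℤ // m ≠ 0}) : K :=
  (((m : ℤ) : ℂ) * (qpow t 1 - qpow t (-1)))⁻¹ •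
    PowerSeries.coeff (m : ℤ).natAbs (psiLog w K (if 0 < (m : ℤ) then 1 else -1) i)

/-- The module underlying the Verma module. -/
abbrev VermaModel : Type _ := FreeVerma (cartanData X hq (-1)) K

/-- The operators `x_{j,r}^-`. -/
noncomputable def xmOp (j : Fin n) (r : ℤ) : Module.End K (VermaModel hq K (X := X)) :=
  opX (cartanData X hq (-1)) K j r

theorem exists_kOp (h : 𝔥) : ∃ f : Module.End K (VermaModel hq K (X := X)),
    f 1 = algebraMap ℂ K (qpow t (w.wt h)) • 1 ∧
      ∀ j r, f * xmOp hq K j r = qpow t (-R.root j h) • (xmOp hq K j r * f) :=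
  exists_scaling _ _

/-- The operator `k_h`. -/
noncomputable def kOp (h : 𝔥) : Module.End K (VermaModel hq K (X := X)) :=
  (exists_kOp hq w K h).choose

theorem kOp_one (h : 𝔥) : kOp hq w K h 1 = algebraMap ℂ K (qpow t (w.wt h)) • 1 :=
  (exists_kOp hq w K h).choose_spec.1

theorem kOp_mul (h : 𝔥) (j : Fin n) (r : ℤ) :
    kOp hq w K h * xmOp hq K j r = qpow t (-R.root j h) • (xmOp hq K j r * kOp hq w K h) :=
  (exists_kOp hq w K h).choose_spec.2 j r

theorem kOp_xmOp (h : 𝔥) (j : Fin n) (r : ℤ) (v : VermaModel hq K (X := X)) :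
    kOp hq w K h (xmOp hq K j r v) = qpow t (-R.root j h) • xmOp hq K j r (kOp hq w K h v) :=
  LinearMap.congr_fun (kOp_mul hq w K h j r) v

/-- The structure constants `[h_{i,m}, x_{j,r}^ε] = c x_{j,m+r}^ε`. -/
noncomputable def hxCoeff (X : SymmetrizableGCM n) (t : ℂ) (ε : ℤˣ) (i : Fin n)
    (m : {m : ℤ // m ≠ 0}) (j : Fin n) : ℂ :=
  ((ε : ℤ) : ℂ) * (1 / ((m : ℤ) : ℂ)) * qInt (qpow t 1) ((m : ℤ) * X.B i j)

/-- Shifting modes is a derivation compatible with all relations, and the value on 1 can be chosen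
freely. -/
theorem exists_hOp (i : Fin n) (m : {m : ℤ // m ≠ 0}) :
    ∃ f : Module.End K (VermaModel hq K (X := X)), f 1 = hEigen w K i m • 1 ∧
      ∀ j r, f * xmOp hq K j r = xmOp hq K j r * f +
        hxCoeff X t (-1) i m j • xmOp hq K j (r + m) :=
  exists_operator _ _ ((opX_quadRel _ K).shift _ _) ((opX_serreRel _ K).shift _ _)

/-- The operator `h_{i,m}`. -/
noncomputable def hOp (i : Fin n) (m : {m : ℤ // m ≠ 0}) :
    Module.End K (VermaModel hq K (X := X)) := (exists_hOp hq w K i m).choose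

theorem hOp_one (i : Fin n) (m : {m : ℤ // m ≠ 0}) :
    hOp hq w K i m 1 = hEigen w K i m • 1 := (exists_hOp hq w K i m).choose_spec.1

theorem hOp_mul (i : Fin n) (m : {m : ℤ // m ≠ 0}) (j : Fin n) (r : ℤ) :
    hOp hq w K i m * xmOp hq K j r = xmOp hq K j r * hOp hq w K i m +
        hxCoeff X t (-1) i m j • xmOp hq K j (r + m) := (exists_hOp hq w K i m).choose_spec.2 j r

theorem hOp_xmOp (i : Fin n) (m : {m : ℤ // m ≠ 0}) (j : Fin n) (r : ℤ)
    (v : VermaModel hq K (X := X)) :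
    hOp hq w K i m (xmOp hq K j r v) = xmOp hq K j r (hOp hq w K i m v) +
      hxCoeff X t (-1) i m j • xmOp hq K j (r + m) v :=
  LinearMap.congr_fun (hOp_mul hq w K i m j r) v

variable {K} in
theorem VermaModel.end_ext {f g : Module.End K (VermaModel hq K (X := X))} (one : f 1 = g 1)
    (mul : ∀ j r v, f v = g v → f (xmOp hq K j r v) = g (xmOp hq K j r v)) : f = g :=
  FreeVerma.end_ext one mul

theorem kOp_add (h h' : 𝔥) : kOp hq w K h * kOp hq w K h' = kOp hq w K (h + h') := by
  refine VermaModel.end_ext hq ?_ fun j r v hv => ?_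
  · simp only [Module.End.mul_apply, kOp_one, map_smul, LinearMap.map_smul_of_tower, smul_smul, ← map_mul, ← qpow_add, map_add,
      add_comm]
  · simp only [Module.End.mul_apply] at hv
    simp only [Module.End.mul_apply, kOp_xmOp, map_smul, LinearMap.map_smul_of_tower, hv, smul_smul, ← qpow_add, map_add]
    rw [neg_add, add_comm]

theorem kOp_zero : kOp hq w K (0 : 𝔥) = 1 := by
  refine VermaModel.end_ext hq ?_ fun j r v hv => ?_
  · simp [kOp_one]
  · rw [kOp_xmOp, hv]
    simp

theorem commute_kOp_hOp (h : 𝔥) (i : Fin n) (m : {m : ℤ // m ≠ 0}) :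
    Commute (kOp hq w K h) (hOp hq w K i m) := by
  refine VermaModel.end_ext hq ?_ fun j r v hv => ?_
  · simp only [Module.End.mul_apply, kOp_one, hOp_one, map_smul, LinearMap.map_smul_of_tower, smul_smul, mul_comm]
  · simp only [Module.End.mul_apply] at hv
    simp only [Module.End.mul_apply, kOp_xmOp, hOp_xmOp, map_smul, LinearMap.map_smul_of_tower, map_add, hv]
    module

theorem commute_hOp (i j : Fin n) (m m' : {m : ℤ // m ≠ 0}) :
    Commute (hOp hq w K i m) (hOp hq w K j m') := by
  refine VermaModel.end_ext hq ?_ fun l r v hv => ?_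
  · simp only [Module.End.mul_apply, hOp_one, map_smul, LinearMap.map_smul_of_tower, smul_smul, mul_comm]
  · simp only [Module.End.mul_apply] at hv
    simp only [Module.End.mul_apply, hOp_xmOp, map_smul, LinearMap.map_smul_of_tower, map_add, hv, add_right_comm r _ (m : ℤ)]
    module

/-- The normalization of `hEigen` is made for this: a from the Euler operator and ε(q - q⁻¹) from
the exponent cancel (εa(q - q⁻¹))⁻¹. -/
theorem phiExp_hOp_one (ε : ℤˣ) (i : Fin n) (a : ℕ) :
    a • PowerSeries.coeff a (phiExp t (hOp hq w K) ε i) (1 : VermaModel hq K) =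
      PowerSeries.coeff a (psiLog w K ε i) • 1 := by
  rcases eq_or_ne a 0 with rfl | ha
  · simp [coeff_zero_psiLog]
  rw [coeff_phiExp t _ ha, LinearMap.smul_apply, hOp_one, hEigen]
  have h1 : (if (0 : ℤ) < (ε : ℤ) * a then (1 : ℤˣ) else -1) = ε := by
    rcases Int.units_eq_one_or ε with rfl | rfl
    · rw [if_pos (by simp; omega)]
    · rw [if_neg (by simp)]
  have h2 : ((ε : ℤ) * (a : ℤ)).natAbs = a := by
    rcases Int.units_eq_one_or ε with rfl | rfl <;> simp
  simp only [h1, h2]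
  rw [← Nat.cast_smul_eq_nsmul ℂ, smul_assoc, smul_smul, smul_smul]
  have hq' := qpow_one_sub_ne_zero hq
  have ha' : (a : ℂ) ≠ 0 := by exact_mod_cast ha
  have hεc : ((ε : ℤ) : ℂ) ≠ 0 := by exact_mod_cast Units.ne_zero ε
  have h3 : (a : ℂ) * (((ε : ℤ) : ℂ) * (qpow t 1 - qpow t (-1))) *
      ((((ε : ℤ) * (a : ℤ) : ℤ) : ℂ) * (qpow t 1 - qpow t (-1)))⁻¹ = 1 := by
    push_cast
    field_simp
  rw [h3, one_smul]

theorem phiSer_one (ε : ℤˣ) (i : Fin n) (m : ℕ) :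
    PowerSeries.coeff m (phiSer R t (kOp hq w K) (hOp hq w K) ε i) (1 : VermaModel hq K) =
      algebraMap ℂ[T;T⁻¹] K (w.psi ε i m) • 1 := by
  rw [phiSer, PowerSeries.coeff_C_mul, coeff_expSeries, Module.End.mul_apply,
    expCoeff_apply (coeff_zero_phiExp t _ ε i)
      (commute_phiExp t (commute_hOp hq w K) ε ε i i) (euler_psiNorm w K ε i)
      (coeff_zero_psiNorm w K ε i) (phiExp_hOp_one hq w K ε i), map_smul, kOp_one, smul_smul,
    psiNorm, PowerSeries.coeff_mk, mul_comm, ← Algebra.smul_def, smul_smul, ← qpow_add]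
  rw [map_zsmul, zsmul_eq_mul]
  push_cast
  rw [add_neg_cancel, qpow_zero, one_smul]

theorem xmOp_quadRel : QuadRel (cartanData X hq (-1)) (xmOp hq K (X := X)) := opX_quadRel _ K

theorem xmOp_serreRel : SerreRel (cartanData X hq (-1)) (xmOp hq K (X := X)) := opX_serreRel _ K

/-- The operators `[x_{i,r}^+, x_{i,r'}^-]`, depending on `r + r'`. -/
noncomputable def xiOp (i : Fin n) (r : ℤ) : Module.End K (VermaModel hq K (X := X)) :=
  xiMode R t (kOp hq w K) (hOp hq w K) i r

theorem isContraction_xmOp (i : Fin n) :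
    IsContraction (cartanData X hq (-1)) (xmOp hq K) i (xiOp hq w K i) := by
  refine isContraction_xiMode R hq (commute_hOp hq w K) (commute_kOp_hOp hq w K)
    (fun h j r => ?_) (fun i j m r => ?_) (xmOp_quadRel hq K) i
  · rw [kOp_mul]
    simp
  · rw [hOp_mul, add_sub_cancel_left, add_comm r]
    rfl

/-- The contraction property says precisely that the family x⁻ + εξ satisfies the defining relations
over the dual numbers. -/
theorem exists_xpOp (i : Fin n) (r : ℤ) : ∃ f : Module.End K (VermaModel hq K (X := X)),
    f 1 = 0 ∧ ∀ j r', f * xmOp hq K j r' = xmOp hq K j r' * f +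
      if j = i then xiOp hq w K i (r' + r) else 0 :=
  exists_operator _ _ (quadRel_dualFamily (xmOp_quadRel hq K) (isContraction_xmOp hq w K i) r)
    (serreRel_dualFamily (xmOp_serreRel hq K) (isContraction_xmOp hq w K i) r)

/-- The operator `x_{i,r}^+`. -/
noncomputable def xpOp (i : Fin n) (r : ℤ) : Module.End K (VermaModel hq K (X := X)) :=
  (exists_xpOp hq w K i r).choose

theorem xpOp_one (i : Fin n) (r : ℤ) : xpOp hq w K i r 1 = 0 :=
  (exists_xpOp hq w K i r).choose_spec.1

theorem xpOp_mul (i : Fin n) (r : ℤ) (j : Fin n) (r' : ℤ) :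
    xpOp hq w K i r * xmOp hq K j r' = xmOp hq K j r' * xpOp hq w K i r +
      if j = i then xiOp hq w K i (r' + r) else 0 := (exists_xpOp hq w K i r).choose_spec.2 j r'

theorem xpOp_xmOp (i : Fin n) (r : ℤ) (j : Fin n) (r' : ℤ) (v : VermaModel hq K (X := X)) :
    xpOp hq w K i r (xmOp hq K j r' v) = xmOp hq K j r' (xpOp hq w K i r v) +
      if j = i then xiOp hq w K i (r' + r) v else 0 := by
  have := LinearMap.congr_fun (xpOp_mul hq w K i r j r') v
  simp only [Module.End.mul_apply, LinearMap.add_apply] at this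
  rw [this]
  split_ifs <;> simp

theorem commute_xiOp {y : Module.End K (VermaModel hq K (X := X))}
    (hk : ∀ h, Commute y (kOp hq w K h)) (hh : ∀ i m, Commute y (hOp hq w K i m)) (i : Fin n)
    (r : ℤ) : Commute y (xiOp hq w K i r) :=
  ((commute_zCoeff (commute_phiSer R hk hh 1 i) _).sub_right
    (commute_zCoeff (commute_phiSer R hk hh (-1) i) _)).smul_right _

theorem commute_kOp_xiOp (h : 𝔥) (i : Fin n) (r : ℤ) : Commute (kOp hq w K h) (xiOp hq w K i r) :=
  commute_xiOp hq w K (fun h' => by rw [Commute, SemiconjBy, kOp_add, kOp_add, add_comm])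
    (fun i m => commute_kOp_hOp hq w K h i m) i r

theorem commute_hOp_xiOp (i : Fin n) (m : {m : ℤ // m ≠ 0}) (j : Fin n) (r : ℤ) :
    Commute (hOp hq w K i m) (xiOp hq w K j r) :=
  commute_xiOp hq w K (fun h => (commute_kOp_hOp hq w K h i m).symm)
    (fun j m' => commute_hOp hq w K i j m m') j r

/-- Both sides kill 1. Passing an x⁻ produces an extra ξ, which commutes with k_h and has weight
zero because the weights of x⁺_i and x⁻_i are opposite. -/
theorem kOp_mul_xpOp (h : 𝔥) (j : Fin n) (r : ℤ) :
    kOp hq w K h * xpOp hq w K j r = qpow t (R.root j h) • (xpOp hq w K j r * kOp hq w K h) := by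
  refine VermaModel.end_ext hq ?_ fun l r' v hv => ?_
  · simp [xpOp_one, kOp_one]
  · simp only [Module.End.mul_apply, LinearMap.smul_apply] at hv
    simp only [Module.End.mul_apply, LinearMap.smul_apply, xpOp_xmOp, kOp_xmOp, map_add, hv,
      map_smul, LinearMap.map_smul_of_tower]
    have h1 := LinearMap.congr_fun (commute_kOp_xiOp hq w K h j (r' + r)).eq v
    simp only [Module.End.mul_apply] at h1
    split_ifs with hl
    · subst hl
      have h2 : qpow t (R.root l h) * qpow t (-R.root l h) = 1 := by
        rw [← qpow_add, add_neg_cancel, qpow_zero]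
      rw [h1, smul_add, smul_add, smul_smul (qpow t (R.root l h)) _ (xiOp hq w K l _ _), h2,
        one_smul, smul_comm]
    · simp only [map_zero, add_zero]
      rw [smul_comm]

theorem hOp_mul_xpOp (i : Fin n) (m : {m : ℤ // m ≠ 0}) (j : Fin n) (r : ℤ) :
    hOp hq w K i m * xpOp hq w K j r - xpOp hq w K j r * hOp hq w K i m =
      hxCoeff X t 1 i m j • xpOp hq w K j ((m : ℤ) + r) := by
  have hc : ∀ l, hxCoeff X t (-1) i m l = -hxCoeff X t 1 i m l := by
    intro l
    simp [hxCoeff]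
  refine VermaModel.end_ext hq ?_ fun l r' v hv => ?_
  · simp [xpOp_one, hOp_one]
  · simp only [Module.End.mul_apply, LinearMap.smul_apply, LinearMap.sub_apply] at hv
    simp only [Module.End.mul_apply, LinearMap.smul_apply, LinearMap.sub_apply, xpOp_xmOp,
      hOp_xmOp, map_add, map_smul, LinearMap.map_smul_of_tower, hc]
    have h1 := LinearMap.congr_fun (commute_hOp_xiOp hq w K i m j (r' + r)).eq v
    simp only [Module.End.mul_apply] at h1
    have h3 := congrArg (xmOp hq K l r') hv
    simp only [map_sub, map_smul, LinearMap.map_smul_of_tower] at h3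
    split_ifs with hl
    · subst hl
      rw [h1, add_assoc r' (m : ℤ) r]
      linear_combination (norm := module) (1 : ℂ) • h3
    · simp only [map_zero]
      linear_combination (norm := module) (1 : ℂ) • h3

theorem modeRel_xpOp (i j : Fin n) :
    ModeRel ((cartanData X hq 1).b i j) (xiOp hq w K i) (xpOp hq w K j) := by
  refine modeRel_xiMode R hq (commute_hOp hq w K) (commute_kOp_hOp hq w K)
    (fun h j r => ?_) (fun i j m r => ?_) i j
  · rw [kOp_mul_xpOp]
    simp
  · exact hOp_mul_xpOp hq w K i m j r

theorem commutator_xpOp (i : Fin n) (r : ℤ) (j : Fin n) (r' : ℤ) :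
    xpOp hq w K i r * xmOp hq K j r' - xmOp hq K j r' * xpOp hq w K i r =
      if i = j then xiOp hq w K j (r + r') else 0 := by
  rw [xpOp_mul, add_sub_cancel_left]
  by_cases h : i = j
  · subst h
    rw [if_pos rfl, if_pos rfl, add_comm]
  · rw [if_neg h, if_neg (Ne.symm h)]

/-- The relator kills 1, and its commutator with x⁻_{l,s} is the derivative of the relation in the
direction ξ_l, which vanishes by `quad_dualFamily`. -/
theorem xpOp_quadRel : QuadRel (cartanData X hq 1) (xpOp hq w K) := by
  intro i j r r'
  rw [← sub_eq_zero]
  refine FreeVerma.eq_zero_of_commute (by simp [xpOp_one]) fun l s => ?_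
  have h := quad_dualFamily (modeRel_xpOp hq w K l) s i j r r'
  simp only [← commutator_xpOp] at h
  change _ * xmOp hq K l s = xmOp hq K l s * _
  rw [← sub_eq_zero] at h ⊢
  simp only [mul_sub, sub_mul, mul_add, add_mul, smul_sub, smul_add, mul_smul_comm, smul_mul_assoc,
    mul_assoc] at h ⊢
  linear_combination (norm := module) (1 : ℂ) • h

theorem isContraction_xpOp (i : Fin n) :
    IsContraction (cartanData X hq 1) (xpOp hq w K) i (xiOp hq w K i) := by
  refine isContraction_xiMode R hq (commute_hOp hq w K) (commute_kOp_hOp hq w K)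
    (fun h j r => ?_) (fun i j m r => ?_) (xpOp_quadRel hq w K) i
  · rw [kOp_mul_xpOp]
    simp
  · exact hOp_mul_xpOp hq w K i m j r

/-- As for the quadratic relations: the commutator with x⁻_{l,s} is the ε-part of the Serre sum of
the dual family, since that family is the image of x⁺ under `commHom`. -/
theorem xpOp_serreRel : SerreRel (cartanData X hq 1) (xpOp hq w K) := by
  intro i j hij r r'
  refine FreeVerma.eq_zero_of_commute
    (serreSum_apply_eq_zero _ _ (fun c => xpOp_one hq w K _ _) (xpOp_one hq w K _ _)) fun l s => ?_
  change _ * xmOp hq K l s = xmOp hq K l s * _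
  have h := snd_serreSum_dualFamily (isContraction_xpOp hq w K l) s hij r r'
  have hd : ∀ a b, dualFamily (xpOp hq w K) l (xiOp hq w K l) s a b =
      commHom (xmOp hq K l s) (xpOp hq w K a b) := by
    intro a b
    rw [commHom_apply, commutator_xpOp, dualFamily]
  simp only [hd] at h
  rwa [← map_serreSum, commHom_apply, snd_dual, sub_eq_zero] at h

end Action

/-! ### The representation of the quantum affinization. -/

section Representation

variable {n : ℕ} {X : SymmetrizableGCM n} {𝔥 : Type*} [AddCommGroup 𝔥] [Module ℚ 𝔥]
variable {R : Realization X 𝔥} {t : ℂ} (hq : ∀ m : ℕ, 0 < m → Complex.exp t ^ m ≠ 1)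
  (w : LUWeight R t) (K : Type*) [CommRing K] [Algebra ℂ K] [Algebra ℂ[T;T⁻¹] K]
  [IsScalarTower ℂ ℂ[T;T⁻¹] K]

/-- The operators `x_{j,r}^ε`. -/
noncomputable def xOp (ε : ℤˣ) (j : Fin n) (r : ℤ) : Module.End K (VermaModel hq K (X := X)) :=
  if ε = 1 then xpOp hq w K j r else xmOp hq K j r

@[simp] theorem xOp_pos : xOp hq w K 1 = xpOp hq w K := by
  funext j r
  simp [xOp]

@[simp] theorem xOp_neg : xOp hq w K (-1) = xmOp hq K := by
  funext j r
  simp [xOp]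

/-- The action of the free algebra on the model of the Verma module. -/
noncomputable def genHom : Free n 𝔥 →ₐ[ℂ] Module.End K (VermaModel hq K (X := X)) :=
  FreeAlgebra.lift ℂ fun
    | Gen.x ε i r => xOp hq w K ε i r
    | Gen.k h => kOp hq w K h
    | Gen.h i m => hOp hq w K i m

@[simp] theorem genHom_fx (ε : ℤˣ) (i : Fin n) (r : ℤ) :
    genHom hq w K (fx 𝔥 ε i r) = xOp hq w K ε i r := by simp [genHom, fx]

@[simp] theorem genHom_fk (h : 𝔥) : genHom hq w K (fk n h) = kOp hq w K h := by
  simp [genHom, fk]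

@[simp] theorem genHom_fh (i : Fin n) (m : {m : ℤ // m ≠ 0}) :
    genHom hq w K (fh 𝔥 i m) = hOp hq w K i m := by simp [genHom, fh]

theorem genHom_fphi (ε : ℤˣ) (i : Fin n) (m : ℤ) : genHom hq w K (fphi R t ε i m) =
    zCoeff (phiSer R t (kOp hq w K) (hOp hq w K) ε i) ((ε : ℤ) * m) :=
  map_fphi R _ (genHom_fk hq w K) (genHom_fh hq w K) ε i m

theorem kOp_mul_xOp (ε : ℤˣ) (h : 𝔥) (j : Fin n) (r : ℤ) :
    kOp hq w K h * xOp hq w K ε j r =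
      qpow t (((ε : ℤ) : ℚ) * R.root j h) • (xOp hq w K ε j r * kOp hq w K h) := by
  rcases Int.units_eq_one_or ε with rfl | rfl
  · simpa using kOp_mul_xpOp hq w K h j r
  · simpa using kOp_mul hq w K h j r

theorem hOp_mul_xOp (ε : ℤˣ) (i : Fin n) (m : {m : ℤ // m ≠ 0}) (j : Fin n) (r : ℤ) :
    hOp hq w K i m * xOp hq w K ε j r - xOp hq w K ε j r * hOp hq w K i m =
      hxCoeff X t ε i m j • xOp hq w K ε j ((m : ℤ) + r) := by
  rcases Int.units_eq_one_or ε with rfl | rfl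
  · simpa using hOp_mul_xpOp hq w K i m j r
  · simp [hOp_mul, add_comm]

theorem xOp_quadRel (ε : ℤˣ) : QuadRel (cartanData X hq ε) (xOp hq w K ε) := by
  rcases Int.units_eq_one_or ε with rfl | rfl
  · simpa using xpOp_quadRel hq w K
  · simpa using xmOp_quadRel hq K

theorem xOp_serreRel (ε : ℤˣ) : SerreRel (cartanData X hq ε) (xOp hq w K ε) := by
  rcases Int.units_eq_one_or ε with rfl | rfl
  · simpa using xpOp_serreRel hq w K
  · simpa using xmOp_serreRel hq K

theorem qBinom_qpow_units (ε : ℤˣ) (a : ℚ) (s k : ℕ) :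
    qBinom (qpow t (((ε : ℤ) : ℚ) * a)) s k = qBinom (qpow t a) s k := by
  rcases Int.units_eq_one_or ε with rfl | rfl
  · simp
  · simp [qpow_neg, qBinom_inv]

/-- `cartanData` uses q_i^ε whereas the defining relation has q_i for both signs; q-binomials do not
change under inversion of the parameter. -/
theorem serreSum_eq_of_serreRel {E : Type*} [Ring E] [Algebra ℂ E] {ε : ℤˣ} {x : Fin n → ℤ → E}
    (hx : SerreRel (cartanData X hq ε) x) {i j : Fin n} (hij : i ≠ j) (s : ℕ)
    (hs : (s : ℤ) = 1 - X.C i j) (r : Fin s → ℤ) (r' : ℤ) :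
    serreSum (qpow t (X.r i)) s (fun a => x i (r a)) (x j r') = 0 := by
  obtain rfl : s = (cartanData X hq ε).a i j + 1 := by
    have := X.offDiag i j hij
    simp only [cartanData]
    omega
  refine Eq.trans ?_ (hx i j hij r r')
  simp only [serreSum, cartanData, qBinom_qpow_units]

theorem genHom_rel {a b : Free n 𝔥} (h : Rel R t a b) : genHom hq w K a = genHom hq w K b := by
  cases h with
  | k_add h h' => simp [kOp_add]
  | k_zero => simp [kOp_zero]
  | k_h h j m => simpa using (commute_kOp_hOp hq w K h j m).eq
  | h_h i j m m' => simpa using (commute_hOp hq w K i j m m').eq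
  | k_x ε h j r =>
    simp only [map_mul, genHom_fk, genHom_fx, map_smul]
    rw [kOp_mul_xOp, smul_mul_assoc, mul_assoc, kOp_add, add_neg_cancel, kOp_zero, mul_one]
  | h_x ε i j m r => simpa [hxCoeff] using hOp_mul_xOp hq w K ε i m j r
  | x_x i j r r' =>
    simp only [map_mul, map_sub, genHom_fx, xOp_pos, xOp_neg, commutator_xpOp]
    split_ifs with hij
    · subst hij
      simp [xiOp, xiMode, genHom_fphi]
    · simp
  | quad ε i j r r' => simpa [cartanData] using xOp_quadRel hq w K ε i j r r'
  | serre ε i j hij s hs r r' =>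
    have h := serreSum_eq_of_serreRel hq (xOp_serreRel hq w K ε) hij s hs r r'
    have h2 := map_serreSum (genHom hq w K) (qpow t (X.r i)) s (fun a => fx 𝔥 ε i (r a))
      (fx 𝔥 ε j r')
    simp only [genHom_fx] at h2
    rw [map_zero, ← h, ← h2]
    rfl

/-- The representation of the quantum affinization on the model of the Verma module. -/
noncomputable def rep : Uq R t →ₐ[ℂ] Module.End K (VermaModel hq K (X := X)) :=
  RingQuot.liftAlgHom ℂ ⟨genHom hq w K, fun _ _ h => genHom_rel hq w K h⟩

theorem rep_toUq (a : Free n 𝔥) : rep hq w K (toUq R t a) = genHom hq w K a := by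
  change RingQuot.liftAlgHom ℂ _ (RingQuot.mkAlgHom ℂ _ _) = _
  rw [RingQuot.liftAlgHom_mkAlgHom_apply]

end Representation

/-! ### Universal property of the model -/

theorem toUq_surjective {n : ℕ} {X : SymmetrizableGCM n} {𝔥 : Type*} [AddCommGroup 𝔥]
    [Module ℚ 𝔥] (R : Realization X 𝔥) (t : ℂ) : Function.Surjective (toUq R t) :=
  RingQuot.mkAlgHom_surjective ℂ (Rel R t)

theorem toUq_rel {n : ℕ} {X : SymmetrizableGCM n} {𝔥 : Type*} [AddCommGroup 𝔥]
    [Module ℚ 𝔥] {R : Realization X 𝔥} {t : ℂ} {a b : Free n 𝔥} (h : Rel R t a b) :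
    toUq R t a = toUq R t b :=
  RingQuot.mkAlgHom_rel ℂ h

theorem expCoeff_mem {A : Type*} [Ring A] [Algebra ℂ A] (S : Subalgebra ℂ A) {f : PowerSeries A}
    (h : ∀ a, PowerSeries.coeff a f ∈ S) (m : ℕ) : expCoeff f m ∈ S := by
  have hp : ∀ p a, PowerSeries.coeff a (f ^ p) ∈ S := by
    intro p
    induction p with
    | zero =>
      intro a
      rw [pow_zero, PowerSeries.coeff_one]
      split_ifs
      · exact S.one_mem
      · exact S.zero_mem
    | succ p ih =>
      intro a
      rw [pow_succ, PowerSeries.coeff_mul]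
      exact S.sum_mem fun x _ => S.mul_mem (ih x.1) (h x.2)
  exact S.sum_mem fun p _ => S.smul_mem (hp p m) _

/-- Converse of `expCoeff_apply`: in degree m of the recursion the new unknown occurs only in the
pair (m, 0), with P_0 = 1, and all other pairs are known by induction. -/
theorem apply_of_expCoeff {K V : Type*} [CommRing K] [Algebra ℂ K] [AddCommGroup V] [Module K V]
    [Module ℂ V] [IsScalarTower ℂ K V] [SMulCommClass K ℂ V]
    {f : PowerSeries (Module.End K V)} {P Δ : PowerSeries K} {v : V}
    (hf : PowerSeries.coeff 0 f = 0)
    (hc : ∀ a b, Commute (PowerSeries.coeff a f) (PowerSeries.coeff b f))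
    (hP : euler P = Δ * P) (hP0 : PowerSeries.coeff 0 P = 1)
    (hv : ∀ m, expCoeff f m v = PowerSeries.coeff m P • v) (m : ℕ) :
    m • PowerSeries.coeff m f v = PowerSeries.coeff m Δ • v := by
  induction m using Nat.strong_induction_on with
  | _ m ih =>
    have h1 := congrArg (fun F : PowerSeries (Module.End K V) => PowerSeries.coeff m F v)
      (euler_expSeries hf hc)
    simp only [coeff_euler, PowerSeries.coeff_mul, coeff_expSeries, LinearMap.sum_apply,
      LinearMap.smul_apply, Module.End.mul_apply, hv] at h1
    have h2 := congrArg (fun F : PowerSeries K => PowerSeries.coeff m F • v) hP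
    simp only [coeff_euler, PowerSeries.coeff_mul, Finset.sum_smul] at h2
    rw [smul_assoc, h1] at h2
    have hmem : (m, 0) ∈ Finset.HasAntidiagonal.antidiagonal m := by simp
    rw [← Finset.add_sum_erase _ _ hmem, ← Finset.add_sum_erase _ _ hmem] at h2
    have h3 : ∑ x ∈ (Finset.HasAntidiagonal.antidiagonal m).erase (m, 0),
        x.1 • PowerSeries.coeff x.1 f (PowerSeries.coeff x.2 P • v) =
        ∑ x ∈ (Finset.HasAntidiagonal.antidiagonal m).erase (m, 0),
          (PowerSeries.coeff x.1 Δ * PowerSeries.coeff x.2 P) • v := by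
      refine Finset.sum_congr rfl fun x hx => ?_
      obtain ⟨hne, hx⟩ := Finset.mem_erase.mp hx
      have hx' := Finset.HasAntidiagonal.mem_antidiagonal.mp hx
      have hlt : x.1 < m := by
        by_contra hge
        exact hne (Prod.ext (by omega) (by omega))
      rw [map_smul, smul_comm, ih _ hlt, smul_smul, mul_comm]
    rw [h3] at h2
    simpa [hP0] using add_right_cancel h2

section Universal

variable {n : ℕ} {X : SymmetrizableGCM n} {𝔥 : Type*} [AddCommGroup 𝔥] [Module ℚ 𝔥]
variable {R : Realization X 𝔥} {t : ℂ} (hq : ∀ m : ℕ, 0 < m → Complex.exp t ^ m ≠ 1)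
  (w : LUWeight R t) {K : Type*} [CommRing K] [Algebra ℂ K] [Algebra ℂ[T;T⁻¹] K]
  [IsScalarTower ℂ ℂ[T;T⁻¹] K] {M : Type*} [AddCommGroup M] [Module K M] [Module ℂ M]
  [IsScalarTower ℂ K M] [SMulCommClass K ℂ M] {ρ : Uq R t →ₐ[ℂ] Module.End K M} {g : M}

include hq in
-- Highest weight vectors are defined by the φ, while the model is built from the h. Taking
-- logarithms on the vector recovers the eigenvalues of h from those of φ.
theorem h_apply_of_phi_apply
    (hk : ∀ h, ρ (toUq R t (fk n h)) g = algebraMap ℂ K (qpow t (w.wt h)) • g)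
    (hφ : ∀ (ε : ℤˣ) i (m : ℕ), ρ (toUq R t (fphi R t ε i ((ε : ℤ) * m))) g =
      algebraMap ℂ[T;T⁻¹] K (w.psi ε i m) • g) (i : Fin n) (m : {m : ℤ // m ≠ 0}) :
    ρ (toUq R t (fh 𝔥 i m)) g = hEigen w K i m • g := by
  obtain ⟨ε, a, ha, rfl⟩ : ∃ (ε : ℤˣ) (a : ℕ) (ha : a ≠ 0),
      m = ⟨(ε : ℤ) * a, mul_ne_zero (Units.ne_zero ε) (Int.natCast_ne_zero.mpr ha)⟩ := by
    obtain ⟨m, hm⟩ := m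
    refine ⟨if 0 < m then 1 else -1, m.natAbs, by omega, ?_⟩
    ext
    rcases hm.lt_or_gt with h | h
    · simp [h.not_gt, abs_of_neg h]
    · simp [h, abs_of_pos h]
  have h1 : (if (0 : ℤ) < (ε : ℤ) * a then (1 : ℤˣ) else -1) = ε := by
    rcases Int.units_eq_one_or ε with rfl | rfl
    · rw [if_pos (by simp; omega)]
    · rw [if_neg (by simp)]
  have h2 : ((ε : ℤ) * (a : ℤ)).natAbs = a := by
    rcases Int.units_eq_one_or ε with rfl | rfl <;> simp
  simp only [hEigen, h1, h2]
  set kf : 𝔥 → Module.End K M := fun h => ρ (toUq R t (fk n h)) with hkf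
  set hf : Fin n → {m : ℤ // m ≠ 0} → Module.End K M := fun i m => ρ (toUq R t (fh 𝔥 i m)) with hhf
  have hh : ∀ i j m m', Commute (hf i m) (hf j m') := fun i j m m' => by
    have := congrArg ρ (toUq_rel (R := R) (t := t) (Rel.h_h i j m m'))
    rwa [map_mul, map_mul, map_mul, map_mul] at this
  have hkk : ∀ h v, kf (-h) (kf h v) = v := fun h v => by
    have e1 := congrArg ρ (toUq_rel (R := R) (t := t) (Rel.k_add (-h) h))
    have e2 := congrArg ρ (toUq_rel (R := R) (t := t) Rel.k_zero)
    rw [neg_add_cancel, e2] at e1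
    simpa using LinearMap.congr_fun e1 v
  have hφ' : ∀ m, PowerSeries.coeff m (phiSer R t kf hf ε i) g =
      algebraMap ℂ[T;T⁻¹] K (w.psi ε i m) • g := fun m => by
    have := map_fphi (t := t) (kf := kf) (hf := hf) R (ρ.comp (toUq R t)) (fun _ => rfl)
      (fun _ _ => rfl) ε i ((ε : ℤ) * m)
    rw [← mul_assoc, Int.units_coe_mul_self, one_mul, zCoeff, if_pos (by simp),
      Int.toNat_natCast] at this
    rw [← this, ← hφ]
    rfl
  have hexp : ∀ m, expCoeff (phiExp t hf ε i) m g = PowerSeries.coeff m (psiNorm w K ε i) • g :=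
    fun m => by
    have e := hφ' m
    rw [phiSer, PowerSeries.coeff_C_mul, coeff_expSeries, Module.End.mul_apply] at e
    have e' := congrArg (kf (-(((ε : ℤ) * (X.r i : ℤ)) • R.coroot i))) e
    rw [hkk, map_smul, hk, map_neg, map_zsmul, zsmul_eq_mul] at e'
    rw [e', psiNorm, PowerSeries.coeff_mk, smul_smul, mul_comm, ← Algebra.smul_def]
    push_cast
    rfl
  have key := apply_of_expCoeff (coeff_zero_phiExp t hf ε i) (commute_phiExp t hh ε ε i i)
    (euler_psiNorm w K ε i) (coeff_zero_psiNorm w K ε i) hexp a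
  rw [coeff_phiExp t hf ha, LinearMap.smul_apply, ← Nat.cast_smul_eq_nsmul ℂ, smul_smul] at key
  rw [smul_assoc, ← key, smul_smul]
  have hq' := qpow_one_sub_ne_zero hq
  have ha' : (a : ℂ) ≠ 0 := by exact_mod_cast ha
  have hεc : ((ε : ℤ) : ℂ) ≠ 0 := by exact_mod_cast Units.ne_zero ε
  have h3 : ((((ε : ℤ) * (a : ℤ) : ℤ) : ℂ) * (qpow t 1 - qpow t (-1)))⁻¹ *
      ((a : ℂ) * (((ε : ℤ) : ℂ) * (qpow t 1 - qpow t (-1)))) = 1 := by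
    push_cast
    field_simp
  rw [h3, one_smul]

/-- The map a ↦ a·g on the x⁻-algebra is well defined by the relations in M. It intertwines k and h
by their commutation with x⁻, hence φ, and then x⁺ because [x⁺, x⁻] is built from φ. -/
theorem exists_intertwiner (hx : ∀ i r, ρ (toUq R t (fx 𝔥 1 i r)) g = 0)
    (hk : ∀ h, ρ (toUq R t (fk n h)) g = algebraMap ℂ K (qpow t (w.wt h)) • g)
    (hφ : ∀ (ε : ℤˣ) i (m : ℕ), ρ (toUq R t (fphi R t ε i ((ε : ℤ) * m))) g =
      algebraMap ℂ[T;T⁻¹] K (w.psi ε i m) • g) :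
    ∃ θ : VermaModel hq K (X := X) →ₗ[K] M, θ 1 = g ∧ ∀ u v, θ (rep hq w K u v) = ρ u (θ v) := by
  set σ : Free n 𝔥 →ₐ[ℂ] Module.End K M := ρ.comp (toUq R t) with hσ
  have hrel : ∀ {a b}, Rel R t a b → σ a = σ b := fun h => congrArg ρ (toUq_rel h)
  have quadM : QuadRel (cartanData X hq (-1)) fun j r => σ (fx 𝔥 (-1) j r) := fun i j r r' => by
    simpa [cartanData] using hrel (Rel.quad (-1) i j r r')
  have serreM : SerreRel (cartanData X hq (-1)) fun j r => σ (fx 𝔥 (-1) j r) := by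
    intro i j hij r r'
    have hs : (((cartanData X hq (-1)).a i j + 1 : ℕ) : ℤ) = 1 - X.C i j := by
      have := X.offDiag i j hij
      simp only [cartanData]
      omega
    have h := hrel (Rel.serre (-1) i j hij _ hs r r')
    rw [map_zero] at h
    refine Eq.trans ?_ h
    have h2 := map_serreSum σ (qpow t (X.r i)) ((cartanData X hq (-1)).a i j + 1)
      (fun a => fx 𝔥 (-1) i (r a)) (fx 𝔥 (-1) j r')
    simp only [serreSum, cartanData, qBinom_qpow_units] at h2 ⊢
    exact h2.symm
  let θ : VermaModel hq K (X := X) →ₗ[K] M :=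
    ((LinearMap.applyₗ g).restrictScalars ℂ ∘ₗ
      (CurrAlg.lift quadM serreM).toLinearMap).liftBaseChange K
  have θ_one : θ 1 = g := by
    rw [Algebra.TensorProduct.one_def, LinearMap.liftBaseChange_tmul]
    simp
  have θ_xm : ∀ j r v, θ (xmOp hq K j r v) = σ (fx 𝔥 (-1) j r) (θ v) := by
    intro j r v
    induction v using TensorProduct.induction_on with
    | zero => simp
    | add a b ha hb => rw [map_add, map_add, ha, hb, map_add, map_add]
    | tmul z a =>
      rw [xmOp, opX, leftMul_tmul, LinearMap.liftBaseChange_tmul, LinearMap.liftBaseChange_tmul]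
      simp
  -- The elements that θ intertwines form a subalgebra, so only generators need checking.
  let S : Subalgebra ℂ (Free n 𝔥) :=
    { carrier := {a | ∀ v, θ (genHom hq w K a v) = σ a (θ v)}
      mul_mem' := fun {a b} ha hb v => by
        simp only [map_mul, Module.End.mul_apply, ha _, hb _]
      add_mem' := fun {a b} ha hb v => by
        simp only [map_add, LinearMap.add_apply, ha _, hb _]
      algebraMap_mem' := fun c v => by
        simp only [AlgHom.commutes, Module.algebraMap_end_apply, LinearMap.map_smul_of_tower] }
  have Sxm : ∀ j r, fx 𝔥 (-1) j r ∈ S := fun j r v => by simpa using θ_xm j r v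
  have Sk : ∀ h, fk n h ∈ S := by
    intro h v
    rw [genHom_fk]
    induction v using FreeVerma.induction with
    | one => rw [kOp_one, map_smul, θ_one]; exact (hk h).symm
    | add a b ha hb => simp only [map_add, ha, hb]
    | smul c a ha => simp only [map_smul, ha]
    | mul j r a ha =>
      change θ (kOp hq w K h (xmOp hq K j r a)) = σ _ (θ (xmOp hq K j r a))
      have e1 := hrel (Rel.k_x (-1) h j r)
      have e2 : σ (fk n (-h)) * σ (fk n h) = 1 := by
        rw [← map_mul, hrel (Rel.k_add (-h) h), neg_add_cancel, hrel Rel.k_zero, map_one]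
      have e3 := congrArg (· * σ (fk n h)) e1
      simp only [map_mul, mul_assoc, e2, mul_one, map_smul] at e3
      have e4 := LinearMap.congr_fun e3 (θ a)
      simp only [Module.End.mul_apply, smul_mul_assoc, LinearMap.smul_apply] at e4
      rw [kOp_xmOp, LinearMap.map_smul_of_tower, θ_xm, ha, θ_xm, e4]
      simp
  have Sh : ∀ i m, fh 𝔥 i m ∈ S := by
    intro i m v
    rw [genHom_fh]
    induction v using FreeVerma.induction with
    | one =>
      rw [hOp_one, map_smul, θ_one]
      exact (h_apply_of_phi_apply hq w hk hφ i m).symm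
    | add a b ha hb => simp only [map_add, ha, hb]
    | smul c a ha => simp only [map_smul, ha]
    | mul j r a ha =>
      change θ (hOp hq w K i m (xmOp hq K j r a)) = σ _ (θ (xmOp hq K j r a))
      have e1 := LinearMap.congr_fun (hrel (Rel.h_x (-1) i j m r)) (θ a)
      simp only [map_mul, map_sub, LinearMap.sub_apply, Module.End.mul_apply, map_smul,
        LinearMap.smul_apply] at e1
      rw [sub_eq_iff_eq_add] at e1
      rw [hOp_xmOp, map_add, LinearMap.map_smul_of_tower, θ_xm, θ_xm, ha, θ_xm, e1, add_comm,
        add_comm r]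
      rfl
  have Sφ : ∀ ε i m, fphi R t ε i m ∈ S := by
    intro ε i m
    rw [fphi]
    split_ifs
    · refine S.mul_mem (Sk _) (expCoeff_mem S (fun a => ?_) _)
      rw [PowerSeries.coeff_smul]
      refine S.smul_mem ?_ _
      rw [hSeries, PowerSeries.coeff_mk]
      split_ifs
      · exact S.zero_mem
      · exact Sh _ _
    · exact S.zero_mem
  have Sxp : ∀ i r, fx 𝔥 1 i r ∈ S := by
    intro i r v
    rw [genHom_fx, xOp_pos]
    induction v using FreeVerma.induction with
    | one => rw [xpOp_one, map_zero, θ_one]; exact (hx i r).symm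
    | add a b ha hb => simp only [map_add, ha, hb]
    | smul c a ha => simp only [map_smul, ha]
    | mul j r' a ha =>
      change θ (xpOp hq w K i r (xmOp hq K j r' a)) = σ _ (θ (xmOp hq K j r' a))
      have e1 := LinearMap.congr_fun (hrel (Rel.x_x i j r r')) (θ a)
      have e2 := LinearMap.congr_fun (genHom_rel hq w K (Rel.x_x (R := R) i j r r')) a
      have e3 : (if i = j then
          (qpow t (X.r i) - qpow t (-(X.r i)))⁻¹ •
            (fphi R t 1 i (r + r') - fphi R t (-1) i (r + r'))
          else 0) ∈ S := by
        split_ifs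
        · exact S.smul_mem (S.sub_mem (Sφ _ _ _) (Sφ _ _ _)) _
        · exact S.zero_mem
      rw [← e3 a, ← e2] at e1
      simp only [map_mul, map_sub, LinearMap.sub_apply, Module.End.mul_apply, genHom_fx, xOp_pos,
        xOp_neg, θ_xm, ha] at e1
      rw [θ_xm]
      exact (sub_left_injective e1).symm
  have Stop : ∀ a, a ∈ S := by
    intro a
    induction a using FreeAlgebra.induction with
    | grade0 c => exact S.algebraMap_mem c
    | grade1 z =>
      cases z with
      | x ε i r =>
        rcases Int.units_eq_one_or ε with rfl | rfl
        · exact Sxp i r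
        · exact Sxm i r
      | k h => exact Sk h
      | h i m => exact Sh i m
    | mul a b ha hb => exact S.mul_mem ha hb
    | add a b ha hb => exact S.add_mem ha hb
  refine ⟨θ, θ_one, fun u v => ?_⟩
  obtain ⟨a, rfl⟩ := toUq_surjective R t u
  rw [rep_toUq]
  exact Stop a v

end Universal

/-! ### The Verma module and its coefficient functional -/

section VermaModule

variable {n : ℕ} {X : SymmetrizableGCM n} {𝔥 : Type*} [AddCommGroup 𝔥] [Module ℚ 𝔥]
variable {R : Realization X 𝔥} {t : ℂ} (hq : ∀ m : ℕ, 0 < m → Complex.exp t ^ m ≠ 1)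
  (w : LUWeight R t) (K : Type*) [CommRing K] [Algebra ℂ K] [Algebra ℂ[T;T⁻¹] K]
  [IsScalarTower ℂ ℂ[T;T⁻¹] K]

/-- The representation of `K ⊗ U_q(ĝ)` on the model of the Verma module. -/
noncomputable def repK : UK R t K →ₐ[K] Module.End K (VermaModel hq K (X := X)) :=
  Algebra.TensorProduct.lift (Algebra.ofId K _) (rep hq w K) fun _ _ => by
    rw [Algebra.ofId_apply]
    exact Algebra.commutes _ _

theorem repK_tmul (z : K) (u : Uq R t) (v : VermaModel hq K (X := X)) :
    repK hq w K (z ⊗ₜ u) v = z • rep hq w K u v := by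
  rw [repK, Algebra.TensorProduct.lift_tmul, Algebra.ofId_apply, Module.End.mul_apply,
    Module.algebraMap_end_apply]

theorem repK_apply_one_of_mem {u : UK R t K} (hu : u ∈ vermaIdeal K w) : repK hq w K u 1 = 0 := by
  induction hu using Submodule.span_induction with
  | zero => simp
  | add a b _ _ ha hb => rw [map_add, LinearMap.add_apply, ha, hb, add_zero]
  | smul c a _ ha => rw [smul_eq_mul, map_mul, Module.End.mul_apply, ha, map_zero]
  | mem y hy =>
    rcases hy with (⟨i, r, rfl⟩ | ⟨h, rfl⟩) | ⟨ε, i, m, rfl⟩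
    · rw [xPlus, repK_tmul, rep_toUq, genHom_fx, xOp_pos, xpOp_one, smul_zero]
    · rw [map_sub, LinearMap.sub_apply, kEl, wtEl, repK_tmul, rep_toUq, genHom_fk, kOp_one,
        AlgHom.commutes, Module.algebraMap_end_apply, one_smul, sub_self]
    · rw [map_sub, LinearMap.sub_apply, phiEl, psiEl, repK_tmul, rep_toUq, genHom_fphi,
        AlgHom.commutes, Module.algebraMap_end_apply, one_smul, ← mul_assoc,
        Int.units_coe_mul_self, one_mul, zCoeff, if_pos (by simp), Int.toNat_natCast, phiSer_one,
        sub_self]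

/-- The canonical map from the Verma module to its model. -/
noncomputable def vermaEv : Verma K w →ₗ[K] VermaModel hq K (X := X) :=
  (((vermaIdeal K w).restrictScalars K).liftQ
    ((LinearMap.applyₗ (1 : VermaModel hq K)).comp (repK hq w K).toLinearMap)
    fun _ hu => repK_apply_one_of_mem hq w K hu).comp
    (Submodule.Quotient.restrictScalarsEquiv K (vermaIdeal K w)).symm.toLinearMap

theorem vermaEv_mk (u : UK R t K) :
    vermaEv hq w K (Submodule.Quotient.mk u) = repK hq w K u 1 := rfl

theorem vermaEv_smul (u : UK R t K) (v : Verma K w) :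
    vermaEv hq w K (u • v) = repK hq w K u (vermaEv hq w K v) := by
  obtain ⟨v, rfl⟩ := Submodule.Quotient.mk_surjective _ v
  rw [← Submodule.Quotient.mk_smul, vermaEv_mk, vermaEv_mk, smul_eq_mul, map_mul]
  rfl

theorem vermaEv_vermaGen : vermaEv hq w K (vermaGen K w) = 1 := by
  rw [vermaGen, vermaEv_mk, map_one (repK hq w K)]
  rfl

theorem smul_vermaGen (u : UK R t K) : u • vermaGen K w = Submodule.Quotient.mk u := by
  rw [vermaGen, ← Submodule.Quotient.mk_smul, smul_eq_mul, mul_one]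

theorem xPlus_smul_vermaGen (i : Fin n) (r : ℤ) : xPlus R t K i r • vermaGen K w = 0 := by
  rw [smul_vermaGen, Submodule.Quotient.mk_eq_zero]
  exact Submodule.subset_span (Or.inl (Or.inl ⟨i, r, rfl⟩))

theorem kEl_smul_vermaGen (h : 𝔥) :
    kEl R t K h • vermaGen K w = wtEl K w h • vermaGen K w := by
  rw [← sub_eq_zero, ← sub_smul, smul_vermaGen, Submodule.Quotient.mk_eq_zero]
  exact Submodule.subset_span (Or.inl (Or.inr ⟨h, rfl⟩))

theorem phiEl_smul_vermaGen (ε : ℤˣ) (i : Fin n) (m : ℕ) :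
    phiEl R t K ε i m • vermaGen K w = psiEl K w ε i m • vermaGen K w := by
  rw [← sub_eq_zero, ← sub_smul, smul_vermaGen, Submodule.Quotient.mk_eq_zero]
  exact Submodule.subset_span (Or.inr ⟨ε, i, m, rfl⟩)

/-- The action of `U_q(ĝ)` on the Verma module. -/
noncomputable def actVerma : Uq R t →ₐ[ℂ] Module.End K (Verma K w) :=
  ((Algebra.lsmul K K (Verma K w) : UK R t K →ₐ[K] _).restrictScalars ℂ).comp
    Algebra.TensorProduct.includeRight

theorem actVerma_apply (u : Uq R t) (v : Verma K w) :
    actVerma w K u v = ((1 : K) ⊗ₜ[ℂ] u : UK R t K) • v := rfl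

/-- The universal property gives a map θ back from the model. It is onto because the Verma module is
cyclic, and evaluation after θ fixes 1 and commutes with x⁻, hence is the identity. -/
theorem vermaEv_bijective : Function.Bijective (vermaEv hq w K) := by
  obtain ⟨θ, h1, h2⟩ := exists_intertwiner (ρ := actVerma w K) (g := vermaGen K w) hq w
    (fun i r => xPlus_smul_vermaGen w K i r)
    (fun h => (kEl_smul_vermaGen w K h).trans (algebraMap_smul _ _ _))
    (fun ε i m => (phiEl_smul_vermaGen w K ε i m).trans (algebraMap_smul _ _ _))
  have hs : Function.Surjective θ := by
    intro v
    obtain ⟨u, rfl⟩ := Submodule.Quotient.mk_surjective _ v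
    rw [← smul_vermaGen]
    induction u using TensorProduct.induction_on with
    | zero => exact ⟨0, by simp⟩
    | add a b ha hb =>
      obtain ⟨a', ha⟩ := ha
      obtain ⟨b', hb⟩ := hb
      exact ⟨a' + b', by rw [map_add, ha, hb, add_smul]⟩
    | tmul z u =>
      refine ⟨z • rep hq w K u 1, ?_⟩
      rw [map_smul, h2, h1, actVerma_apply, ← smul_assoc, TensorProduct.smul_tmul', smul_eq_mul,
        mul_one]
  have hi : vermaEv hq w K ∘ₗ θ = LinearMap.id := by
    refine VermaModel.end_ext hq ?_ fun j r v hv => ?_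
    · rw [LinearMap.comp_apply, h1, vermaEv_vermaGen]
      rfl
    · have e : xmOp hq K j r = rep hq w K (toUq R t (fx 𝔥 (-1) j r)) := by
        rw [rep_toUq, genHom_fx, xOp_neg]
      rw [e, LinearMap.comp_apply, h2, actVerma_apply, vermaEv_smul, repK_tmul, one_smul]
      exact congrArg _ hv
  have hi' : ∀ v, vermaEv hq w K (θ v) = v := fun v => LinearMap.congr_fun hi v
  refine ⟨fun a b hab => ?_, fun v => ⟨θ v, hi' v⟩⟩
  obtain ⟨a, rfl⟩ := hs a
  obtain ⟨b, rfl⟩ := hs b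
  rw [hi', hi'] at hab
  rw [hab]

/-- The coefficient of the generator in the weight decomposition of the Verma module. -/
noncomputable def coef : Verma K w →ₗ[K] K := (augm _ K).comp (vermaEv hq w K)

@[simp] theorem coef_vermaGen : coef hq w K (vermaGen K w) = 1 := by
  rw [coef, LinearMap.comp_apply, vermaEv_vermaGen, augm_one]

end VermaModule

/-! ### The generator coefficient, weight vectors and largest submodules. -/

section Weights

/-- Linear independence gives a functional on 𝔥* equal to 1 on every root; 𝔥 is finite-dimensional,
so it is evaluation at a vector. The eigenvalues of k_δ then record heights. -/
theorem Realization.exists_root_eq_one {n : ℕ} {X : SymmetrizableGCM n} {𝔥 : Type*}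
    [AddCommGroup 𝔥] [Module ℚ 𝔥] (R : Realization X 𝔥) : ∃ δ, ∀ j, R.root j δ = 1 := by
  have := R.finite
  let b := Module.Basis.span R.root_linearIndependent
  obtain ⟨Φ, hΦ⟩ := LinearMap.exists_extend (b.constr ℚ fun _ => (1 : ℚ))
  refine ⟨(Module.evalEquiv ℚ 𝔥).symm Φ, fun j => ?_⟩
  rw [Module.apply_evalEquiv_symm_apply]
  have h := LinearMap.congr_fun hΦ (b j)
  rw [Module.Basis.constr_basis] at h
  rw [← h]
  simp [b, Module.Basis.span_apply]

theorem aeval_smul_of_smul {A N : Type*} [Ring A] [Algebra ℂ A] [AddCommGroup N] [Module A N]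
    {a : A} {c : ℂ} {y : N} (h : a • y = algebraMap ℂ A c • y) (p : Polynomial ℂ) :
    Polynomial.aeval a p • y = algebraMap ℂ A (p.eval c) • y := by
  induction p using Polynomial.induction_on with
  | C z => simp
  | add p q hp hq => rw [map_add, add_smul, hp, hq, Polynomial.eval_add, map_add, add_smul]
  | monomial m z ih =>
    have e1 : Polynomial.aeval a (Polynomial.C z * Polynomial.X ^ (m + 1)) =
        Polynomial.aeval a (Polynomial.C z * Polynomial.X ^ m) * a := by
      simp [pow_succ, mul_assoc]
    rw [e1, mul_smul, h, ← mul_smul, ← Algebra.commutes, mul_smul, ih, ← mul_smul, ← map_mul]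
    congr 2
    simp [pow_succ]
    ring

theorem aeval_mul_of_semiconj {A : Type*} [Ring A] [Algebra ℂ A] {a b x : A} (h : a * x = x * b)
    (p : Polynomial ℂ) : Polynomial.aeval a p * x = x * Polynomial.aeval b p := by
  induction p using Polynomial.induction_on with
  | C z => simpa using Algebra.commutes z x
  | add p q hp hq => rw [map_add, map_add, add_mul, mul_add, hp, hq]
  | monomial m z ih =>
    have e : ∀ a : A, Polynomial.aeval a (Polynomial.C z * Polynomial.X ^ (m + 1)) =
        Polynomial.aeval a (Polynomial.C z * Polynomial.X ^ m) * a := by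
      intro a
      simp [pow_succ, mul_assoc]
    rw [e, e, mul_assoc, h, ← mul_assoc, ih, mul_assoc]

variable {n : ℕ} {X : SymmetrizableGCM n} {𝔥 : Type*} [AddCommGroup 𝔥] [Module ℚ 𝔥]
variable {R : Realization X 𝔥} {t : ℂ} (hq : ∀ m : ℕ, 0 < m → Complex.exp t ^ m ≠ 1)
  (w : LUWeight R t) {K : Type*} [CommRing K] [Algebra ℂ K] [Algebra ℂ[T;T⁻¹] K]
  [IsScalarTower ℂ ℂ[T;T⁻¹] K]

/-- A height-d component has k_δ-eigenvalue q^{λ(δ)-d}, and p is chosen to annihilate those with d >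
0. Nonvanishing at all q^{λ(δ)+m}, not only at m = 0, is what survives the substitution X ↦ qX in
the induction. -/
theorem exists_polynomial_kOp {δ : 𝔥} (hδ : ∀ j, R.root j δ = 1) (v : VermaModel hq K (X := X)) :
    ∃ p : Polynomial ℂ, (∀ m : ℕ, p.eval (qpow t 1 ^ m * qpow t (w.wt δ)) ≠ 0) ∧
      Polynomial.aeval (kOp hq w K δ) p v =
        p.eval (qpow t (w.wt δ)) • (augm _ K v • (1 : VermaModel hq K)) := by
  have h1 : ∀ p : Polynomial ℂ, Polynomial.aeval (kOp hq w K δ) p (1 : VermaModel hq K) =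
      p.eval (qpow t (w.wt δ)) • (1 : VermaModel hq K) := by
    intro p
    have := aeval_smul_of_smul (a := kOp hq w K δ) (c := qpow t (w.wt δ))
      (y := (1 : VermaModel hq K)) (by
        rw [Module.algebraMap_end_eq_smul_id, Module.End.smul_def, kOp_one, algebraMap_smul]
        rfl) p
    rw [Module.algebraMap_end_eq_smul_id] at this
    simpa using this
  induction v using FreeVerma.induction with
  | one => exact ⟨1, by simp, by simp⟩
  | smul c a ha =>
    obtain ⟨p, hp, h⟩ := ha
    exact ⟨p, hp, by rw [map_smul, h, map_smul, smul_assoc, smul_comm]⟩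
  | add a b ha hb =>
    obtain ⟨p, hp, ha⟩ := ha
    obtain ⟨p', hp', hb⟩ := hb
    refine ⟨p * p', fun m => ?_, ?_⟩
    · rw [Polynomial.eval_mul]
      exact mul_ne_zero (hp m) (hp' m)
    · have e1 : Polynomial.aeval (kOp hq w K δ) (p * p') a =
          Polynomial.aeval (kOp hq w K δ) p' (Polynomial.aeval (kOp hq w K δ) p a) := by
        rw [mul_comm, map_mul, Module.End.mul_apply]
      have e2 : Polynomial.aeval (kOp hq w K δ) (p * p') b =
          Polynomial.aeval (kOp hq w K δ) p (Polynomial.aeval (kOp hq w K δ) p' b) := by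
        rw [map_mul, Module.End.mul_apply]
      rw [map_add, e1, e2, ha, hb]
      simp only [map_add, LinearMap.map_smul_of_tower, map_smul, h1, Polynomial.eval_mul]
      module
  | mul j r a ha =>
    obtain ⟨p, hp, ha⟩ := ha
    have hq1 : ∀ m : ℕ, qpow t 1 ^ (m + 1) ≠ 1 := fun m => by
      have := hq (m + 1) m.succ_pos
      simpa [qpow] using this
    set P : Polynomial ℂ := (Polynomial.X - Polynomial.C (qpow t (w.wt δ))) * p with hP
    -- k_δ x⁻ = q⁻¹ x⁻ k_δ, so P(q k_δ) x⁻ = x⁻ P(k_δ); the extra factor X - q^{λ(δ)} kills the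
    -- generator component that p left in a.
    refine ⟨P.comp (Polynomial.C (qpow t 1) * Polynomial.X), fun m => ?_, ?_⟩
    · have e := hp (m + 1)
      rw [pow_succ', mul_assoc] at e
      simp only [hP, Polynomial.eval_comp, Polynomial.eval_mul, Polynomial.eval_C,
        Polynomial.eval_X, Polynomial.eval_sub]
      refine mul_ne_zero ?_ e
      have e2 : qpow t 1 * (qpow t 1 ^ m * qpow t (w.wt δ)) - qpow t (w.wt δ) =
          (qpow t 1 ^ (m + 1) - 1) * qpow t (w.wt δ) := by ring
      rw [e2]
      exact mul_ne_zero (sub_ne_zero.mpr (hq1 m)) (qpow_ne_zero _ _)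
    · rw [augm_opX, zero_smul, smul_zero, Polynomial.aeval_comp]
      have e : Polynomial.aeval (kOp hq w K δ) (Polynomial.C (qpow t 1) * Polynomial.X) *
          xmOp hq K j r = xmOp hq K j r * kOp hq w K δ := by
        have := kOp_mul hq w K δ j r
        rw [hδ] at this
        simp only [map_mul, Polynomial.aeval_C, Polynomial.aeval_X, ← Algebra.smul_def,
          smul_mul_assoc, this, smul_smul, ← qpow_add]
        simp
      have e2 := LinearMap.congr_fun (aeval_mul_of_semiconj e P) a
      simp only [Module.End.mul_apply] at e2
      refine e2.trans ?_
      rw [hP, map_mul, Module.End.mul_apply, ha]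
      simp [LinearMap.map_smul_of_tower, kOp_one, sub_eq_zero]

/-- After normalization the polynomial fixes every vector of weight λ in any module and sends the
given v to its generator component. -/
theorem exists_projector {δ : 𝔥} (hδ : ∀ j, R.root j δ = 1) (v : Verma K w) :
    ∃ p : Polynomial ℂ, p.eval (qpow t (w.wt δ)) = 1 ∧
      ((1 : K) ⊗ₜ[ℂ] Polynomial.aeval (toUq R t (fk n δ)) p : UK R t K) • v =
        coef hq w K v • vermaGen K w := by
  obtain ⟨p, hp, h⟩ := exists_polynomial_kOp hq w hδ (vermaEv hq w K v)
  have hp0 := hp 0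
  rw [pow_zero, one_mul] at hp0
  set c := p.eval (qpow t (w.wt δ)) with hc
  refine ⟨Polynomial.C c⁻¹ * p, by rw [Polynomial.eval_mul, Polynomial.eval_C, ← hc,
    inv_mul_cancel₀ hp0], (vermaEv_bijective hq w K).1 ?_⟩
  rw [vermaEv_smul, repK_tmul, one_smul, map_smul, vermaEv_vermaGen, ← Polynomial.aeval_algHom_apply,
    rep_toUq, genHom_fk, map_mul, Module.End.mul_apply, h, Polynomial.aeval_C,
    Module.algebraMap_end_apply, smul_smul, inv_mul_cancel₀ hp0, one_smul]
  rfl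

theorem projector_smul {δ : 𝔥} {N : Type*} [AddCommGroup N] [Module (UK R t K) N] {y : N}
    (hy : kEl R t K δ • y = wtEl K w δ • y) {p : Polynomial ℂ}
    (hp : p.eval (qpow t (w.wt δ)) = 1) :
    ((1 : K) ⊗ₜ[ℂ] Polynomial.aeval (toUq R t (fk n δ)) p : UK R t K) • y = y := by
  have e : ((1 : K) ⊗ₜ[ℂ] Polynomial.aeval (toUq R t (fk n δ)) p : UK R t K) =
      Polynomial.aeval (kEl R t K δ) p :=
    (Polynomial.aeval_algHom_apply
      (Algebra.TensorProduct.includeRight : Uq R t →ₐ[ℂ] UK R t K) _ _).symm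
  rw [e, aeval_smul_of_smul (c := qpow t (w.wt δ)) hy, hp, map_one, one_smul]

variable (K) in
/-- The largest submodule on which the coefficient functional vanishes. -/
noncomputable def nullSubmodule : Submodule (UK R t K) (Verma K w) where
  carrier := {v | ∀ u : UK R t K, coef hq w K (u • v) = 0}
  add_mem' ha hb u := by rw [smul_add, map_add, ha, hb, add_zero]
  zero_mem' u := by rw [smul_zero, map_zero]
  smul_mem' c v hv u := by rw [← mul_smul]; exact hv _

theorem coef_smul_vermaGen_mem {N : Submodule (UK R t K) (Verma K w)} {v : Verma K w}
    (hv : v ∈ N) : coef hq w K v • vermaGen K w ∈ N := by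
  obtain ⟨δ, hδ⟩ := R.exists_root_eq_one
  obtain ⟨p, -, h⟩ := exists_projector hq w hδ v
  rw [← h]
  exact N.smul_mem _ hv

theorem eq_coef_smul_vermaGen {v : Verma K w}
    (hv : ∀ h, kEl R t K h • v = wtEl K w h • v) : v = coef hq w K v • vermaGen K w := by
  obtain ⟨δ, hδ⟩ := R.exists_root_eq_one
  obtain ⟨p, hp, h⟩ := exists_projector hq w hδ v
  rw [← h, projector_smul w (hv δ) hp]

theorem kEl_smul_smul_vermaGen (c : K) (h : 𝔥) :
    kEl R t K h • (c • vermaGen K w) = wtEl K w h • (c • vermaGen K w) := by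
  rw [smul_comm, kEl_smul_vermaGen, smul_comm]

/-- A submodule without vectors of weight λ contains coef(uv) times the generator, so this
coefficient is zero. Conversely a vector of weight λ is determined by its coefficient. -/
theorem maxNoTop_eq : maxNoTop w = nullSubmodule hq w ℂ[T;T⁻¹] := by
  refine le_antisymm (sSup_le fun N hN v hv u => ?_) (le_sSup fun y hy hw => ?_)
  · have h := hN _ (coef_smul_vermaGen_mem hq w (N.smul_mem u hv))
      (kEl_smul_smul_vermaGen w _)
    simpa using congrArg (coef hq w ℂ[T;T⁻¹]) h
  · have h := hy 1
    rw [one_smul] at h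
    rw [eq_coef_smul_vermaGen hq w hw, h, zero_smul]

theorem eq_top_of_isUnit_coef {N : Submodule (UK R t K) (Verma K w)} {v : Verma K w} (hv : v ∈ N)
    (h : IsUnit (coef hq w K v)) : N = ⊤ := by
  obtain ⟨c, hc⟩ := h
  have h1 := coef_smul_vermaGen_mem hq w hv
  have h2 : vermaGen K w ∈ N := by
    have h3 := N.smul_mem (algebraMap K (UK R t K) ↑c⁻¹) h1
    rwa [algebraMap_smul, smul_smul, ← hc, Units.inv_mul, one_smul] at h3
  refine eq_top_iff.mpr fun y _ => ?_
  obtain ⟨y, rfl⟩ := Submodule.Quotient.mk_surjective _ y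
  rw [← smul_vermaGen]
  exact N.smul_mem _ h2

/-- Over the field ℂ((u)) a nonzero coefficient is a unit, so the submodule would contain the
generator. -/
theorem le_nullSubmodule {N : Submodule (UK R t ℂ⸨X⸩) (Verma ℂ⸨X⸩ w)} (hN : N ≠ ⊤) :
    N ≤ nullSubmodule hq w ℂ⸨X⸩ := by
  intro v hv u
  by_contra hne
  exact hN (eq_top_of_isUnit_coef hq w (N.smul_mem u hv) (Ne.isUnit hne))

theorem vermaGen_notMem_nullSubmodule [Nontrivial K] : vermaGen K w ∉ nullSubmodule hq w K := by
  intro h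
  have := h 1
  rw [one_smul, coef_vermaGen] at this
  exact one_ne_zero this

theorem nullSubmodule_ne_top [Nontrivial K] : nullSubmodule hq w K ≠ ⊤ := fun h =>
  vermaGen_notMem_nullSubmodule hq w (K := K) (h ▸ Submodule.mem_top)

theorem maxProper_eq : maxProper w = nullSubmodule hq w ℂ⸨X⸩ :=
  le_antisymm (sSup_le fun _ hN => le_nullSubmodule hq w hN)
    (le_sSup (nullSubmodule_ne_top hq w))

include hq in
theorem isSimpleModule_simpleL : IsSimpleModule (UK R t ℂ⸨X⸩) (SimpleL w) := by
  rw [isSimpleModule_iff_isCoatom, maxProper_eq hq w]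
  refine ⟨nullSubmodule_ne_top hq w, fun N hN => ?_⟩
  by_contra h
  exact hN.not_ge (le_nullSubmodule hq w h)

end Weights

/-! ### Laurent polynomials inside Laurent series -/

theorem isPrincipalIdealRing_laurentPolynomial (k : Type*) [Field k] :
    IsPrincipalIdealRing k[T;T⁻¹] := by
  refine ⟨fun I => ?_⟩
  rw [← IsLocalization.map_under (Submonoid.powers (Polynomial.X : Polynomial k)) k[T;T⁻¹] I]
  exact Submodule.IsPrincipal.map_ringHom _ (IsPrincipalIdealRing.principal _)

theorem coeff_laurentIncl (f : ℂ[T;T⁻¹]) (m : ℤ) :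
    HahnSeries.coeff (laurentIncl f) m = f.coeff m := by
  rw [laurentIncl, AddMonoidAlgebra.lift_apply, Finsupp.sum, HahnSeries.coeff_sum]
  simp only [MonoidHom.coe_mk, OneHom.coe_mk, toAdd_ofAdd, HahnSeries.coeff_smul,
    HahnSeries.coeff_single]
  simp [eq_comm]

theorem laurentIncl_injective : Function.Injective laurentIncl := by
  intro f g h
  ext m
  rw [← coeff_laurentIncl, h, coeff_laurentIncl]

theorem isTorsionFree_laurentSeries : Module.IsTorsionFree ℂ[T;T⁻¹] ℂ⸨X⸩ :=
  Module.isTorsionFree_iff_algebraMap_injective.mpr laurentIncl_injective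

/-! ### A criterion for forms -/

/-- Injectivity is the point. A relation over K involves only a finitely generated A-submodule P of
K, free because A is a principal ideal domain. Integral functionals turn it into A-linear relations
among a basis of P. -/
theorem isBaseChange_subtype {A K V ι : Type*} [CommRing A] [IsDomain A]
    [IsPrincipalIdealRing A] [CommRing K] [Algebra A K] [Module.IsTorsionFree A K]
    [AddCommGroup V] [Module A V] [Module K V] [IsScalarTower A K V] (N : Submodule A V)
    (φ : ι → V →ₗ[K] K) (hφ : ∀ s, ∀ v ∈ N, ∃ a, φ s v = algebraMap A K a)
    (hsep : ∀ v, (∀ s, φ s v = 0) → v = 0) (hspan : Submodule.span K (N : Set V) = ⊤) :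
    IsBaseChange K N.subtype := by
  set g : K ⊗[A] N →ₗ[A] V := TensorProduct.lift
    (((Algebra.linearMap K <| Module.End K (N →ₗ[A] V)).flip N.subtype).restrictScalars A) with hg
  have hgt : ∀ (z : K) (y : N), g (z ⊗ₜ y) = z • (y : V) := fun z y => by
    simp [hg]
  change Function.Bijective g
  constructor
  · rw [← LinearMap.ker_eq_bot, LinearMap.ker_eq_bot']
    intro z hz
    obtain ⟨P, hP, y, rfl⟩ := Submodule.exists_fg_le_eq_rTensor_subtype z
    have : Module.Finite A P := Module.Finite.iff_fg.mpr hP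
    let b := Module.Free.chooseBasis A P
    suffices hy : y = 0 by rw [hy, map_zero]
    set c := TensorProduct.equivFinsuppOfBasisLeft (N := N) b y with hc
    have hgy : g (LinearMap.rTensor N P.subtype y) = c.sum fun j y => (b j : K) • (y : V) := by
      have e : y = c.sum fun j y => b j ⊗ₜ y := by
        rw [hc, ← TensorProduct.equivFinsuppOfBasisLeft_symm_apply, LinearEquiv.symm_apply_apply]
      rw [e, Finsupp.sum, map_sum, map_sum, Finsupp.sum]
      exact Finset.sum_congr rfl fun j _ => by rw [LinearMap.rTensor_tmul, hgt]; rfl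
    rw [hz] at hgy
    -- Applying φ_s to ∑ b_j y_j = 0 gives ∑ φ_s(y_j) b_j = 0 with coefficients in A. So all
    -- φ_s(y_j) vanish, and separation gives y_j = 0.
    have hc0 : c = 0 := by
      ext j
      refine hsep _ fun s => ?_
      choose a ha using fun j => hφ s (c j : V) (c j).2
      have h1 := congrArg (φ s) hgy
      rw [map_zero, Finsupp.sum, map_sum] at h1
      have h2 : ∑ i ∈ c.support, a i • b i = 0 := by
        apply Subtype.ext
        rw [ZeroMemClass.coe_zero, h1, AddSubmonoidClass.coe_finsetSum]
        refine Finset.sum_congr rfl fun i _ => ?_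
        rw [map_smul, ha, Submodule.coe_smul, Algebra.smul_def, smul_eq_mul, mul_comm]
      by_cases hj : j ∈ c.support
      · rw [ha, linearIndependent_iff'.mp b.linearIndependent _ _ h2 j hj, map_zero]
      · rw [Finsupp.notMem_support_iff.mp hj]
        simp
    exact (LinearEquiv.map_eq_zero_iff _).mp (hc.symm.trans hc0)
  · intro v
    have hv : v ∈ Submodule.span K (N : Set V) := hspan ▸ Submodule.mem_top
    induction hv using Submodule.span_induction with
    | mem y hy => exact ⟨1 ⊗ₜ ⟨y, hy⟩, by rw [hgt, one_smul]⟩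
    | zero => exact ⟨0, map_zero g⟩
    | add x y _ _ hx hy =>
      obtain ⟨x', rfl⟩ := hx
      obtain ⟨y', rfl⟩ := hy
      exact ⟨x' + y', map_add g _ _⟩
    | smul z x _ hx =>
      obtain ⟨x', rfl⟩ := hx
      refine ⟨z • x', ?_⟩
      clear * - hgt
      induction x' using TensorProduct.induction_on with
      | zero => simp
      | add x y hx hy => rw [smul_add, map_add, map_add, hx, hy, smul_add]
      | tmul k y => rw [TensorProduct.smul_tmul', hgt, hgt, smul_assoc]

/-! ### Base change of the Verma module -/

section BaseChange

variable {n : ℕ} {X : SymmetrizableGCM n} {𝔥 : Type*} [AddCommGroup 𝔥] [Module ℚ 𝔥]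
variable {R : Realization X 𝔥} {t : ℂ} (hq : ∀ m : ℕ, 0 < m → Complex.exp t ^ m ≠ 1)
  (w : LUWeight R t) (K : Type*) [CommRing K] [Algebra ℂ K] [Algebra ℂ[T;T⁻¹] K]
  [IsScalarTower ℂ ℂ[T;T⁻¹] K]

variable (R t) in
/-- The extension of scalars `ℂ[u^±] ⊗ U_q(ĝ) → K ⊗ U_q(ĝ)`. -/
noncomputable def baseChangeU : UK R t ℂ[T;T⁻¹] →ₐ[ℂ[T;T⁻¹]] UK R t K :=
  Algebra.TensorProduct.map (Algebra.ofId ℂ[T;T⁻¹] K) (AlgHom.id ℂ (Uq R t))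

theorem inclU_eq : inclU R t = baseChangeU R t ℂ⸨X⸩ := rfl

/-- The map from the model over `ℂ[u^±]` to the model over `K`. -/
noncomputable def modelIncl :
    VermaModel hq ℂ[T;T⁻¹] (X := X) →ₐ[ℂ] VermaModel hq K (X := X) :=
  Algebra.TensorProduct.map (IsScalarTower.toAlgHom ℂ ℂ[T;T⁻¹] K) (AlgHom.id ℂ _)

theorem modelIncl_smul (c : ℂ[T;T⁻¹]) (v : VermaModel hq ℂ[T;T⁻¹] (X := X)) :
    modelIncl hq K (c • v) = c • modelIncl hq K v := by
  induction v using TensorProduct.induction_on with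
  | zero => simp
  | add a b ha hb => rw [smul_add, map_add, map_add, ha, hb, smul_add]
  | tmul z a =>
    rw [TensorProduct.smul_tmul', modelIncl, Algebra.TensorProduct.map_tmul,
      Algebra.TensorProduct.map_tmul, TensorProduct.smul_tmul', smul_eq_mul, map_mul,
      Algebra.smul_def]
    rfl

theorem modelIncl_injective (hK : Function.Injective (algebraMap ℂ[T;T⁻¹] K)) :
    Function.Injective (modelIncl hq K (X := X)) :=
  Module.Flat.rTensor_preserves_injective_linearMap (M := CurrAlg (cartanData X hq (-1)))
    (IsScalarTower.toAlgHom ℂ ℂ[T;T⁻¹] K).toLinearMap hK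

theorem modelIncl_xmOp (j : Fin n) (r : ℤ) (v : VermaModel hq ℂ[T;T⁻¹] (X := X)) :
    modelIncl hq K (xmOp hq ℂ[T;T⁻¹] j r v) = xmOp hq K j r (modelIncl hq K v) := by
  induction v using TensorProduct.induction_on with
  | zero => simp
  | add a b ha hb => rw [map_add, map_add, ha, hb, map_add, map_add]
  | tmul z a =>
    rw [xmOp, xmOp, opX, opX, leftMul_tmul, modelIncl, Algebra.TensorProduct.map_tmul,
      Algebra.TensorProduct.map_tmul, leftMul_tmul]
    rfl

/-- Restriction of scalars for endomorphisms. -/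
noncomputable def endRestrict (V : Type*) [AddCommGroup V] [Module ℂ V] [Module K V] [Module ℂ[T;T⁻¹] V]
    [IsScalarTower ℂ[T;T⁻¹] K V] [IsScalarTower ℂ K V] [IsScalarTower ℂ ℂ[T;T⁻¹] V]
    [SMulCommClass K ℂ V] [SMulCommClass ℂ[T;T⁻¹] ℂ V] :
    Module.End K V →ₐ[ℂ] Module.End ℂ[T;T⁻¹] V where
  toFun f := f.restrictScalars ℂ[T;T⁻¹]
  map_one' := rfl
  map_mul' _ _ := rfl
  map_zero' := rfl
  map_add' _ _ := rfl
  commutes' _ := rfl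

/-- The model over K is also a module with a highest weight vector over ℂ[u^±]. The resulting
intertwiner agrees with the inclusion on 1 and under x⁻, hence everywhere. -/
theorem modelIncl_rep (u : Uq R t) (v : VermaModel hq ℂ[T;T⁻¹] (X := X)) :
    modelIncl hq K (rep hq w ℂ[T;T⁻¹] u v) = rep hq w K u (modelIncl hq K v) := by
  obtain ⟨θ, h1, h2⟩ := exists_intertwiner (K := ℂ[T;T⁻¹])
    (ρ := (endRestrict K (VermaModel hq K (X := X))).comp (rep hq w K)) (g := (1 : VermaModel hq K)) hq w
    (fun i r => by
      change rep hq w K _ 1 = 0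
      rw [rep_toUq, genHom_fx, xOp_pos, xpOp_one])
    (fun h => by
      change rep hq w K _ 1 = _
      rw [rep_toUq, genHom_fk, kOp_one, algebraMap_smul, algebraMap_smul])
    (fun ε i m => by
      change rep hq w K _ 1 = _
      rw [rep_toUq, genHom_fphi, ← mul_assoc, Int.units_coe_mul_self, one_mul, zCoeff,
        if_pos (by simp), Int.toNat_natCast, phiSer_one, algebraMap_smul]
      rfl)
  have hθ : ∀ v, θ v = modelIncl hq K v := by
    intro v
    induction v using FreeVerma.induction with
    | one => rw [h1, map_one]
    | add a b ha hb => rw [map_add, map_add, ha, hb]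
    | smul c a ha => rw [map_smul, modelIncl_smul, ha]
    | mul j r a ha =>
      have e := h2 (toUq R t (fx 𝔥 (-1) j r)) a
      rw [rep_toUq, genHom_fx, xOp_neg] at e
      refine e.trans ?_
      change rep hq w K _ (θ a) = _
      rw [rep_toUq, genHom_fx, xOp_neg, ha]
      exact (modelIncl_xmOp hq K j r a).symm
  rw [← hθ, ← hθ, h2]
  rfl

theorem modelIncl_repK (u : UK R t ℂ[T;T⁻¹]) (v : VermaModel hq ℂ[T;T⁻¹] (X := X)) :
    modelIncl hq K (repK hq w ℂ[T;T⁻¹] u v) = repK hq w K (baseChangeU R t K u) (modelIncl hq K v) := by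
  induction u using TensorProduct.induction_on with
  | zero => simp
  | add a b ha hb =>
    rw [map_add, map_add, map_add, LinearMap.add_apply, LinearMap.add_apply, map_add, ha, hb]
  | tmul z u =>
    rw [repK_tmul, modelIncl_smul, modelIncl_rep, baseChangeU, Algebra.TensorProduct.map_tmul, repK_tmul,
      Algebra.ofId_apply, algebraMap_smul]
    rfl

theorem vermaEv_baseChangeU_smul (u : UK R t ℂ[T;T⁻¹]) :
    vermaEv hq w K (baseChangeU R t K u • vermaGen K w) =
      modelIncl hq K (vermaEv hq w ℂ[T;T⁻¹] (u • vermaGen ℂ[T;T⁻¹] w)) := by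
  rw [vermaEv_smul, vermaEv_smul, vermaEv_vermaGen, vermaEv_vermaGen, modelIncl_repK,
    map_one (modelIncl hq K)]

theorem coef_baseChangeU_smul (u : UK R t ℂ[T;T⁻¹]) :
    coef hq w K (baseChangeU R t K u • vermaGen K w) =
      algebraMap ℂ[T;T⁻¹] K (coef hq w ℂ[T;T⁻¹] (u • vermaGen ℂ[T;T⁻¹] w)) := by
  rw [coef, LinearMap.comp_apply, vermaEv_baseChangeU_smul, modelIncl, augm_map]
  rfl

include hq in
theorem baseChangeU_smul_eq_zero_iff (hK : Function.Injective (algebraMap ℂ[T;T⁻¹] K)) (u : UK R t ℂ[T;T⁻¹]) :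
    baseChangeU R t K u • vermaGen K w = 0 ↔ u • vermaGen ℂ[T;T⁻¹] w = 0 := by
  rw [← (vermaEv_bijective hq w K).1.eq_iff, vermaEv_baseChangeU_smul, map_zero,
    ← (vermaEv_bijective hq w ℂ[T;T⁻¹]).1.eq_iff, map_zero, ← (modelIncl_injective hq K hK).eq_iff,
    map_zero]

/-- `coef` commutes with extension of scalars, and it suffices to test nullity on elements 1 ⊗ p,
which come from ℂ[u^±] ⊗ U_q. Hence L^u embeds in L. -/
theorem baseChangeU_smul_mem_nullSubmodule_iff (hK : Function.Injective (algebraMap ℂ[T;T⁻¹] K))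
    (u : UK R t ℂ[T;T⁻¹]) :
    baseChangeU R t K u • vermaGen K w ∈ nullSubmodule hq w K ↔
      u • vermaGen ℂ[T;T⁻¹] w ∈ nullSubmodule hq w ℂ[T;T⁻¹] := by
  constructor
  · intro h u'
    apply hK
    rw [map_zero, ← h (baseChangeU R t K u'), ← mul_smul, ← mul_smul, ← map_mul]
    exact (coef_baseChangeU_smul hq w K _).symm
  · intro h u'
    induction u' using TensorProduct.induction_on with
    | zero => rw [zero_smul, map_zero]
    | add a b ha hb => rw [add_smul, map_add, ha, hb, add_zero]
    | tmul z p =>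
      have e : (z ⊗ₜ[ℂ] p : UK R t K) = z • baseChangeU R t K (1 ⊗ₜ p) := by
        rw [baseChangeU, Algebra.TensorProduct.map_tmul, TensorProduct.smul_tmul', map_one, smul_eq_mul,
          mul_one]
        rfl
      rw [e, smul_assoc, map_smul, ← mul_smul, ← map_mul, coef_baseChangeU_smul, mul_smul, h, map_zero,
        smul_zero z]

end BaseChange

/-! ### Forms generated by highest weight vectors -/

section Forms

variable {n : ℕ} {X : SymmetrizableGCM n} {𝔥 : Type*} [AddCommGroup 𝔥] [Module ℚ 𝔥]
variable {R : Realization X 𝔥} {t : ℂ}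

/-- Two cyclic modules whose generators have the same annihilator are isomorphic. -/
theorem exists_linearEquiv_span {S P Q : Type*} [Ring S] [AddCommGroup P] [Module S P]
    [AddCommGroup Q] [Module S Q] (f : S →ₗ[S] P) (hf : Function.Surjective f) (v : Q)
    (h : ∀ u : S, u • v = 0 ↔ f u = 0) : Nonempty (Submodule.span S {v} ≃ₗ[S] P) := by
  have hk : LinearMap.ker (LinearMap.toSpanSingleton S Q v) = LinearMap.ker f := by
    ext u
    rw [LinearMap.mem_ker, LinearMap.mem_ker, LinearMap.toSpanSingleton_apply, h]
  rw [← LinearMap.range_toSpanSingleton]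
  exact ⟨(LinearMap.quotKerEquivRange _).symm.trans
    ((Submodule.quotEquivOfEq _ _ hk).trans (f.quotKerEquivOfSurjective hf))⟩

section Generic

variable {V : Type*} [AddCommGroup V]
    [Module (UK R t ℂ⸨X⸩) V] [Module (UK R t ℂ[T;T⁻¹]) V] [Module ℂ⸨X⸩ V] [Module ℂ[T;T⁻¹] V]
    [IsScalarTower (UK R t ℂ[T;T⁻¹]) (UK R t ℂ⸨X⸩) V]
    [IsScalarTower ℂ⸨X⸩ (UK R t ℂ⸨X⸩) V]
    [IsScalarTower ℂ[T;T⁻¹] (UK R t ℂ[T;T⁻¹]) V] [IsScalarTower ℂ[T;T⁻¹] ℂ⸨X⸩ V]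

omit [Module ℂ⸨X⸩ V] [Module ℂ[T;T⁻¹] V] [IsScalarTower ℂ⸨X⸩ (UK R t ℂ⸨X⸩) V]
    [IsScalarTower ℂ[T;T⁻¹] (UK R t ℂ[T;T⁻¹]) V] [IsScalarTower ℂ[T;T⁻¹] ℂ⸨X⸩ V] in
theorem inclU_smul (a : UK R t ℂ[T;T⁻¹]) (v : V) : inclU R t a • v = a • v := by
  rw [← smul_one_smul (UK R t ℂ⸨X⸩) a v, inclU_smul_def, mul_one]

theorem smul_smul_comm_laurentSeries (a : UK R t ℂ[T;T⁻¹]) (c : ℂ⸨X⸩) (v : V) :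
    a • c • v = c • a • v := by
  rw [← inclU_smul, ← inclU_smul, ← algebraMap_smul (UK R t ℂ⸨X⸩) c v,
    ← algebraMap_smul (UK R t ℂ⸨X⸩) c, ← mul_smul, ← mul_smul, Algebra.commutes]

theorem smul_smul_eq_zero_iff (a : UK R t ℂ[T;T⁻¹]) {c : ℂ⸨X⸩} (hc : c ≠ 0) (v : V) :
    a • c • v = 0 ↔ inclU R t a • v = 0 := by
  rw [smul_smul_comm_laurentSeries, smul_eq_zero, or_iff_right hc, inclU_smul]

/-- The functionals are integral on the orbit of the unscaled generator; dividing them by c makes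
them integral on the orbit of c times it. Spanning holds because z ⊗ p acts as the scalar z times
the action of 1 ⊗ p. -/
theorem isForm_span (w : LUWeight R t) (π : Verma ℂ⸨X⸩ w →ₗ[UK R t ℂ⸨X⸩] V)
    (hπ : Function.Surjective π) {c : ℂ⸨X⸩} (hc : c ≠ 0) {ι : Type*} (φ : ι → V →ₗ[ℂ⸨X⸩] ℂ⸨X⸩)
    (hφ : ∀ s (u : UK R t ℂ[T;T⁻¹]), ∃ a,
      φ s (π (inclU R t u • vermaGen ℂ⸨X⸩ w)) = algebraMap ℂ[T;T⁻¹] ℂ⸨X⸩ a)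
    (hsep : ∀ v, (∀ s, φ s v = 0) → v = 0) :
    IsForm (Submodule.span (UK R t ℂ[T;T⁻¹]) {c • π (vermaGen ℂ⸨X⸩ w)}) := by
  have := isPrincipalIdealRing_laurentPolynomial ℂ
  have := isTorsionFree_laurentSeries
  refine isBaseChange_subtype _ (fun s => c⁻¹ • φ s) (fun s v hv => ?_) (fun v hv => ?_) ?_
  · obtain ⟨a, rfl⟩ := Submodule.mem_span_singleton.mp hv
    obtain ⟨b, hb⟩ := hφ s a
    refine ⟨b, ?_⟩
    rw [smul_smul_comm_laurentSeries, ← inclU_smul, ← map_smul, LinearMap.smul_apply, map_smul,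
      smul_smul, inv_mul_cancel₀ hc, one_smul, hb]
  · refine hsep v fun s => ?_
    exact (smul_eq_zero.mp (hv s)).resolve_left (inv_ne_zero hc)
  · refine eq_top_iff.mpr fun v _ => ?_
    obtain ⟨m, rfl⟩ := hπ v
    obtain ⟨u, rfl⟩ := Submodule.Quotient.mk_surjective _ m
    rw [← smul_vermaGen]
    induction u using TensorProduct.induction_on with
    | zero => rw [zero_smul, map_zero]; exact zero_mem _
    | add a b ha hb => rw [add_smul, map_add]; exact add_mem (ha trivial) (hb trivial)
    | tmul z p =>
      have e : (z ⊗ₜ[ℂ] p : UK R t ℂ⸨X⸩) =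
          algebraMap ℂ⸨X⸩ _ z * inclU R t (1 ⊗ₜ p) := by
        rw [inclU, Algebra.TensorProduct.map_tmul, map_one, Algebra.TensorProduct.algebraMap_apply,
          Algebra.TensorProduct.tmul_mul_tmul, mul_one, one_mul]
        rfl
      have e2 : π ((z ⊗ₜ[ℂ] p : UK R t ℂ⸨X⸩) • vermaGen ℂ⸨X⸩ w) = (z * c⁻¹) •
          ((1 ⊗ₜ[ℂ] p : UK R t ℂ[T;T⁻¹]) • c • π (vermaGen ℂ⸨X⸩ w)) := by
        rw [smul_smul_comm_laurentSeries, smul_smul, inv_mul_cancel_right₀ hc, map_smul, e,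
          mul_smul, inclU_smul, algebraMap_smul]
      rw [e2]
      exact Submodule.smul_mem _ _ (Submodule.subset_span
        (Submodule.smul_mem _ _ (Submodule.mem_span_singleton_self _)))

end Generic

variable (hq : ∀ m : ℕ, 0 < m → Complex.exp t ^ m ≠ 1) (w : LUWeight R t)

include hq in
theorem isHighestWeightVector_vermaGen (K : Type*) [CommRing K] [Nontrivial K] [Algebra ℂ K]
    [Algebra ℂ[T;T⁻¹] K] [IsScalarTower ℂ ℂ[T;T⁻¹] K] :
    IsHighestWeightVector K w (vermaGen K w) := by
  refine ⟨fun h => ?_, xPlus_smul_vermaGen w K, kEl_smul_vermaGen w K, phiEl_smul_vermaGen w K⟩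
  have := coef_vermaGen hq w K
  rw [h, map_zero] at this
  exact zero_ne_one this

/-- The coordinates of the model of the Verma module. -/
noncomputable def modelCoord (K : Type*) [CommRing K] [Algebra ℂ K]
    (s : Module.Basis.ofVectorSpaceIndex ℂ (CurrAlg (cartanData X hq (-1)))) :
    VermaModel hq K (X := X) →ₗ[K] K :=
  (Algebra.TensorProduct.basis K (Module.Basis.ofVectorSpace ℂ _)).coord s

theorem modelCoord_modelIncl (K : Type*) [CommRing K] [Algebra ℂ K] [Algebra ℂ[T;T⁻¹] K]
    [IsScalarTower ℂ ℂ[T;T⁻¹] K]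
    (s : Module.Basis.ofVectorSpaceIndex ℂ (CurrAlg (cartanData X hq (-1))))
    (v : VermaModel hq ℂ[T;T⁻¹] (X := X)) :
    modelCoord hq K s (modelIncl hq K v) = algebraMap ℂ[T;T⁻¹] K (modelCoord hq ℂ[T;T⁻¹] s v) := by
  induction v using TensorProduct.induction_on with
  | zero => simp
  | add a b ha hb => rw [map_add, map_add, map_add, map_add, ha, hb]
  | tmul z a =>
    rw [modelIncl, Algebra.TensorProduct.map_tmul, modelCoord, modelCoord, Module.Basis.coord_apply,
      Module.Basis.coord_apply, Algebra.TensorProduct.basis_repr_tmul,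
      Algebra.TensorProduct.basis_repr_tmul]
    simp only [Finsupp.smul_apply, Finsupp.mapRange_apply, smul_eq_mul, map_mul,
      IsScalarTower.coe_toAlgHom', ← IsScalarTower.algebraMap_apply]
    rfl

include hq in
theorem isForm_verma {c : ℂ⸨X⸩} (hc : c ≠ 0) :
    IsForm (Submodule.span (UK R t ℂ[T;T⁻¹]) {c • vermaGen ℂ⸨X⸩ w}) := by
  refine isForm_span w LinearMap.id Function.surjective_id hc
    (fun s => (modelCoord hq ℂ⸨X⸩ s).comp (vermaEv hq w ℂ⸨X⸩)) (fun s u => ?_) fun v hv => ?_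
  · refine ⟨_, Eq.trans ?_ (modelCoord_modelIncl hq ℂ⸨X⸩ s
      (vermaEv hq w ℂ[T;T⁻¹] (u • vermaGen ℂ[T;T⁻¹] w)))⟩
    rw [LinearMap.id_apply, LinearMap.comp_apply, inclU_eq, vermaEv_baseChangeU_smul]
  · refine (vermaEv_bijective hq w ℂ⸨X⸩).1 (Eq.trans ?_ (map_zero _).symm)
    exact Module.Basis.ext_elem
      (Algebra.TensorProduct.basis ℂ⸨X⸩ (Module.Basis.ofVectorSpace ℂ _)) fun s => (hv s).trans (LinearMap.map_zero (modelCoord hq _ s)).symm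

section Quotient

variable {K : Type*} [CommRing K] [Algebra ℂ K] [Algebra ℂ[T;T⁻¹] K]
  [IsScalarTower ℂ ℂ[T;T⁻¹] K] {J : Submodule (UK R t K) (Verma K w)}

theorem mem_nullSubmodule_of_forall {v : Verma K w}
    (h : ∀ p : Uq R t, coef hq w K (actVerma w K p v) = 0) : v ∈ nullSubmodule hq w K := by
  intro u
  induction u using TensorProduct.induction_on with
  | zero => rw [zero_smul, map_zero]
  | add a b ha hb => rw [add_smul, map_add, ha, hb, add_zero]
  | tmul z p =>
    have e : (z ⊗ₜ[ℂ] p : UK R t K) = z • (1 ⊗ₜ p) := by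
      rw [TensorProduct.smul_tmul', smul_eq_mul, mul_one]
    have hp := h p
    rw [actVerma_apply] at hp
    rw [e, smul_assoc, map_smul, hp, smul_zero]

/-- The functional `v ↦ coef (p v)` on a quotient of the Verma module. -/
noncomputable def coefQuot (hJ : J ≤ nullSubmodule hq w K) (p : Uq R t) :
    (Verma K w ⧸ J) →ₗ[K] K :=
  ((J.restrictScalars K).liftQ ((coef hq w K).comp (actVerma w K p)) fun _ hv => hJ hv _).comp
    (Submodule.Quotient.restrictScalarsEquiv K J).symm.toLinearMap

theorem coefQuot_mk (hJ : J ≤ nullSubmodule hq w K) (p : Uq R t) (v : Verma K w) :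
    coefQuot hq w hJ p (J.mkQ v) = coef hq w K (actVerma w K p v) := rfl

end Quotient

include hq in
-- The functionals v ↦ coef(pv) descend to L and separate its points because the submodule divided
-- out is exactly their common kernel.
theorem isForm_simpleL {c : ℂ⸨X⸩} (hc : c ≠ 0) :
    IsForm (Submodule.span (UK R t ℂ[T;T⁻¹]) {c • (maxProper w).mkQ (vermaGen ℂ⸨X⸩ w)}) := by
  have hJ := (maxProper_eq hq w).le
  refine isForm_span w (maxProper w).mkQ (Submodule.mkQ_surjective _) hc
    (fun p => coefQuot hq w hJ p) (fun p u => ⟨_, Eq.trans ?_ (coef_baseChangeU_smul hq w ℂ⸨X⸩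
      ((1 ⊗ₜ p) * u))⟩) fun v hv => ?_
  · rw [coefQuot_mk, actVerma_apply, map_mul, mul_smul, inclU_eq]
    congr 2
    rw [baseChangeU, Algebra.TensorProduct.map_tmul, map_one]
    rfl
  · obtain ⟨v, rfl⟩ := Submodule.mkQ_surjective _ v
    rw [Submodule.mkQ_apply, Submodule.Quotient.mk_eq_zero, maxProper_eq hq w]
    exact mem_nullSubmodule_of_forall hq w fun p => hv p

include hq in
theorem exists_linearEquiv_verma {c : ℂ⸨X⸩} (hc : c ≠ 0) :
    Nonempty (Submodule.span (UK R t ℂ[T;T⁻¹]) {c • vermaGen ℂ⸨X⸩ w}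
      ≃ₗ[UK R t ℂ[T;T⁻¹]] Verma ℂ[T;T⁻¹] w) := by
  refine exists_linearEquiv_span (vermaIdeal ℂ[T;T⁻¹] w).mkQ (Submodule.mkQ_surjective _) _
    fun u => ?_
  refine (smul_smul_eq_zero_iff u hc (vermaGen ℂ⸨X⸩ w)).trans ?_
  rw [inclU_eq,
    baseChangeU_smul_eq_zero_iff hq w _ laurentIncl_injective, smul_vermaGen]
  rfl

include hq in
theorem exists_linearEquiv_simpleLu {c : ℂ⸨X⸩} (hc : c ≠ 0) :
    Nonempty (Submodule.span (UK R t ℂ[T;T⁻¹]) {c • (maxProper w).mkQ (vermaGen ℂ⸨X⸩ w)}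
      ≃ₗ[UK R t ℂ[T;T⁻¹]] SimpleLu w) := by
  refine exists_linearEquiv_span ((maxNoTop w).mkQ.comp (vermaIdeal ℂ[T;T⁻¹] w).mkQ)
    ((Submodule.mkQ_surjective _).comp (Submodule.mkQ_surjective _)) _ fun u => ?_
  refine (smul_smul_eq_zero_iff u hc ((maxProper w).mkQ (vermaGen ℂ⸨X⸩ w))).trans ?_
  rw [inclU_eq, ← map_smul,
    Submodule.mkQ_apply, Submodule.Quotient.mk_eq_zero, maxProper_eq hq w,
    baseChangeU_smul_mem_nullSubmodule_iff hq w _ laurentIncl_injective, smul_vermaGen,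
    LinearMap.comp_apply, Submodule.mkQ_apply, Submodule.mkQ_apply, Submodule.Quotient.mk_eq_zero,
    maxNoTop_eq hq w]

include hq in
theorem isHighestWeightVector_simpleL :
    IsHighestWeightVector ℂ⸨X⸩ w ((maxProper w).mkQ (vermaGen ℂ⸨X⸩ w)) := by
  refine ⟨fun h => ?_, fun i r => ?_, fun h => ?_, fun ε i m => ?_⟩
  · rw [Submodule.mkQ_apply, Submodule.Quotient.mk_eq_zero, maxProper_eq hq w] at h
    exact vermaGen_notMem_nullSubmodule hq w h
  · rw [← map_smul, xPlus_smul_vermaGen, map_zero]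
  · rw [← map_smul, kEl_smul_vermaGen, map_smul]
  · rw [← map_smul, phiEl_smul_vermaGen, map_smul]

include hq in
-- The weight condition alone already confines v to the line of the generator.
theorem exists_eq_smul_of_verma {v : Verma ℂ⸨X⸩ w} (hv : IsHighestWeightVector ℂ⸨X⸩ w v) :
    ∃ c : ℂ⸨X⸩, c ≠ 0 ∧ v = c • vermaGen ℂ⸨X⸩ w := by
  have h := eq_coef_smul_vermaGen hq w hv.2.2.1
  refine ⟨_, fun h0 => hv.1 ?_, h⟩
  rw [h, h0]
  exact zero_smul ℂ⸨X⸩ (vermaGen ℂ⸨X⸩ w)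

include hq in
-- The projector attached to a lift of v fixes v, by its weight, and sends the lift to a multiple of
-- the generator.
theorem exists_eq_smul_of_simpleL {v : SimpleL w} (hv : IsHighestWeightVector ℂ⸨X⸩ w v) :
    ∃ c : ℂ⸨X⸩, c ≠ 0 ∧ v = c • (maxProper w).mkQ (vermaGen ℂ⸨X⸩ w) := by
  obtain ⟨y, rfl⟩ := Submodule.mkQ_surjective _ v
  obtain ⟨δ, hδ⟩ := R.exists_root_eq_one
  obtain ⟨p, hp, h⟩ := exists_projector hq w hδ y
  have h1 := projector_smul w (hv.2.2.1 δ) hp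
  have h2 : (maxProper w).mkQ y = coef hq w ℂ⸨X⸩ y • (maxProper w).mkQ (vermaGen ℂ⸨X⸩ w) := by
    rw [← h1, ← map_smul, h]
    rfl
  refine ⟨_, fun h0 => hv.1 ?_, h2⟩
  rw [h2, h0]
  exact zero_smul ℂ⸨X⸩ ((maxProper w).mkQ (vermaGen ℂ⸨X⸩ w))

end Forms

end QAff

open QAff in
theorem mainTheorem12 {n : ℕ} {X : SymmetrizableGCM n} {𝔥 : Type*} [AddCommGroup 𝔥] [Module ℚ 𝔥]
    (R : Realization X 𝔥) (t : ℂ) (hq : ∀ m : ℕ, 0 < m → Complex.exp t ^ m ≠ 1)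
    (w : LUWeight R t) :
    (IsHighestWeightVector ℂ⸨X⸩ w (vermaGen ℂ⸨X⸩ w) ∧
      ∀ v : Verma ℂ⸨X⸩ w, IsHighestWeightVector ℂ⸨X⸩ w v →
        IsForm (Submodule.span (UK R t ℂ[T;T⁻¹]) {v}) ∧
        Nonempty (Submodule.span (UK R t ℂ[T;T⁻¹]) {v} ≃ₗ[UK R t ℂ[T;T⁻¹]] Verma ℂ[T;T⁻¹] w)) ∧
    (IsSimpleModule (UK R t ℂ⸨X⸩) (SimpleL w) ∧
      IsHighestWeightVector ℂ⸨X⸩ w ((maxProper w).mkQ (vermaGen ℂ⸨X⸩ w)) ∧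
      ∀ v : SimpleL w, IsHighestWeightVector ℂ⸨X⸩ w v →
        IsForm (Submodule.span (UK R t ℂ[T;T⁻¹]) {v}) ∧
        Nonempty (Submodule.span (UK R t ℂ[T;T⁻¹]) {v} ≃ₗ[UK R t ℂ[T;T⁻¹]] SimpleLu w)) := by
  refine ⟨⟨isHighestWeightVector_vermaGen hq w ℂ⸨X⸩, fun v hv => ?_⟩, isSimpleModule_simpleL hq w,
    isHighestWeightVector_simpleL hq w, fun v hv => ?_⟩
  · obtain ⟨c, hc, rfl⟩ := exists_eq_smul_of_verma hq w hv
    exact ⟨isForm_verma hq w hc, exists_linearEquiv_verma hq w hc⟩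
  · obtain ⟨c, hc, rfl⟩ := exists_eq_smul_of_simpleL hq w hv
    exact ⟨isForm_simpleL hq w hc, exists_linearEquiv_simpleLu hq w hc⟩
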